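/- **Setting.** Let $d\in\{2,3\}$, let $D\subset\mathbb R^d$ be a nonempty open bounded convex polyhedron, $f\in L^2(D)$, $V=H^1_0(D)$ with $\|v\|_V=\|\nabla v\|_{L^2(D)}$. Let $U=[-1,1]^{\mathbb N}$ carry the product $\sigma$-algebra and the prior $\rho=\bigotimes_{j\ge1}du_j/2$. For $u\in U$, let $K(\cdot,u)=\bar K+\sum_{j\ge1}u_j\psi_j$ with $\bar K,\psi_j\in W^{1,\infty}(D)$, and $K^J=\bar K+\sum_{j\le J}u_j\psi_j$. Assume $\bar K_{\min}=\operatorname{ess\,inf}\bar K>0$, and that for some $\kappa,q,C>0$ $$\sum_j\|\psi_j\|_{L^\infty}\le\tfrac{\kappa}{1+\kappa}\bar K_{\min},\qquad \sum_j\|\psi_j\|_{W^{1,\infty}}<\infty,\qquad \sum_{j>J}\|\psi_j\|_{L^\infty}\le CJ^{-q}\quad(J\ge1).$$ Let $P(\cdot,u)\in V$ be the weak solution of $-\nabla\cdot(K\nabla P)=f$, $P=0$ on $\partial D$, and $P^J$ the solution with $K^J$ in place of $K$. Let $\mathcal T^0,\mathcal T^1,\dots$ be nested, shape regular, conforming simplicial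 meshes of $\overline D$, each simplex of $\mathcal T^l$ being divided into $2^d$ simplices of $\mathcal T^{l+1}$, with meshwidth $O(2^{-l})$; let $V^l\subset V$ be the space of continuous piecewise linear functions on $\mathcal T^l$, with a given basis, and $P^{J,l}(\cdot,u)\in V^l$ the Galerkin solution with coefficient $K^J$. Assume that $P\in L^\infty(U,\rho;H^2(D)\cap V)$; that $P^J(\cdot,u)$ is bounded in $H^2(D)$ uniformly in $J\ge1$ and $u\in U$; that, with constants independent of $J\ge 1$, $l\ge 0$ and $u$, the Galerkin matrices of level $l$ have $O((l+1)^{d-1}2^{dl})$ nonzero entries and $\|P^J-P^{J,l}\|_V\le C2^{-l}\|P^J\|_{H^2(D)}$. Let $\mathcal O_1,\dots,\mathcal O_k,\ell\in V^*$, $\delta\in\mathbb R^k$, and let $\Sigma\in\mathbb R^{k\times k}$ be positive definite. For a forward map $F:U\to V$ put $\Phi_F(u)=\frac12|\Sigma^{-1/2}(\delta-(\mathcal O_i(F(u)))_i)|^2$ and let $\rho_F$ be the probability measure on $U$ with density proportional to $e^{-\Phi_F}$ with respect to $\rho$; $\rho^\delta=\rho_P$. Put $J_l=2^{\lceil l/q\rceil}$,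 $P^l=P^{J_l,l}$, $\Phi^l=\Phi_{P^l}$. **Estimator.** For each $l\ge0$ let $\mathcal C_l=(u^{(n)})_{n\ge0}$ be the independence sampler on $U$: $u^{(0)}\sim\rho$; a proposal $v\sim\rho$ is accepted iff $w\le 1\wedge\exp(\Phi^l(u^{(n)})-\Phi^l(v))$, with $w$ uniform on $[0,1]$, all these draws being independent within a chain and between the chains. Let $E^l_M[g]=\frac1M\sum_{n=1}^Mg(u^{(n)})$ on $\mathcal C_l$. With $M_{ll'}=2^{2(L-l-l')}$, $A_0=1$, $A_l=1-\exp(\Phi^l-\Phi^{l-1})$ for $l\ge1$, $B_0=\ell(P^0)$, $B_{l'}=\ell(P^{l'})-\ell(P^{l'-1})$ for $l'\ge1$, and $E^{-1}_M=0$, the multilevel MCMC estimator is $$E_L=\sum_{l=0}^{L}\sum_{l'=0}^{L-l}\Big(E^l_{M_{ll'}}[A_lB_{l'}]+E^l_{M_{ll'}}[-A_l]\;E^{l-1}_{M_{ll'}}[B_{l'}]\Big).$$ Let $\mathbf E_L$ be the expectation over the independent chains. **Algorithm.** It evaluates $E_L$ term by term. Every forward solve on level $l$ assembles the Galerkin matrix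 with coefficient $K^{J_l}(\cdot,u)$ (each potentially nonzero entry by summing the contributions of $\bar K$ and of the $J_l$ terms $u_j\psi_j$, which are available) and calls a linear solver. The number of degrees of freedom $N=N_L$ is the total number of unknowns of all the linear systems solved in the run; it depends neither on the random draws nor on the solver. The solver is *linear scaling* if its result on level $l$ depends measurably on $u$, has an error at most $C2^{-l}$ in $\|\cdot\|_V$ uniformly in $u$, and needs at most $C(1+\text{number of nonzero matrix entries})$ floating point operations. **Theorem.** $\ell(P)$ is $\rho^\delta$-integrable, and there is a constant $C$, independent of $L$ (it depends on $\delta$ and the other data), such that for all $L\ge1$ the error is integrable and $$\mathbf E_L\big[\,|\mathbb E^{\rho^\delta}[\ell(P)]-E_L|\,\big]\le C\,L^2\,2^{-L}.$$ The number of degrees of freedom satisfies $N\le C L2^{2L}$ if $d=2$ and $N\le C2^{3L}$ if $d=3$ (for all $L\ge1$). As $L\to\infty$ the expected error is $O((\log N)^{3/2}N^{-1/2})$ if $d=2$ and $O((\log N)^2N^{-1/3})$ if $d=3$. Moreover, for every linear scaling solver, the algorithm returns the estimator built on the computed solutions in place of the $P^l$, this estimator satisfies the same error bounds, and the number of floating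 point operations is, for every realization, at most $CL^{d-1}2^{(d+1/q)L}$ for all $L\ge1$; in terms of $N$ it is, as $L\to\infty$ and uniformly in the realization, $O((\log N)^{-1/(2q)}N^{1+1/(2q)})$ if $d=2$ and $O((\log N)^2N^{1+1/(3q)})$ if $d=3$. -/

import Mathlib

open MeasureTheory Filter Topology
open scoped ENNReal Matrix

noncomputable section

namespace MLMCMC

/-! ### Function spaces on a domain of Euclidean space -/

/-- Euclidean space of dimension `d`. -/
abbrev E (d : ℕ) : Type := EuclideanSpace ℝ (Fin d)

/-- Test functions: smooth with compact support inside `D`. -/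
def IsTestFunction {d : ℕ} (D : Set (E d)) (φ : E d → ℝ) : Prop :=
  ContDiff ℝ (⊤ : ℕ∞) φ ∧ HasCompactSupport φ ∧ tsupport φ ⊆ D

/-- The space of square integrable scalar functions on `D`. -/
abbrev L2 {d : ℕ} (D : Set (E d)) := Lp ℝ 2 (volume.restrict D)

/-- The space of square integrable vector fields on `D`. -/
abbrev L2Vec {d : ℕ} (D : Set (E d)) := Lp (E d) 2 (volume.restrict D)

/-- The space of essentially bounded scalar functions on `D`. -/
abbrev LInf {d : ℕ} (D : Set (E d)) := Lp ℝ ∞ (volume.restrict D)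

/-- The space of essentially bounded vector fields on `D`. -/
abbrev LInfVec {d : ℕ} (D : Set (E d)) := Lp (E d) ∞ (volume.restrict D)

/-- `H¹₀(D)`: the closure of the test functions in the norm
`(‖v‖² + ‖∇v‖²)^(1/2)`. An element is a pair: the function and its weak gradient. -/
def sobolevH10 {d : ℕ} (D : Set (E d)) : Submodule ℝ (WithLp 2 (L2 D × L2Vec D)) :=
  (Submodule.span ℝ {p : WithLp 2 (L2 D × L2Vec D) | ∃ φ : E d → ℝ, IsTestFunction D φ ∧
    (p.fst : E d → ℝ) =ᵐ[volume.restrict D] φ ∧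
    (p.snd : E d → E d) =ᵐ[volume.restrict D] gradient φ}).topologicalClosure

/-- The Hilbert space `V = H¹₀(D)`. -/
abbrev V {d : ℕ} (D : Set (E d)) : Type := ↥(sobolevH10 D)

/-- The function underlying an element of `H¹₀(D)`. -/
def fn {d : ℕ} {D : Set (E d)} (v : V D) : E d → ℝ := (v.1.fst : E d → ℝ)

/-- The weak gradient of an element of `H¹₀(D)`. -/
def grad {d : ℕ} {D : Set (E d)} (v : V D) : E d → E d := (v.1.snd : E d → E d)

/-- The norm `‖v‖_V = ‖∇v‖_{L²(D)}`; it is equivalent to the norm of the ambient product space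
when `D` is bounded, so that both define the same dual space. -/
def vNorm {d : ℕ} {D : Set (E d)} (v : V D) : ℝ := ‖v.1.snd‖

/-- The vector field `G` is the weak gradient of `g` on `D`. -/
def IsWeakGradient {d : ℕ} (D : Set (E d)) (g : E d → ℝ) (G : E d → E d) : Prop :=
  ∀ φ : E d → ℝ, IsTestFunction D φ → ∀ j : Fin d,
    ∫ x in D, g x * gradient φ x j = -∫ x in D, G x j * φ x

/-- `H i` is the weak gradient of the `i`-th partial derivative of `v`, that is, `v ∈ H²(D)` with
second derivatives `H`. -/
def IsWeakHessian {d : ℕ} {D : Set (E d)} (v : V D) (H : Fin d → L2Vec D) : Prop :=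
  ∀ i : Fin d, IsWeakGradient D (fun x => grad v x i) (H i)

/-- The `H²(D)` norm of a function `v` of `H¹₀(D)` with second derivatives `H`. -/
def h2Norm {d : ℕ} {D : Set (E d)} (v : V D) (H : Fin d → L2Vec D) : ℝ :=
  Real.sqrt (‖v‖ ^ 2 + ∑ i, ‖H i‖ ^ 2)

/-! ### Weak and Galerkin solutions of `-∇·(a ∇P) = f`, `P = 0` on the boundary -/

/-- `v ∈ S` solves the variational problem posed on the subspace `S` of `H¹₀(D)`. -/
def IsGalerkinSolution {d : ℕ} {D : Set (E d)} (S : Submodule ℝ (V D)) (a : LInf D) (f : L2 D)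
    (v : V D) : Prop :=
  v ∈ S ∧ ∀ φ ∈ S, ∫ x in D, a x * inner ℝ (grad v x) (grad φ x) = ∫ x in D, f x * fn φ x

open Classical in
/-- The Galerkin solution in the subspace `S`; for `S = ⊤` this is the weak solution. (It exists
and is unique whenever `a` is bounded below by a positive constant.) -/
def galerkin {d : ℕ} {D : Set (E d)} (S : Submodule ℝ (V D)) (a : LInf D) (f : L2 D) : V D :=
  if h : ∃ v, IsGalerkinSolution S a f v then h.choose else 0

/-! ### The parameter space and the prior -/

/-- `U = [-1,1]^ℕ`; the coordinate `u_j`, `j ≥ 1`, of the literature is `u (j - 1)`. -/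
abbrev Param : Type := ℕ → Set.Icc (-1 : ℝ) 1

/-- The uniform distribution on `[-1,1]`. -/
def uniformIcc : Measure (Set.Icc (-1 : ℝ) 1) := 
  (2⁻¹ : ℝ≥0∞) • Measure.comap Subtype.val (volume : Measure ℝ)

instance : IsProbabilityMeasure uniformIcc where
  measure_univ := by
    have h : Measure.comap (Subtype.val : Set.Icc (-1 : ℝ) 1 → ℝ) volume Set.univ = 2 := by
      rw [comap_subtype_coe_apply measurableSet_Icc, Set.image_univ, Subtype.range_coe,
        Real.volume_Icc]
      norm_num
    rw [uniformIcc, Measure.smul_apply, h, smul_eq_mul]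
    exact ENNReal.inv_mul_cancel (by norm_num) (by norm_num)

/-- The prior `ρ = ⨂ du_j / 2`. -/
def prior : Measure Param := Measure.infinitePi fun _ : ℕ => uniformIcc

instance : IsProbabilityMeasure prior := by
  unfold prior; infer_instance

/-! ### The inverse problem -/

/-- The data of the elliptic Bayesian inverse problem: the domain, the coefficient functions of
`K = K̄ + ∑ u_j ψ_j` (with `ψ j` for `ψ_{j+1}`), the source, the observation functionals, the
covariance of the Gaussian noise, the observed data, and the quantity of interest. -/
structure Problem (d k : ℕ) where
  D : Set (E d)
  Kbar : LInf D
  ψ : ℕ → LInf D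
  f : L2 D
  obs : Fin k → (V D →L[ℝ] ℝ)
  cov : Matrix (Fin k) (Fin k) ℝ
  data : Fin k → ℝ
  qoi : V D →L[ℝ] ℝ

namespace Problem

variable {d k : ℕ} (P : Problem d k)

/-- The domain is a nonempty, open, bounded, convex polyhedron. -/
def ConvexPolyhedralDomain : Prop :=
  P.D.Nonempty ∧ ∃ s : Set (E d), s.Finite ∧ P.D = interior (convexHull ℝ s)

/-- The coefficient `K(·,u)`. -/
def coeff (u : Param) : LInf P.D := P.Kbar + ∑' j, (u j : ℝ) • P.ψ j

/-- The truncated coefficient `K^J(·,u)`. -/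
def coeffTrunc (J : ℕ) (u : Param) : LInf P.D :=
  P.Kbar + ∑ j ∈ Finset.range J, (u j : ℝ) • P.ψ j

/-- The forward map `u ↦ P(·,u)`. -/
def solution (u : Param) : V P.D := galerkin ⊤ (P.coeff u) P.f

/-- The solution `P^J(·,u)` of the problem with truncated coefficient. -/
def solutionTrunc (J : ℕ) (u : Param) : V P.D := galerkin ⊤ (P.coeffTrunc J u) P.f

/-- `∑ ‖ψ_j‖_∞ ≤ κ/(1+κ) ess inf K̄`, with `ess inf K̄ > 0`. -/
def EllipticityAssumption (κ : ℝ) : Prop :=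
  0 < essInf P.Kbar (volume.restrict P.D) ∧ Summable (fun j => ‖P.ψ j‖) ∧
    ∑' j, ‖P.ψ j‖ ≤ κ / (1 + κ) * essInf P.Kbar (volume.restrict P.D)

/-- `K̄` and the `ψ_j` lie in `W^{1,∞}(D)`, the `W^{1,∞}`-norms of the `ψ_j` are summable, and
`∑_{j>J} ‖ψ_j‖_∞ ≤ C J^{-q}`. -/
def DecayAssumption (q : ℝ) : Prop :=
  (∃ G : LInfVec P.D, IsWeakGradient P.D P.Kbar G) ∧
  (∃ G : ℕ → LInfVec P.D, (∀ j, IsWeakGradient P.D (P.ψ j) (G j)) ∧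
    Summable fun j => ‖P.ψ j‖ + ‖G j‖) ∧
  ∃ C : ℝ, ∀ J : ℕ, 1 ≤ J → ∑' j, ‖P.ψ (J + j)‖ ≤ C * (J : ℝ) ^ (-q)

/-- `P ∈ L^∞(U, ρ; H²(D) ∩ V)`. -/
def RegularityAssumption : Prop :=
  ∃ B : ℝ, ∀ᵐ u ∂prior, ∃ H, IsWeakHessian (P.solution u) H ∧ h2Norm (P.solution u) H ≤ B

/-- The Bayesian potential `Φ(u;δ) = ½ |Σ^{-1/2}(δ - 𝒪(F(u)))|²` built on a forward map `F`. -/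
def potential (F : Param → V P.D) (u : Param) : ℝ :=
  1 / 2 * ((fun i => P.data i - P.obs i (F u)) ⬝ᵥ
    (P.cov⁻¹ *ᵥ fun i => P.data i - P.obs i (F u)))

/-- The posterior with density proportional to `exp(-Φ)` with respect to the prior. -/
def posterior (F : Param → V P.D) : Measure Param :=
  prior.tilted fun u => -P.potential F u

/-- The quantity to be estimated, `𝔼^{ρ^δ}[ℓ(P)]`. -/
def target : ℝ := ∫ u, P.qoi (P.solution u) ∂P.posterior P.solution

end Problem

/-! ### The independence sampler -/

/-- The random input of one chain: the initial state, and for each step a proposal and a uniform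
random number. -/
abbrev Noise : Type := Param × (ℕ → Param × unitInterval)

/-- Initial state `∼ ρ`, i.i.d. proposals `∼ ρ`, i.i.d. uniform numbers, all independent. -/
def noiseLaw : Measure Noise :=
  prior.prod (Measure.infinitePi fun _ : ℕ => prior.prod (volume : Measure unitInterval))

instance : IsProbabilityMeasure noiseLaw := by
  unfold noiseLaw; infer_instance

/-- Independent random inputs for the chains `𝒞_0, 𝒞_1, …` of the different levels. -/
def noisesLaw : Measure (ℕ → Noise) := Measure.infinitePi fun _ : ℕ => noiseLaw

/-- The states of the chain with potential `Φ`: the proposal `v` is accepted if and only if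
`w ≤ 1 ∧ exp(Φ(u) - Φ(v))`. -/
def chain (Φ : Param → ℝ) (ω : Noise) : ℕ → Param
  | 0 => ω.1
  | n + 1 =>
    if ((ω.2 n).2 : ℝ) ≤ min 1 (Real.exp (Φ (chain Φ ω n) - Φ (ω.2 n).1)) then (ω.2 n).1
    else chain Φ ω n

/-- The sample average of `g` over the states number `1, …, M` of the chain. -/
def sampleAverage (Φ : Param → ℝ) (ω : Noise) (M : ℕ) (g : Param → ℝ) : ℝ :=
  (∑ n ∈ Finset.range M, g (chain Φ ω (n + 1))) / M

/-- The sample sizes `M_{ll'} = 2^{2(L-(l+l'))}` for `l + l' ≤ L`. -/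
def sampleSize (L l l' : ℕ) : ℕ := 2 ^ (2 * (L - (l + l')))

/-! ### The multilevel estimator

`Q l` is the approximate forward map on level `l`. The estimator of depth `L` reads the inputs of
the chains `0, …, L` only. Conventions on level `0`: the approximation on level `-1` of the forward
map is zero, and expectations under the posterior on level `-1` vanish. -/

namespace Problem

variable {d k : ℕ} (P : Problem d k) (Q : ℕ → Param → V P.D)

/-- `1 - exp(Φ^l - Φ^{l-1})`, which is `1` for `l = 0`. -/
def weight : ℕ → Param → ℝ
  | 0, _ => 1
  | l + 1, u => 1 - Real.exp (P.potential (Q (l + 1)) u - P.potential (Q l) u)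

/-- `ℓ(P^l) - ℓ(P^{l-1})`, which is `ℓ(P^0)` for `l = 0`. -/
def increment : ℕ → Param → ℝ
  | 0, u => P.qoi (Q 0 u)
  | l + 1, u => P.qoi (Q (l + 1) u) - P.qoi (Q l u)

/-- The sample average over the chain of level `l - 1`; zero for `l = 0`. -/
def coarserAverage (ω : ℕ → Noise) (M : ℕ) (g : Param → ℝ) : ℕ → ℝ
  | 0 => 0
  | l + 1 => sampleAverage (P.potential (Q l)) (ω l) M g

/-- The multilevel Markov chain Monte Carlo estimator with `L'(l) = L - l`. -/
def estimator (L : ℕ) (ω : ℕ → Noise) : ℝ :=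
  ∑ l ∈ Finset.range (L + 1), ∑ l' ∈ Finset.range (L - l + 1),
    (sampleAverage (P.potential (Q l)) (ω l) (sampleSize L l l')
        (fun u => P.weight Q l u * P.increment Q l' u) +
      sampleAverage (P.potential (Q l)) (ω l) (sampleSize L l l') (fun u => -P.weight Q l u) *
        P.coarserAverage Q ω (sampleSize L l l') (P.increment Q l') l)

/-- The absolute error of the estimator. -/
def absError (L : ℕ) (ω : ℕ → Noise) : ℝ := |P.target - P.estimator Q L ω|

/-- The expected absolute error of the estimator. -/
def meanError (L : ℕ) : ℝ := ∫ ω, P.absError Q L ω ∂noisesLaw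

end Problem

/-! ### Finite elements -/

/-- The `d`-dimensional simplices of a simplicial complex, given by their vertices. -/
def cells {d : ℕ} (K : Geometry.SimplicialComplex ℝ (E d)) : Set (Finset (E d)) :=
  {s | s ∈ K.faces ∧ s.card = d + 1}

/-- A nested, shape regular sequence of simplicial meshes of `D`: each simplex is divided into
`2^d` simplices of the next mesh, and the meshwidth is `O(2^{-l})`. -/
structure NestedMeshes {d : ℕ} (D : Set (E d)) where
  mesh : ℕ → Geometry.SimplicialComplex ℝ (E d)
  finite : ∀ l, (mesh l).faces.Finite
  covers : ∀ l, (mesh l).space = closure D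
  nested : ∀ l, ∀ s ∈ cells (mesh (l + 1)), ∃ t ∈ cells (mesh l),
    convexHull ℝ (s : Set (E d)) ⊆ convexHull ℝ (t : Set (E d))
  children : ∀ l, ∀ t ∈ cells (mesh l),
    {s ∈ cells (mesh (l + 1)) |
      convexHull ℝ (s : Set (E d)) ⊆ convexHull ℝ (t : Set (E d))}.ncard = 2 ^ d
  meshwidth : ∃ h₀ : ℝ, ∀ l, ∀ s ∈ cells (mesh l),
    Metric.diam (convexHull ℝ (s : Set (E d))) ≤ h₀ / 2 ^ l
  shapeRegular : ∃ γ : ℝ, 0 < γ ∧ ∀ l, ∀ s ∈ cells (mesh l), ∃ x : E d,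
    Metric.closedBall x (γ * Metric.diam (convexHull ℝ (s : Set (E d)))) ⊆
      convexHull ℝ (s : Set (E d))

/-- `V^l`: the elements of `H¹₀(D)` which are affine on each simplex of the mesh. -/
def feSpace {d : ℕ} {D : Set (E d)} (T : NestedMeshes D) (l : ℕ) : Submodule ℝ (V D) where
  carrier := {v | ∀ s ∈ cells (T.mesh l), ∃ (a : ℝ) (b : E d),
    ∀ᵐ x ∂(volume.restrict D), x ∈ convexHull ℝ (s : Set (E d)) → fn v x = a + inner ℝ b x}
  zero_mem' := by
    intro s _
    refine ⟨0, 0, ?_⟩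
    filter_upwards [Lp.coeFn_zero ℝ 2 (volume.restrict D)] with x hx _
    have e : fn (0 : V D) x = 0 := hx
    simp [e]
  add_mem' := by
    intro v w hv hw s hs
    obtain ⟨a, b, h⟩ := hv s hs
    obtain ⟨a', b', h'⟩ := hw s hs
    refine ⟨a + a', b + b', ?_⟩
    filter_upwards [h, h', Lp.coeFn_add v.1.fst w.1.fst] with x h1 h2 h3 hx
    have e : fn (v + w) x = fn v x + fn w x := h3
    rw [e, h1 hx, h2 hx, inner_add_left]
    ring
  smul_mem' := by
    intro c v hv s hs
    obtain ⟨a, b, h⟩ := hv s hs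
    refine ⟨c * a, c • b, ?_⟩
    filter_upwards [h, Lp.coeFn_smul c v.1.fst] with x h1 h2 hx
    have e : fn (c • v) x = c * fn v x := h2
    rw [e, h1 hx, real_inner_smul_left]
    ring

/-- A finite element discretization: nested meshes and a basis of each space `V^l`. -/
structure Discretization {d k : ℕ} (P : Problem d k) where
  meshes : NestedMeshes P.D
  dim : ℕ → ℕ
  basis : ∀ l, Module.Basis (Fin (dim l)) ℝ (feSpace meshes l)

/-- The number of nonzero entries of a matrix. -/
def nnz {n : ℕ} (A : Matrix (Fin n) (Fin n) ℝ) : ℕ :=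
  {p : Fin n × Fin n | A p.1 p.2 ≠ 0}.ncard

/-- The truncation level `J_l = 2^{⌈l/q⌉}`. -/
def truncLevel (q : ℝ) (l : ℕ) : ℕ := 2 ^ ⌈(l : ℝ) / q⌉₊

namespace Discretization

variable {d k : ℕ} {P : Problem d k} (X : Discretization P)

/-- The basis functions `w^l_i`. -/
def w (l : ℕ) (i : Fin (X.dim l)) : V P.D := (X.basis l i : V P.D)

/-- The Galerkin solution `P^{J,l}(·,u)`. -/
def feSolution (J l : ℕ) (u : Param) : V P.D :=
  galerkin (feSpace X.meshes l) (P.coeffTrunc J u) P.f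

/-- The matrix `∫ a ∇w_i · ∇w_j` of the form with coefficient `a`. -/
def formMatrix (l : ℕ) (a : LInf P.D) : Matrix (Fin (X.dim l)) (Fin (X.dim l)) ℝ :=
  fun i j => ∫ x in P.D, a x * inner ℝ (grad (X.w l j) x) (grad (X.w l i) x)

/-- The matrix of the Galerkin problem with truncated coefficient. -/
def stiffness (J l : ℕ) (u : Param) : Matrix (Fin (X.dim l)) (Fin (X.dim l)) ℝ :=
  X.formMatrix l (P.coeffTrunc J u)

/-- The load vector `∫ f w_i`. -/
def load (l : ℕ) : Fin (X.dim l) → ℝ := fun i => ∫ x in P.D, P.f x * fn (X.w l i) x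

/-- The finite element assumption: the solutions `P^J(·,u)` are bounded in `H²(D) ∩ H¹₀(D)`,
uniformly in `J` and `u`; the stiffness matrices have `O(l^{d-1} 2^{dl})` nonzero entries; and
`‖P^J - P^{J,l}‖_V ≤ C 2^{-l} ‖P^J‖_{H²}`. -/
structure FEAssumption : Prop where
  regular : ∃ B : ℝ, ∀ J : ℕ, 1 ≤ J → ∀ u : Param, ∃ H,
    IsWeakHessian (P.solutionTrunc J u) H ∧ h2Norm (P.solutionTrunc J u) H ≤ B
  sparse : ∃ C : ℝ, ∀ J : ℕ, 1 ≤ J → ∀ (l : ℕ) (u : Param),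
    (nnz (X.stiffness J l u) : ℝ) ≤ C * ((l : ℝ) + 1) ^ (d - 1) * 2 ^ (d * l)
  accurate : ∃ C : ℝ, ∀ J : ℕ, 1 ≤ J → ∀ (l : ℕ) (u : Param) (H : Fin d → L2Vec P.D),
    IsWeakHessian (P.solutionTrunc J u) H →
      vNorm (P.solutionTrunc J u - X.feSolution J l u) ≤
        C / 2 ^ l * h2Norm (P.solutionTrunc J u) H

/-- The hierarchy `P^{J_l,l}` of exact Galerkin solutions. -/
def levels (q : ℝ) (l : ℕ) (u : Param) : V P.D := X.feSolution (truncLevel q l) l u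

end Discretization

/-- A solver for the linear systems on the levels `l`: for a matrix and a right hand side it
returns an approximate solution and reports the number of floating point operations used. -/
structure Solver {d k : ℕ} {P : Problem d k} (X : Discretization P) where
  solve : ∀ l, Matrix (Fin (X.dim l)) (Fin (X.dim l)) ℝ → (Fin (X.dim l) → ℝ) → Fin (X.dim l) → ℝ
  flops : ∀ l, Matrix (Fin (X.dim l)) (Fin (X.dim l)) ℝ → (Fin (X.dim l) → ℝ) → ℕ

namespace Solver

variable {d k : ℕ} {P : Problem d k} {X : Discretization P} (S : Solver X)

/-- The coefficients of the computed solution on level `l`. -/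
def coeffs (q : ℝ) (l : ℕ) (u : Param) : Fin (X.dim l) → ℝ :=
  S.solve l (X.stiffness (truncLevel q l) l u) (X.load l)

/-- The computed solution on level `l`. -/
def levels (q : ℝ) (l : ℕ) (u : Param) : V P.D := ∑ i, S.coeffs q l u i • X.w l i

/-- A linear scaling solver: on level `l` it stops with an error `O(2^{-l})`, after a number of
operations which is proportional to the number of nonzero entries of the matrix. -/
structure IsLinearScaling (q : ℝ) : Prop where
  measurable : ∀ l, Measurable (S.coeffs q l)
  accurate : ∃ C : ℝ, ∀ (l : ℕ) (u : Param),
    vNorm (X.levels q l u - S.levels q l u) ≤ C / 2 ^ l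
  linear : ∃ C : ℝ, ∀ (l : ℕ) (u : Param),
    (S.flops l (X.stiffness (truncLevel q l) l u) (X.load l) : ℝ) ≤
      C * (1 + nnz (X.stiffness (truncLevel q l) l u))

end Solver

/-! ### Computations with a count of floating point operations and of degrees of freedom -/

/-- The result of a computation, the number of floating point operations that were carried out, and
the total number of unknowns of the linear systems that were solved. -/
structure Counted (α : Type) where
  val : α
  flops : ℕ
  dofs : ℕ

namespace Counted

instance : Monad Counted where
  pure a := ⟨a, 0, 0⟩
  bind x f := ⟨(f x.val).val, x.flops + (f x.val).flops, x.dofs + (f x.val).dofs⟩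

/-- One floating point operation (`+`, `-`, `*`, `/`, `exp`, `min` or a comparison). -/
def flop {α : Type} (x : α) : Counted α := ⟨x, 1, 0⟩

/-- A sum: one addition for each summand, besides the cost of computing the summands. -/
def sum {ι : Type} (s : Finset ι) (g : ι → Counted ℝ) : Counted ℝ :=
  ⟨∑ i ∈ s, (g i).val, ∑ i ∈ s, ((g i).flops + 1), ∑ i ∈ s, (g i).dofs⟩

open Classical in
/-- A table: the entries with index in `s` are computed, the others are set to zero. -/
def table {ι : Type} (s : Finset ι) (g : ι → Counted ℝ) : Counted (ι → ℝ) :=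
  ⟨fun i => if i ∈ s then (g i).val else 0, ∑ i ∈ s, (g i).flops, ∑ i ∈ s, (g i).dofs⟩

end Counted

namespace Solver

open Counted

variable {d k : ℕ} {P : Problem d k} {X : Discretization P} (S : Solver X) (q : ℝ)

open Classical in
/-- The positions at which the stiffness matrix of level `l` can have a nonzero entry. -/
def pattern (l : ℕ) : Finset (Fin (X.dim l) × Fin (X.dim l)) :=
  {p | ∃ u : Param, X.stiffness (truncLevel q l) l u p.1 p.2 ≠ 0}

/-- Assembly of the stiffness matrix: each entry of the pattern is computed by summing up the
contributions of `K̄` and of the `J_l` terms `u_j ψ_j`, where the contributions of the individual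
coefficient functions are available. -/
def assemble (l : ℕ) (u : Param) : Counted (Fin (X.dim l) × Fin (X.dim l) → ℝ) :=
  table (pattern (X := X) q l) fun p => do
    let t ← sum (Finset.range (truncLevel q l)) fun j =>
      flop ((u j : ℝ) * X.formMatrix l (P.ψ j) p.1 p.2)
    flop (X.formMatrix l P.Kbar p.1 p.2 + t)

/-- The forward solve on level `l`. -/
def forward (l : ℕ) (u : Param) : Counted (Fin (X.dim l) → ℝ) := do
  let A ← assemble (X := X) q l u
  ⟨S.solve l (fun i j => A (i, j)) (X.load l), S.flops l (fun i j => A (i, j)) (X.load l), X.dim l⟩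

/-- The value of a linear functional at a finite element function with given coefficients. -/
def applyFunctional (l : ℕ) (F : V P.D →L[ℝ] ℝ) (x : Fin (X.dim l) → ℝ) : Counted ℝ :=
  sum Finset.univ fun i => flop (x i * F (X.w l i))

/-- Computation of the potential `Φ^{J_l,l}`. -/
def runPotential (l : ℕ) (u : Param) : Counted ℝ := do
  let x ← S.forward q l u
  let r ← table (Finset.univ : Finset (Fin k)) fun i => do
    let y ← applyFunctional l (P.obs i) x
    flop (P.data i - y)
  let s ← sum Finset.univ fun i => do
    let t ← sum Finset.univ fun j => flop (P.cov⁻¹ i j * r j)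
    flop (r i * t)
  flop (1 / 2 * s)

/-- Computation of the quantity of interest `ℓ(P^{J_l,l})`. -/
def runQoi (l : ℕ) (u : Param) : Counted ℝ := do
  let x ← S.forward q l u
  applyFunctional l P.qoi x

/-- Computation of `1 - exp(Φ^l - Φ^{l-1})`. -/
def runWeight : ℕ → Param → Counted ℝ
  | 0, _ => pure 1
  | l + 1, u => do
    let p ← S.runPotential q (l + 1) u
    let p' ← S.runPotential q l u
    let t ← flop (p - p')
    let e ← flop (Real.exp t)
    flop (1 - e)

/-- Computation of `ℓ(P^l) - ℓ(P^{l-1})`. -/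
def runIncrement : ℕ → Param → Counted ℝ
  | 0, u => S.runQoi q 0 u
  | l + 1, u => do
    let y ← S.runQoi q (l + 1) u
    let y' ← S.runQoi q l u
    flop (y - y')

/-- `M` steps of the chain of level `l`. Returned are the current state, its potential, and the sum
of the values of `g` at the states visited after the initial one. -/
def runChain (l : ℕ) (ω : Noise) (g : Param → Counted ℝ) : ℕ → Counted (Param × ℝ × ℝ)
  | 0 => do
    let p ← S.runPotential q l ω.1
    pure (ω.1, p, 0)
  | n + 1 => do
    let z ← runChain l ω g n
    let p ← S.runPotential q l (ω.2 n).1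
    let t ← flop (z.2.1 - p)
    let e ← flop (Real.exp t)
    let a ← flop (min 1 e)
    let y ← flop (if ((ω.2 n).2 : ℝ) ≤ a then ((ω.2 n).1, p) else (z.1, z.2.1))
    let v ← g y.1
    let s ← flop (z.2.2 + v)
    pure (y.1, y.2, s)

/-- Computation of a sample average over `M` steps of the chain of level `l`. -/
def runAverage (l : ℕ) (ω : Noise) (M : ℕ) (g : Param → Counted ℝ) : Counted ℝ := do
  let z ← S.runChain q l ω g M
  flop (z.2.2 / M)

/-- Computation of the term with indices `l, l'` of the estimator. -/
def runTerm (L : ℕ) (ω : ℕ → Noise) (l' : ℕ) : ℕ → Counted ℝ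
  | 0 => S.runAverage q 0 (ω 0) (sampleSize L 0 l') fun u => S.runIncrement q l' u
  | l + 1 => do
    let a ← S.runAverage q (l + 1) (ω (l + 1)) (sampleSize L (l + 1) l') fun u => do
      let A ← S.runWeight q (l + 1) u
      let B ← S.runIncrement q l' u
      flop (A * B)
    let b ← S.runAverage q (l + 1) (ω (l + 1)) (sampleSize L (l + 1) l') fun u => do
      let A ← S.runWeight q (l + 1) u
      flop (-A)
    let c ← S.runAverage q l (ω l) (sampleSize L (l + 1) l') fun u => S.runIncrement q l' u
    let bc ← flop (b * c)
    flop (a + bc)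

/-- The multilevel Markov chain Monte Carlo algorithm. -/
def run (L : ℕ) (ω : ℕ → Noise) : Counted ℝ :=
  sum (Finset.range (L + 1)) fun l =>
    sum (Finset.range (L - l + 1)) fun l' => S.runTerm q L ω l' l

end Solver

end MLMCMC

end

open MLMCMC

/-!
The error of the estimator splits into a bias and a sampling error.

*Bias.* Uniform ellipticity bounds all Galerkin solutions, hence all potentials, and truncation of
the coefficient and discretization both cost `O(2^(-l))` on level `l` (`exists_vNorm_levels_le`).
The weights and the increments are therefore `O(2^(-l))`. The expectations of the terms of the
estimator telescope over both levels (`integral_gibbs_sub`, `sum_levelDiff`,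
`sum_levelDiff_increment`), and what is left over are the pairs of levels with `l + l' > L`.

*Sampling error.* As the potentials are bounded, every proposal is accepted with a probability
bounded below. This is a Doeblin condition: one step of the sampler contracts the oscillation of
functions (`trans_mem_Icc`), the Poisson equation has bounded solutions (`exists_poisson`), and the
error of a sample average over `M` steps is a martingale divided by `M` up to a boundary term
`O(1/M)` (`sampleAverage_sub_eq`). In dimension two the rate `(log N)^(3/2) N^(-1/2)` is of the order
`L 2^(-L)`, which is better by a factor `L` than the sum of the `O(L^2)` individual root mean square
errors of size `2^(-L)`. The factor is gained by orthogonality. The averages that use one chain run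
over nested samples, so that their martingale parts combine into a single martingale whose second
moment grows only linearly in their number (`exists_nested_decomposition`), and different chains are
independent (`integral_abs_multilevel_le`). The products of two sampling errors from different
chains are of higher order (`Problem.integral_abs_mul_le`).

*Degrees of freedom.* The rates in terms of `N` need bounds of `N` from both sides, and so bounds of
the dimension of the finite element space from both sides by multiples of `2^(dl)`. From above, a
finite element function is determined by its affine pieces, because an element of `H¹₀` with
vanishing function has vanishing gradient (`card_basis_le`). From below, the nodal functions of
vertices well inside the domain are linearly independent elements of the space
(`exists_le_card_basis`); that they belong to `H¹₀` is seen by mollification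
(`exists_fn_ae_eq_of_lipschitz`).

*Operations.* The entries of the stiffness matrix are affine in the parameters. For a generic
parameter all entries of the assembled pattern are nonzero, so that the pattern obeys the sparsity
bound of the individual matrices (`Solver.exists_card_pattern_le`). A forward solve on level `l`
then costs `O((l+1)^(d-1) 2^((d+1/q)l))`, and since `d + 1/q > 2`, the sum over all samples and levels
is dominated by the finest level.
-/

noncomputable section

namespace MLMCMC

/-! ### The independence sampler: Doeblin contraction and the Poisson equation -/

/-- The law of the random input of one step: a proposal and a uniform random number. -/
def proposalLaw : Measure (Param × unitInterval) := prior.prod volume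

instance : IsProbabilityMeasure proposalLaw := by
  unfold proposalLaw; infer_instance

/-- The acceptance probability of the proposal `v` in the state `u`. -/
def acceptance (Φ : Param → ℝ) (u v : Param) : ℝ := min 1 (Real.exp (Φ u - Φ v))

/-- One step of the independence sampler. -/
def step (Φ : Param → ℝ) (u : Param) (z : Param × unitInterval) : Param :=
  if (z.2 : ℝ) ≤ acceptance Φ u z.1 then z.1 else u

/-- The Markov operator of the independence sampler. -/
def trans (Φ h : Param → ℝ) (u : Param) : ℝ := ∫ z, h (step Φ u z) ∂proposalLaw

/-- The probability measure with density proportional to `exp (-Φ)` with respect to the prior. -/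
def gibbs (Φ : Param → ℝ) : Measure Param := prior.tilted fun u => -Φ u

lemma acceptance_nonneg (Φ : Param → ℝ) (u v : Param) : 0 ≤ acceptance Φ u v :=
  le_min zero_le_one (Real.exp_pos _).le

lemma acceptance_le_one (Φ : Param → ℝ) (u v : Param) : acceptance Φ u v ≤ 1 := min_le_left _ _

lemma le_acceptance {Φ : Param → ℝ} {B : ℝ} (h0 : ∀ u, 0 ≤ Φ u) (hB : ∀ u, Φ u ≤ B)
    (u v : Param) : Real.exp (-B) ≤ acceptance Φ u v := by
  have hB0 : 0 ≤ B := (h0 u).trans (hB u)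
  refine le_min (Real.exp_le_one_iff.2 (by linarith)) (Real.exp_le_exp.2 ?_)
  linarith [h0 u, hB v]

lemma measurable_acceptance {Φ : Param → ℝ} (hΦ : Measurable Φ) :
    Measurable fun p : Param × Param => acceptance Φ p.1 p.2 := by
  unfold acceptance
  exact measurable_const.min ((hΦ.comp measurable_fst).sub (hΦ.comp measurable_snd)).exp

lemma measurable_step {Φ : Param → ℝ} (hΦ : Measurable Φ) :
    Measurable fun p : Param × (Param × unitInterval) => step Φ p.1 p.2 := by
  unfold step
  refine Measurable.ite (measurableSet_le ?_ ?_) (by fun_prop) (by fun_prop)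
  · fun_prop
  · exact (measurable_acceptance hΦ).comp (f := fun p : Param × (Param × unitInterval) =>
      (p.1, p.2.1)) (by fun_prop)

/-- A measurable function with values in a bounded interval is integrable against a probability
measure. -/
lemma integrable_of_bounds {α : Type*} [MeasurableSpace α] {μ : Measure α} [IsFiniteMeasure μ]
    {h : α → ℝ} (hm : Measurable h) {c : ℝ} (hc : ∀ u, |h u| ≤ c) : Integrable h μ :=
  Integrable.of_bound hm.aestronglyMeasurable c (Eventually.of_forall hc)

lemma abs_integral_le_of_abs_le {α : Type*} [MeasurableSpace α] {μ : Measure α}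
    [IsProbabilityMeasure μ] {h : α → ℝ} {c : ℝ} (hc : ∀ u, |h u| ≤ c) : |∫ u, h u ∂μ| ≤ c := by
  have := norm_integral_le_of_norm_le_const (μ := μ) (f := h) (Eventually.of_forall hc)
  simpa using this

lemma integral_unitInterval_ite {a : ℝ} (h0 : 0 ≤ a) (h1 : a ≤ 1) (x y : ℝ) :
    ∫ w : unitInterval, (if (w : ℝ) ≤ a then x else y) = a * x + (1 - a) * y := by
  have hs : MeasurableSet {w : unitInterval | (w : ℝ) ≤ a} :=
    measurableSet_le (by fun_prop) measurable_const
  have hv : volume.real {w : unitInterval | (w : ℝ) ≤ a} = a := by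
    have : {w : unitInterval | (w : ℝ) ≤ a} = Set.Iic (⟨a, h0, h1⟩ : unitInterval) := rfl
    rw [this, Measure.real, unitInterval.volume_Iic, ENNReal.toReal_ofReal h0]
  have : (fun w : unitInterval => if (w : ℝ) ≤ a then x else y) =
      fun w => {w : unitInterval | (w : ℝ) ≤ a}.indicator (fun _ => x - y) w + y := by
    ext w
    by_cases hw : (w : ℝ) ≤ a <;> simp [hw]
  rw [this, integral_add ((integrable_const _).indicator hs) (integrable_const _),
    integral_indicator_const _ hs, hv]
  simp
  ring

lemma trans_eq {Φ h : Param → ℝ} (hΦ : Measurable Φ) (hh : Measurable h) {c : ℝ}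
    (hc : ∀ u, |h u| ≤ c) (u : Param) :
    trans Φ h u = ∫ v, (acceptance Φ u v * h v + (1 - acceptance Φ u v) * h u) ∂prior := by
  unfold trans proposalLaw
  rw [integral_prod]
  · refine integral_congr_ae (Eventually.of_forall fun v => ?_)
    simp only
    rw [← integral_unitInterval_ite (acceptance_nonneg Φ u v) (acceptance_le_one Φ u v)]
    refine integral_congr_ae (Eventually.of_forall fun w => ?_)
    simp only [step]
    split_ifs <;> rfl
  · exact integrable_of_bounds (hh.comp ((measurable_step hΦ).comp
      (f := fun z : Param × unitInterval => (u, z)) (by fun_prop))) (fun z => hc _)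

lemma measurable_trans {Φ h : Param → ℝ} (hΦ : Measurable Φ) (hh : Measurable h) :
    Measurable (trans Φ h) := by
  unfold trans
  exact (StronglyMeasurable.integral_prod_right'
    (f := fun p : Param × (Param × unitInterval) => h (step Φ p.1 p.2))
    (hh.comp (measurable_step hΦ)).stronglyMeasurable).measurable

lemma abs_trans_le {Φ h : Param → ℝ} {c : ℝ} (hc : ∀ u, |h u| ≤ c) (u : Param) :
    |trans Φ h u| ≤ c := abs_integral_le_of_abs_le fun _ => hc _

lemma integrable_exp_neg {Φ : Param → ℝ} (hΦ : Measurable Φ) (h0 : ∀ u, 0 ≤ Φ u) :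
    Integrable (fun u => Real.exp (-Φ u)) prior :=
  integrable_of_bounds hΦ.neg.exp (c := 1) fun u => by
    rw [abs_of_pos (Real.exp_pos _)]
    exact Real.exp_le_one_iff.2 (by linarith [h0 u])

lemma isProbabilityMeasure_gibbs {Φ : Param → ℝ} (hΦ : Measurable Φ) (h0 : ∀ u, 0 ≤ Φ u) :
    IsProbabilityMeasure (gibbs Φ) :=
  isProbabilityMeasure_tilted (integrable_exp_neg hΦ h0)

lemma integral_gibbs (Φ h : Param → ℝ) :
    ∫ u, h u ∂gibbs Φ = (∫ u, Real.exp (-Φ u) ∂prior)⁻¹ * ∫ u, Real.exp (-Φ u) * h u ∂prior := by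
  unfold gibbs
  rw [integral_tilted, ← integral_const_mul]
  refine integral_congr_ae (Eventually.of_forall fun u => ?_)
  simp only [smul_eq_mul]
  ring

/-- The sampler is reversible with respect to `gibbs Φ`, which is therefore invariant. -/
lemma integral_trans_gibbs {Φ h : Param → ℝ} (hΦ : Measurable Φ) (h0 : ∀ u, 0 ≤ Φ u)
    (hh : Measurable h) {c : ℝ} (hc : ∀ u, |h u| ≤ c) :
    ∫ u, trans Φ h u ∂gibbs Φ = ∫ u, h u ∂gibbs Φ := by
  have hexp : ∀ u, |Real.exp (-Φ u)| ≤ 1 := fun u => by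
    rw [abs_of_pos (Real.exp_pos _)]
    exact Real.exp_le_one_iff.2 (by linarith [h0 u])
  have hacc : ∀ u v, |acceptance Φ u v| ≤ 1 := fun u v => by
    rw [abs_of_nonneg (acceptance_nonneg _ _ _)]; exact acceptance_le_one _ _ _
  have hc0 : 0 ≤ c := (abs_nonneg _).trans (hc (fun _ => ⟨0, by simp⟩))
  -- the detailed balance weight
  set S : Param → Param → ℝ := fun u v => Real.exp (-Φ u) * acceptance Φ u v with hS
  have hsymm : ∀ u v, S u v = S v u := by
    intro u v
    simp only [hS, acceptance, mul_min_of_nonneg _ _ (Real.exp_pos _).le, ← Real.exp_add]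
    rw [min_comm]
    congr 1 <;> ring_nf
  have hSm : Measurable fun p : Param × Param => S p.1 p.2 :=
    (hΦ.comp measurable_fst).neg.exp.mul (measurable_acceptance hΦ)
  have hSb : ∀ u v, |S u v| ≤ 1 := fun u v => by
    rw [hS, abs_mul]; exact mul_le_one₀ (hexp u) (abs_nonneg _) (hacc u v)
  have hI1 : Integrable (fun p : Param × Param => S p.1 p.2 * h p.2) (prior.prod prior) :=
    integrable_of_bounds (hSm.mul (hh.comp measurable_snd)) (c := 1 * c) fun p => by
      rw [abs_mul]; exact mul_le_mul (hSb _ _) (hc _) (abs_nonneg _) zero_le_one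
  have hI2 : Integrable (fun p : Param × Param => S p.1 p.2 * h p.1) (prior.prod prior) :=
    integrable_of_bounds (hSm.mul (hh.comp measurable_fst)) (c := 1 * c) fun p => by
      rw [abs_mul]; exact mul_le_mul (hSb _ _) (hc _) (abs_nonneg _) zero_le_one
  have hswap : ∫ u, ∫ v, S u v * h v ∂prior ∂prior = ∫ u, ∫ v, S u v * h u ∂prior ∂prior := by
    rw [integral_integral_swap hI1]
    simp_rw [hsymm]
  rw [integral_gibbs, integral_gibbs]
  congr 1
  have key : ∀ u, Real.exp (-Φ u) * trans Φ h u =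
      (∫ v, S u v * h v ∂prior) - (∫ v, S u v * h u ∂prior) + Real.exp (-Φ u) * h u := by
    intro u
    have i1 : Integrable (fun v => S u v * h v) prior :=
      integrable_of_bounds (((hSm.comp (f := fun v : Param => (u, v)) (by fun_prop))).mul hh)
        (c := 1 * c) fun p => by
          rw [abs_mul]; exact mul_le_mul (hSb _ _) (hc _) (abs_nonneg _) zero_le_one
    have i2 : Integrable (fun v => S u v * h u) prior :=
      integrable_of_bounds (((hSm.comp (f := fun v : Param => (u, v)) (by fun_prop))).mul_const _)
        (c := 1 * c) fun p => by
          rw [abs_mul]; exact mul_le_mul (hSb _ _) (hc _) (abs_nonneg _) zero_le_one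
    have i3 : Integrable (fun _ : Param => Real.exp (-Φ u) * h u) prior := integrable_const _
    rw [trans_eq hΦ hh hc, ← integral_const_mul, ← integral_sub i1 i2]
    have : Real.exp (-Φ u) * h u = ∫ _ : Param, Real.exp (-Φ u) * h u ∂prior := by simp
    rw [this, ← integral_add (f := fun v => S u v * h v - S u v * h u) (i1.sub i2) i3]
    refine integral_congr_ae (Eventually.of_forall fun v => ?_)
    simp only [hS]
    ring
  simp_rw [key]
  rw [integral_add, integral_sub hI1.integral_prod_left hI2.integral_prod_left, hswap, sub_self,
    zero_add]
  · exact hI1.integral_prod_left.sub hI2.integral_prod_left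
  · exact integrable_of_bounds (hΦ.neg.exp.mul hh) (c := 1 * c) fun p => by
      rw [abs_mul]; exact mul_le_mul (hexp _) (hc _) (abs_nonneg _) zero_le_one

/-- Doeblin's minorization: since every proposal is accepted with probability at least `ε`, one
step of the sampler shrinks the range of a function by the factor `1 - ε`. -/
lemma trans_mem_Icc {Φ h : Param → ℝ} (hΦ : Measurable Φ) (hh : Measurable h) {ε : ℝ}
    (hε : ∀ u v, ε ≤ acceptance Φ u v) {a b : ℝ} (hab : ∀ u, h u ∈ Set.Icc a b) (u : Param) :
    trans Φ h u ∈ Set.Icc (ε * (∫ v, h v ∂prior) + (1 - ε) * a)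
      (ε * (∫ v, h v ∂prior) + (1 - ε) * b) := by
  have hc : ∀ u, |h u| ≤ max |a| |b| := fun u => abs_le_max_abs_abs (hab u).1 (hab u).2
  have hm : Measurable fun v => acceptance Φ u v :=
    (measurable_acceptance hΦ).comp (f := fun v : Param => (u, v)) (by fun_prop)
  have hacc : ∀ v, |acceptance Φ u v| ≤ 1 := fun v => by
    rw [abs_of_nonneg (acceptance_nonneg _ _ _)]; exact acceptance_le_one _ _ _
  have ih : Integrable h prior := integrable_of_bounds hh hc
  have ia : Integrable (fun v => acceptance Φ u v * h v + (1 - acceptance Φ u v) * h u) prior := by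
    refine (integrable_of_bounds (hm.mul hh) (c := 1 * max |a| |b|) fun v => ?_).add
      (integrable_of_bounds ((measurable_const.sub hm).mul_const _) (c := 1 * max |a| |b|)
        fun v => ?_)
    · rw [Pi.mul_apply, abs_mul]; exact mul_le_mul (hacc _) (hc _) (abs_nonneg _) zero_le_one
    · rw [abs_mul]
      refine mul_le_mul ?_ (hc _) (abs_nonneg _) zero_le_one
      rw [abs_le]
      constructor <;> linarith [acceptance_nonneg Φ u v, acceptance_le_one Φ u v]
  rw [trans_eq hΦ hh hc]
  have e : ∀ t : ℝ, ε * (∫ v, h v ∂prior) + (1 - ε) * t = ∫ v, (ε * h v + (1 - ε) * t) ∂prior := by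
    intro t
    rw [integral_add (ih.const_mul _) (integrable_const _), integral_const_mul]
    simp
  rw [e, e]
  refine ⟨integral_mono ((ih.const_mul _).add (integrable_const _)) ia fun v => ?_,
    integral_mono ia ((ih.const_mul _).add (integrable_const _)) fun v => ?_⟩
  · simp only
    nlinarith [mul_le_mul_of_nonneg_left (hab v).1 (sub_nonneg.2 (hε u v)),
      mul_le_mul_of_nonneg_left (hab u).1 (sub_nonneg.2 (acceptance_le_one Φ u v))]
  · simp only
    nlinarith [mul_le_mul_of_nonneg_left (hab v).2 (sub_nonneg.2 (hε u v)),
      mul_le_mul_of_nonneg_left (hab u).2 (sub_nonneg.2 (acceptance_le_one Φ u v))]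

lemma measurable_trans_iterate {Φ h : Param → ℝ} (hΦ : Measurable Φ) (hh : Measurable h) (n : ℕ) :
    Measurable ((trans Φ)^[n] h) := by
  induction n with
  | zero => exact hh
  | succ n ih => rw [Function.iterate_succ_apply']; exact measurable_trans hΦ ih

lemma abs_trans_iterate_le {Φ h : Param → ℝ} {c : ℝ} (hc : ∀ u, |h u| ≤ c) (n : ℕ) (u : Param) :
    |(trans Φ)^[n] h u| ≤ c := by
  induction n generalizing u with
  | zero => exact hc u
  | succ n ih => rw [Function.iterate_succ_apply']; exact abs_trans_le ih u

lemma integral_trans_iterate_gibbs {Φ h : Param → ℝ} (hΦ : Measurable Φ) (h0 : ∀ u, 0 ≤ Φ u)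
    (hh : Measurable h) {c : ℝ} (hc : ∀ u, |h u| ≤ c) (n : ℕ) :
    ∫ u, (trans Φ)^[n] h u ∂gibbs Φ = ∫ u, h u ∂gibbs Φ := by
  induction n with
  | zero => rfl
  | succ n ih =>
    simp_rw [Function.iterate_succ_apply']
    rw [integral_trans_gibbs hΦ h0 (measurable_trans_iterate hΦ hh n)
      (abs_trans_iterate_le hc n), ih]

/-- Geometric ergodicity of the independence sampler in the supremum norm. -/
lemma abs_trans_iterate_sub_le {Φ h : Param → ℝ} (hΦ : Measurable Φ) (h0 : ∀ u, 0 ≤ Φ u)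
    (hh : Measurable h) {c : ℝ} (hc : ∀ u, |h u| ≤ c) {ε : ℝ}
    (hε : ∀ u v, ε ≤ acceptance Φ u v) (n : ℕ) (u : Param) :
    |(trans Φ)^[n] h u - ∫ v, h v ∂gibbs Φ| ≤ (1 - ε) ^ n * (2 * c) := by
  have range : ∀ n, ∃ a b, b - a = (1 - ε) ^ n * (2 * c) ∧
      ∀ u, (trans Φ)^[n] h u ∈ Set.Icc a b := by
    intro n
    induction n with
    | zero => exact ⟨-c, c, by ring, fun u => abs_le.1 (hc u)⟩
    | succ n ih =>
      obtain ⟨a, b, hab, hm⟩ := ih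
      refine ⟨ε * (∫ v, (trans Φ)^[n] h v ∂prior) + (1 - ε) * a,
        ε * (∫ v, (trans Φ)^[n] h v ∂prior) + (1 - ε) * b, ?_, fun u => ?_⟩
      · rw [pow_succ, mul_right_comm, ← hab]; ring
      · rw [Function.iterate_succ_apply']
        exact trans_mem_Icc hΦ (measurable_trans_iterate hΦ hh n) hε hm u
  obtain ⟨a, b, hab, hm⟩ := range n
  have := isProbabilityMeasure_gibbs hΦ h0
  have hi : Integrable ((trans Φ)^[n] h) (gibbs Φ) :=
    integrable_of_bounds (measurable_trans_iterate hΦ hh n) (abs_trans_iterate_le hc n)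
  have h1 : a ≤ ∫ v, (trans Φ)^[n] h v ∂gibbs Φ := by
    have := integral_mono (integrable_const a) hi (fun u => (hm u).1)
    simpa using this
  have h2 : ∫ v, (trans Φ)^[n] h v ∂gibbs Φ ≤ b := by
    have := integral_mono hi (integrable_const b) (fun u => (hm u).2)
    simpa using this
  rw [integral_trans_iterate_gibbs hΦ h0 hh hc] at h1 h2
  rw [← hab, abs_le]
  constructor <;> linarith [(hm u).1, (hm u).2]

/-- A bounded solution of the Poisson equation of the sampler. -/
lemma exists_poisson {Φ h : Param → ℝ} (hΦ : Measurable Φ) (h0 : ∀ u, 0 ≤ Φ u)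
    (hh : Measurable h) {c : ℝ} (hc : ∀ u, |h u| ≤ c) {ε : ℝ} (hε0 : 0 < ε)
    (hε : ∀ u v, ε ≤ acceptance Φ u v) :
    ∃ g : Param → ℝ, Measurable g ∧ (∀ u, |g u| ≤ 2 * c / ε) ∧
      ∀ u, g u - trans Φ g u = h u - ∫ v, h v ∂gibbs Φ := by
  have hε1 : ε ≤ 1 := (hε (fun _ => ⟨0, by simp⟩) (fun _ => ⟨0, by simp⟩)).trans
    (acceptance_le_one _ _ _)
  set m := ∫ v, h v ∂gibbs Φ with hm
  set t : ℕ → Param → ℝ := fun n u => (trans Φ)^[n] h u - m with ht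
  have htm : ∀ n, Measurable (t n) := fun n => (measurable_trans_iterate hΦ hh n).sub_const _
  have hb : ∀ n u, ‖t n u‖ ≤ (1 - ε) ^ n * (2 * c) := fun n u =>
    abs_trans_iterate_sub_le hΦ h0 hh hc hε n u
  have hgeo : HasSum (fun n : ℕ => (1 - ε) ^ n * (2 * c)) (2 * c / ε) := by
    have := (hasSum_geometric_of_lt_one (r := 1 - ε) (by linarith) (by linarith)).mul_right (2 * c)
    rwa [sub_sub_cancel, ← div_eq_inv_mul] at this
  have hsum : ∀ u, Summable fun n => t n u := fun u =>
    Summable.of_norm_bounded hgeo.summable fun n => hb n u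
  have htt : ∀ n u, trans Φ (t n) u = t (n + 1) u := by
    intro n u
    simp only [ht, trans]
    rw [integral_sub, Function.iterate_succ_apply']
    · simp [trans]
    · exact integrable_of_bounds ((measurable_trans_iterate hΦ hh n).comp
        ((measurable_step hΦ).comp (f := fun z : Param × unitInterval => (u, z)) (by fun_prop)))
        fun z => abs_trans_iterate_le hc n _
    · exact integrable_const _
  refine ⟨fun u => ∑' n, t n u, ?_, fun u => ?_, fun u => ?_⟩
  · exact measurable_of_tendsto_metrizable
      (fun N => Finset.measurable_sum (Finset.range N) fun n _ => htm n)
      (tendsto_pi_nhds.2 fun u => by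
        simpa only [Finset.sum_apply] using (hsum u).hasSum.tendsto_sum_nat)
  · exact tsum_of_norm_bounded hgeo fun n => hb n u
  · have h1 : trans Φ (fun u => ∑' n, t n u) u = ∑' n, t (n + 1) u := by
      have hi : ∀ n, Integrable (fun z => t n (step Φ u z)) proposalLaw := fun n =>
        integrable_of_bounds ((htm n).comp ((measurable_step hΦ).comp
          (f := fun z : Param × unitInterval => (u, z)) (by fun_prop))) fun z => hb n _
      have := integral_tsum_of_summable_integral_norm hi (by
        refine Summable.of_nonneg_of_le (fun n => by positivity) (fun n => ?_) hgeo.summable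
        have := integral_mono (hi n).norm (integrable_const _) (fun z => hb n (step Φ u z))
        simpa using this)
      simp only [trans]
      rw [← this]
      exact tsum_congr fun n => htt n u
    rw [h1]
    simp only [(hsum u).tsum_eq_zero_add]
    simp [ht]

/-! ### Martingale structure of the sample averages -/

/-- Resampling one coordinate preserves an infinite product measure. -/
lemma measurePreserving_update {Z : Type*} [MeasurableSpace Z] (ν : Measure Z)
    [IsProbabilityMeasure ν] (n : ℕ) :
    MeasurePreserving (fun p : (ℕ → Z) × Z => Function.update p.1 n p.2)
      ((Measure.infinitePi fun _ : ℕ => ν).prod ν) (Measure.infinitePi fun _ : ℕ => ν) := by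
  have hm : Measurable fun p : (ℕ → Z) × Z => Function.update p.1 n p.2 := by
    refine measurable_pi_lambda _ fun i => ?_
    by_cases h : i = n
    · subst h; simpa using measurable_snd
    · simp only [Function.update_of_ne h]
      fun_prop
  refine ⟨hm, Measure.eq_infinitePi _ fun s t ht => ?_⟩
  rw [Measure.map_apply hm (MeasurableSet.pi s.countable_toSet fun i _ => ht i)]
  by_cases hn : n ∈ s
  · have : (fun p : (ℕ → Z) × Z => Function.update p.1 n p.2) ⁻¹' Set.pi s t =
        Set.pi (s.erase n : Finset ℕ) t ×ˢ t n := by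
      ext ⟨ω, z⟩
      simp only [Set.mem_preimage, Set.mem_pi, Set.mem_prod, Finset.mem_coe, Finset.mem_erase]
      constructor
      · intro h
        refine ⟨fun i hi => ?_, by simpa using h n hn⟩
        simpa [Function.update_of_ne hi.1] using h i hi.2
      · rintro ⟨h1, h2⟩ i hi
        by_cases hin : i = n
        · subst hin; simpa using h2
        · simpa [Function.update_of_ne hin] using h1 i ⟨hin, hi⟩
    rw [this, Measure.prod_prod, Measure.infinitePi_pi _ fun i _ => ht i,
      Finset.prod_erase_mul _ _ hn]
  · have : (fun p : (ℕ → Z) × Z => Function.update p.1 n p.2) ⁻¹' Set.pi s t =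
        Set.pi s t ×ˢ Set.univ := by
      ext ⟨ω, z⟩
      simp only [Set.mem_preimage, Set.mem_pi, Set.mem_prod, Finset.mem_coe, Set.mem_univ, and_true]
      refine forall₂_congr fun i hi => ?_
      rw [Function.update_of_ne (ne_of_mem_of_not_mem hi hn)]
    rw [this, Measure.prod_prod, Measure.infinitePi_pi _ fun i _ => ht i, measure_univ, mul_one]

lemma integral_noiseLaw_update {K : Noise → ℝ} (hK : Measurable K) {c : ℝ} (hc : ∀ ω, |K ω| ≤ c)
    (n : ℕ) :
    ∫ ω, K ω ∂noiseLaw =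
      ∫ ω, ∫ z, K (ω.1, Function.update ω.2 n z) ∂proposalLaw ∂noiseLaw := by
  have hmp := measurePreserving_update proposalLaw n
  have hm : Measurable fun p : Noise × (Param × unitInterval) =>
      K (p.1.1, Function.update p.1.2 n p.2) :=
    hK.comp ((measurable_fst.comp measurable_fst).prodMk (hmp.measurable.comp
      (f := fun p : Noise × (Param × unitInterval) => (p.1.2, p.2)) (by fun_prop)))
  have hi : Integrable (fun p : Noise × (Param × unitInterval) =>
      K (p.1.1, Function.update p.1.2 n p.2)) (noiseLaw.prod proposalLaw) :=
    integrable_of_bounds hm fun _ => hc _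
  have hi' := hi.integral_prod_left
  unfold noiseLaw at hi' ⊢
  rw [integral_prod _ hi', integral_prod _ (integrable_of_bounds hK hc)]
  refine integral_congr_ae (Eventually.of_forall fun u => ?_)
  have hmu : Measurable fun ω : ℕ → Param × unitInterval => K (u, ω) := hK.comp (by fun_prop)
  change ∫ ω, K (u, ω) ∂Measure.infinitePi (fun _ : ℕ => proposalLaw) =
    ∫ ω, ∫ z, K (u, Function.update ω n z) ∂proposalLaw
      ∂Measure.infinitePi (fun _ : ℕ => proposalLaw)
  rw [← integral_prod (fun p : (ℕ → Param × unitInterval) × (Param × unitInterval) =>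
      K (u, Function.update p.1 n p.2))
      (integrable_of_bounds (hmu.comp hmp.measurable) fun _ => hc _)]
  rw [← hmp.map_eq, integral_map hmp.measurable.aemeasurable hmu.aestronglyMeasurable, hmp.map_eq]

lemma chain_succ (Φ : Param → ℝ) (ω : Noise) (n : ℕ) :
    chain Φ ω (n + 1) = step Φ (chain Φ ω n) (ω.2 n) := rfl

lemma chain_update (Φ : Param → ℝ) (ω : Noise) {m n : ℕ} (h : m ≤ n) (z : Param × unitInterval) :
    chain Φ (ω.1, Function.update ω.2 n z) m = chain Φ ω m := by
  induction m with
  | zero => rfl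
  | succ m ih =>
    rw [chain_succ, chain_succ, ih (by omega)]
    simp [Function.update_of_ne (show m ≠ n by omega)]

lemma measurable_chain {Φ : Param → ℝ} (hΦ : Measurable Φ) (n : ℕ) :
    Measurable fun ω : Noise => chain Φ ω n := by
  induction n with
  | zero => exact measurable_fst
  | succ n ih =>
    simp_rw [chain_succ]
    exact (measurable_step hΦ).comp (ih.prodMk ((measurable_pi_apply n).comp measurable_snd))

lemma measurable_sampleAverage {Φ h : Param → ℝ} (hΦ : Measurable Φ) (hh : Measurable h) (M : ℕ) :
    Measurable fun ω => sampleAverage Φ ω M h := by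
  unfold sampleAverage
  exact (Finset.measurable_sum _ fun n _ => hh.comp (measurable_chain hΦ (n + 1))).div_const _

lemma abs_sampleAverage_le {Φ h : Param → ℝ} {c : ℝ} (hc : ∀ u, |h u| ≤ c) (ω : Noise) {M : ℕ} :
    |sampleAverage Φ ω M h| ≤ c := by
  have hc0 : 0 ≤ c := (abs_nonneg _).trans (hc (fun _ => ⟨0, by simp⟩))
  unfold sampleAverage
  rw [abs_div, Nat.abs_cast]
  refine div_le_of_le_mul₀ (Nat.cast_nonneg _) hc0 ?_
  refine (Finset.abs_sum_le_sum_abs _ _).trans ((Finset.sum_le_sum fun n _ => hc _).trans ?_)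
  simp [mul_comm]

/-- Orthogonality of martingale increments driven by the chain. -/
lemma integral_martingale {Φ : Param → ℝ} (hΦ : Measurable Φ)
    {G : ℕ → Param → Param × unitInterval → ℝ}
    (hG : ∀ n, Measurable fun p : Param × (Param × unitInterval) => G n p.1 p.2)
    {b : ℕ → ℝ} (hb : ∀ n u z, |G n u z| ≤ b n)
    (h0 : ∀ n u, ∫ z, G n u z ∂proposalLaw = 0) (N : ℕ) :
    ∫ ω, ∑ n ∈ Finset.range N, G n (chain Φ ω n) (ω.2 n) ∂noiseLaw = 0 ∧
    ∫ ω, (∑ n ∈ Finset.range N, G n (chain Φ ω n) (ω.2 n)) ^ 2 ∂noiseLaw ≤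
      ∑ n ∈ Finset.range N, b n ^ 2 := by
  have hD : ∀ n, Measurable fun ω : Noise => G n (chain Φ ω n) (ω.2 n) := fun n =>
    (hG n).comp ((measurable_chain hΦ n).prodMk ((measurable_pi_apply n).comp measurable_snd))
  have hS : ∀ N, Measurable fun ω : Noise =>
      ∑ n ∈ Finset.range N, G n (chain Φ ω n) (ω.2 n) := fun N =>
    Finset.measurable_sum _ fun n _ => hD n
  have hSb : ∀ N (ω : Noise), |∑ n ∈ Finset.range N, G n (chain Φ ω n) (ω.2 n)| ≤
      ∑ n ∈ Finset.range N, b n := fun N ω =>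
    (Finset.abs_sum_le_sum_abs _ _).trans (Finset.sum_le_sum fun n _ => hb _ _ _)
  have hSu : ∀ N (ω : Noise) z, ∑ n ∈ Finset.range N,
      G n (chain Φ (ω.1, Function.update ω.2 N z) n) (Function.update ω.2 N z n) =
      ∑ n ∈ Finset.range N, G n (chain Φ ω n) (ω.2 n) := by
    intro N ω z
    refine Finset.sum_congr rfl fun n hn => ?_
    have hn := Finset.mem_range.1 hn
    rw [chain_update Φ ω hn.le, Function.update_of_ne hn.ne]
  induction N with
  | zero => simp
  | succ N ih =>
    have hb0 : ∀ n, 0 ≤ b n := fun n =>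
      (abs_nonneg _).trans (hb n (fun _ => ⟨0, by simp⟩) (fun _ => ⟨0, by simp⟩, 0))
    have hsb0 : ∀ N, 0 ≤ ∑ n ∈ Finset.range N, b n := fun N => Finset.sum_nonneg fun n _ => hb0 n
    have c0 : ∫ ω, G N (chain Φ ω N) (ω.2 N) ∂noiseLaw = 0 := by
      rw [integral_noiseLaw_update (hD N) (fun ω => hb N _ _) N]
      simp [chain_update, h0]
    have c1 : ∫ ω, (∑ n ∈ Finset.range N, G n (chain Φ ω n) (ω.2 n)) *
        G N (chain Φ ω N) (ω.2 N) ∂noiseLaw = 0 := by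
      rw [integral_noiseLaw_update (K := fun ω => (∑ n ∈ Finset.range N, G n (chain Φ ω n) (ω.2 n)) *
        G N (chain Φ ω N) (ω.2 N)) ((hS N).mul (hD N)) (c := (∑ n ∈ Finset.range N, b n) * b N)
        (fun ω => ?_) N]
      · simp [hSu, chain_update, integral_const_mul, h0]
      · rw [abs_mul]
        exact mul_le_mul (hSb N ω) (hb N _ _) (abs_nonneg _) (hsb0 N)
    have i1 : Integrable (fun ω : Noise => ∑ n ∈ Finset.range N, G n (chain Φ ω n) (ω.2 n))
        noiseLaw := integrable_of_bounds (hS N) (hSb N)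
    have i2 : Integrable (fun ω : Noise => G N (chain Φ ω N) (ω.2 N)) noiseLaw :=
      integrable_of_bounds (hD N) fun _ => hb _ _ _
    have i3 : Integrable (fun ω : Noise =>
        (∑ n ∈ Finset.range N, G n (chain Φ ω n) (ω.2 n)) ^ 2) noiseLaw :=
      integrable_of_bounds ((hS N).pow_const 2) (c := (∑ n ∈ Finset.range N, b n) ^ 2) fun ω => by
        rw [abs_pow]; exact pow_le_pow_left₀ (abs_nonneg _) (hSb N ω) 2
    have i4 : Integrable (fun ω : Noise => G N (chain Φ ω N) (ω.2 N) ^ 2) noiseLaw :=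
      integrable_of_bounds ((hD N).pow_const 2) (c := b N ^ 2) fun ω => by
        rw [abs_pow]; exact pow_le_pow_left₀ (abs_nonneg _) (hb N _ _) 2
    have i5 : Integrable (fun ω : Noise => (∑ n ∈ Finset.range N, G n (chain Φ ω n) (ω.2 n)) *
        G N (chain Φ ω N) (ω.2 N)) noiseLaw :=
      integrable_of_bounds ((hS N).mul (hD N)) (c := (∑ n ∈ Finset.range N, b n) * b N) fun ω => by
        rw [abs_mul]; exact mul_le_mul (hSb N ω) (hb N _ _) (abs_nonneg _) (hsb0 N)
    simp_rw [Finset.sum_range_succ]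
    refine ⟨by rw [integral_add i1 i2, ih.1, c0, add_zero], ?_⟩
    have e : ∀ ω : Noise, (∑ n ∈ Finset.range N, G n (chain Φ ω n) (ω.2 n) +
        G N (chain Φ ω N) (ω.2 N)) ^ 2 = (∑ n ∈ Finset.range N, G n (chain Φ ω n) (ω.2 n)) ^ 2 +
        2 * ((∑ n ∈ Finset.range N, G n (chain Φ ω n) (ω.2 n)) * G N (chain Φ ω N) (ω.2 N)) +
        G N (chain Φ ω N) (ω.2 N) ^ 2 := fun ω => by ring
    simp_rw [e]
    rw [integral_add (f := fun ω : Noise => (∑ n ∈ Finset.range N, G n (chain Φ ω n) (ω.2 n)) ^ 2 +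
        2 * ((∑ n ∈ Finset.range N, G n (chain Φ ω n) (ω.2 n)) * G N (chain Φ ω N) (ω.2 N)))
        (i3.add (i5.const_mul 2)) i4, integral_add i3 (i5.const_mul 2), integral_const_mul, c1,
      mul_zero, add_zero]
    refine add_le_add ih.2 ?_
    have := integral_mono i4 (integrable_const (b N ^ 2)) fun ω => by
      rw [← sq_abs]; exact pow_le_pow_left₀ (abs_nonneg _) (hb N _ _) 2
    simpa using this

/-- The martingale increment built on a function `g`. -/
def martingaleDiff (Φ g : Param → ℝ) (u : Param) (z : Param × unitInterval) : ℝ :=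
  g (step Φ u z) - trans Φ g u

lemma measurable_martingaleDiff {Φ g : Param → ℝ} (hΦ : Measurable Φ) (hg : Measurable g) :
    Measurable fun p : Param × (Param × unitInterval) => martingaleDiff Φ g p.1 p.2 :=
  (hg.comp (measurable_step hΦ)).sub ((measurable_trans hΦ hg).comp measurable_fst)

lemma abs_martingaleDiff_le {Φ g : Param → ℝ} {c : ℝ} (hc : ∀ u, |g u| ≤ c) (u : Param)
    (z : Param × unitInterval) : |martingaleDiff Φ g u z| ≤ 2 * c := by
  refine (abs_sub _ _).trans ?_
  linarith [hc (step Φ u z), abs_trans_le (Φ := Φ) hc u]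

lemma integral_martingaleDiff {Φ g : Param → ℝ} (hΦ : Measurable Φ) (hg : Measurable g) {c : ℝ}
    (hc : ∀ u, |g u| ≤ c) (u : Param) : ∫ z, martingaleDiff Φ g u z ∂proposalLaw = 0 := by
  unfold martingaleDiff
  rw [integral_sub (f := fun z => g (step Φ u z)) (integrable_of_bounds (hg.comp ((measurable_step hΦ).comp
    (f := fun z : Param × unitInterval => (u, z)) (by fun_prop))) fun _ => hc _)
    (integrable_const _)]
  simp [trans]

/-- With a solution `g` of the Poisson equation, the error of a sample average is a martingale up
to a boundary term. -/
lemma sampleAverage_sub_eq {Φ g h : Param → ℝ} {m : ℝ} (hg : ∀ u, g u - trans Φ g u = h u - m)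
    (ω : Noise) {M : ℕ} (hM : M ≠ 0) :
    sampleAverage Φ ω M h - m =
      (∑ n ∈ Finset.range M, martingaleDiff Φ g (chain Φ ω n) (ω.2 n)) / M +
        (trans Φ g (chain Φ ω 0) - trans Φ g (chain Φ ω M)) / M := by
  have hM' : (M : ℝ) ≠ 0 := Nat.cast_ne_zero.2 hM
  have e : ∀ n, h (chain Φ ω (n + 1)) - m = martingaleDiff Φ g (chain Φ ω n) (ω.2 n) -
      (trans Φ g (chain Φ ω (n + 1)) - trans Φ g (chain Φ ω n)) := by
    intro n
    rw [← hg, martingaleDiff, ← chain_succ]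
    ring
  have : ∑ n ∈ Finset.range M, (h (chain Φ ω (n + 1)) - m) =
      ∑ n ∈ Finset.range M, martingaleDiff Φ g (chain Φ ω n) (ω.2 n) -
      (trans Φ g (chain Φ ω M) - trans Φ g (chain Φ ω 0)) := by
    simp_rw [e]
    rw [Finset.sum_sub_distrib, Finset.sum_range_sub (fun n => trans Φ g (chain Φ ω n))]
  rw [Finset.sum_sub_distrib] at this
  simp only [Finset.sum_const, Finset.card_range, nsmul_eq_mul] at this
  unfold sampleAverage
  field_simp
  linarith

/-- The mean square error of one sample average. -/
lemma integral_sampleAverage_sub_sq_le {Φ h : Param → ℝ} (hΦ : Measurable Φ) (h0 : ∀ u, 0 ≤ Φ u)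
    (hh : Measurable h) {c : ℝ} (hc : ∀ u, |h u| ≤ c) {ε : ℝ} (hε0 : 0 < ε)
    (hε : ∀ u v, ε ≤ acceptance Φ u v) {M : ℕ} (hM : M ≠ 0) :
    ∫ ω, (sampleAverage Φ ω M h - ∫ u, h u ∂gibbs Φ) ^ 2 ∂noiseLaw ≤ (8 * c / ε) ^ 2 / M := by
  obtain ⟨g, hgm, hgb, hg⟩ := exists_poisson hΦ h0 hh hc hε0 hε
  have hM' : (0 : ℝ) < M := Nat.cast_pos.2 (Nat.pos_of_ne_zero hM)
  have hM1 : (1 : ℝ) ≤ M := Nat.one_le_cast.2 (Nat.pos_of_ne_zero hM)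
  set b : ℝ := 2 * (2 * c / ε) with hb
  have hc0 : 0 ≤ c := (abs_nonneg _).trans (hc (fun _ => ⟨0, by simp⟩))
  have hb0 : 0 ≤ b := by positivity
  set D : Noise → ℝ := fun ω => ∑ n ∈ Finset.range M, martingaleDiff Φ g (chain Φ ω n) (ω.2 n)
    with hD
  have hDm : Measurable D := Finset.measurable_sum _ fun n _ =>
    (measurable_martingaleDiff hΦ hgm).comp
      ((measurable_chain hΦ n).prodMk ((measurable_pi_apply n).comp measurable_snd))
  have hDb : ∀ ω, |D ω| ≤ M * b := fun ω => by
    refine (Finset.abs_sum_le_sum_abs _ _).trans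
      ((Finset.sum_le_sum fun n _ => abs_martingaleDiff_le hgb _ _).trans ?_)
    simp [hb]
  have hD2 : ∫ ω, D ω ^ 2 ∂noiseLaw ≤ M * b ^ 2 := by
    have := (integral_martingale hΦ (G := fun _ => martingaleDiff Φ g) (b := fun _ => b)
      (fun _ => measurable_martingaleDiff hΦ hgm) (fun _ => abs_martingaleDiff_le hgb)
      (fun _ => integral_martingaleDiff hΦ hgm hgb) M).2
    simpa using this
  have hi : Integrable (fun ω => D ω ^ 2) noiseLaw :=
    integrable_of_bounds (hDm.pow_const 2) (c := (M * b) ^ 2) fun ω => by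
      rw [abs_pow]; exact pow_le_pow_left₀ (abs_nonneg _) (hDb ω) 2
  have hpt : ∀ ω, (sampleAverage Φ ω M h - ∫ u, h u ∂gibbs Φ) ^ 2 ≤
      2 / (M : ℝ) ^ 2 * D ω ^ 2 + 2 * b ^ 2 / (M : ℝ) ^ 2 := by
    intro ω
    rw [sampleAverage_sub_eq hg ω hM]
    have hr : (trans Φ g (chain Φ ω 0) - trans Φ g (chain Φ ω M)) ^ 2 ≤ b ^ 2 := by
      rw [← sq_abs]
      refine pow_le_pow_left₀ (abs_nonneg _) ((abs_sub _ _).trans ?_) 2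
      linarith [abs_trans_le (Φ := Φ) hgb (chain Φ ω 0), abs_trans_le (Φ := Φ) hgb (chain Φ ω M)]
    rw [← add_div, div_pow]
    have : 2 / (M : ℝ) ^ 2 * D ω ^ 2 + 2 * b ^ 2 / (M : ℝ) ^ 2 =
      (2 * D ω ^ 2 + 2 * b ^ 2) / (M : ℝ) ^ 2 := by ring
    rw [this]
    refine div_le_div_of_nonneg_right ?_ (by positivity)
    nlinarith [sq_nonneg (D ω - (trans Φ g (chain Φ ω 0) - trans Φ g (chain Φ ω M)))]
  have := integral_mono_of_nonneg (μ := noiseLaw) (Eventually.of_forall fun ω => sq_nonneg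
    (sampleAverage Φ ω M h - ∫ u, h u ∂gibbs Φ)) ((hi.const_mul _).add (integrable_const _))
    (Eventually.of_forall hpt)
  refine this.trans ?_
  simp only [Pi.add_apply]
  rw [integral_add (hi.const_mul _) (integrable_const _), integral_const_mul]
  have e1 : 2 / (M : ℝ) ^ 2 * ∫ ω, D ω ^ 2 ∂noiseLaw ≤ 2 / (M : ℝ) ^ 2 * (M * b ^ 2) :=
    mul_le_mul_of_nonneg_left hD2 (by positivity)
  have e2 : 2 / (M : ℝ) ^ 2 * (M * b ^ 2) = 2 * b ^ 2 / M := by field_simp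
  have e3 : 2 * b ^ 2 / (M : ℝ) ^ 2 ≤ 2 * b ^ 2 / M :=
    div_le_div_of_nonneg_left (by positivity) hM' (by nlinarith)
  have e4 : (8 * c / ε) ^ 2 / (M : ℝ) = 2 * b ^ 2 / M + 2 * b ^ 2 / M := by rw [hb]; ring
  rw [e4]
  simp only [integral_const, smul_eq_mul, probReal_univ, one_mul]
  linarith

/-! ### Nested samples: the averages of one chain over increasing sample sizes -/

lemma sq_sum_two_pow_le (s : Finset ℕ) :
    (∑ i ∈ s, (2 : ℝ) ^ i) ^ 2 ≤ 4 * ∑ i ∈ s, (4 : ℝ) ^ i := by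
  rcases s.eq_empty_or_nonempty with rfl | hs
  · simp
  -- the sum is dominated by its largest term
  set m := s.max' hs
  have h1 : ∑ i ∈ s, (2 : ℝ) ^ i ≤ 2 * 2 ^ m := by
    have : s ⊆ Finset.range (m + 1) := fun i hi =>
      Finset.mem_range.2 (Nat.lt_succ_of_le (s.le_max' i hi))
    calc ∑ i ∈ s, (2 : ℝ) ^ i ≤ ∑ i ∈ Finset.range (m + 1), (2 : ℝ) ^ i :=
          Finset.sum_le_sum_of_subset_of_nonneg this fun _ _ _ => by positivity
      _ ≤ 2 * 2 ^ m := by rw [geom_sum_eq (by norm_num)]; rw [pow_succ]; norm_num; linarith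
  have h2 : (4 : ℝ) ^ m ≤ ∑ i ∈ s, (4 : ℝ) ^ i :=
    Finset.single_le_sum (f := fun i => (4 : ℝ) ^ i) (fun _ _ => by positivity) (s.max'_mem hs)
  calc (∑ i ∈ s, (2 : ℝ) ^ i) ^ 2 ≤ (2 * 2 ^ m) ^ 2 :=
        pow_le_pow_left₀ (Finset.sum_nonneg fun _ _ => by positivity) h1 2
    _ = 4 * 4 ^ m := by rw [mul_pow, ← pow_mul, mul_comm m 2, pow_mul]; norm_num
    _ ≤ _ := by linarith

/-- The averages over the nested samples of sizes `4^(R-i)` of functions of size `a 2^(-i)` are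
nearly orthogonal: the second moment of the sum of their errors grows only linearly in the number
of averages, up to a uniformly small remainder. -/
lemma exists_nested_decomposition {Φ : Param → ℝ} (hΦ : Measurable Φ) (h0 : ∀ u, 0 ≤ Φ u)
    {ε : ℝ} (hε0 : 0 < ε) (hε : ∀ u v, ε ≤ acceptance Φ u v) (R : ℕ) {a : ℝ} (ha : 0 ≤ a)
    {h : ℕ → Param → ℝ} (hh : ∀ i, Measurable (h i)) (hb : ∀ i u, |h i u| ≤ a / 2 ^ i) :
    ∃ Y : Noise → ℝ, Measurable Y ∧ (∃ c, ∀ ω, |Y ω| ≤ c) ∧ ∫ ω, Y ω ∂noiseLaw = 0 ∧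
      ∫ ω, Y ω ^ 2 ∂noiseLaw ≤ (8 * a / ε) ^ 2 * (R + 1) / 4 ^ R ∧
      ∀ ω, |∑ i ∈ Finset.range (R + 1), (sampleAverage Φ ω (4 ^ (R - i)) (h i) -
        ∫ u, h i u ∂gibbs Φ) - Y ω| ≤ 8 * a / ε / 2 ^ R := by
  choose g hgm hgb hg using fun i => exists_poisson hΦ h0 (hh i) (hb i) hε0 hε
  set s : ℕ → Finset ℕ := fun n => (Finset.range (R + 1)).filter fun i => n < 4 ^ (R - i) with hs
  set G : ℕ → Param → Param × unitInterval → ℝ := fun n u z =>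
    ∑ i ∈ s n, martingaleDiff Φ (g i) u z / 4 ^ (R - i) with hG
  set b : ℕ → ℝ := fun n => 4 * a / ε / 4 ^ R * ∑ i ∈ s n, (2 : ℝ) ^ i with hbdef
  have pw : ∀ i ∈ Finset.range (R + 1), (4 : ℝ) ^ (R - i) * 4 ^ i = 4 ^ R := fun i hi => by
    rw [← pow_add, Nat.sub_add_cancel (Nat.lt_succ_iff.1 (Finset.mem_range.1 hi))]
  have p24 : ∀ i : ℕ, (4 : ℝ) ^ i = 2 ^ i * 2 ^ i := fun i => by rw [← mul_pow]; norm_num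
  have hGm : ∀ n, Measurable fun p : Param × (Param × unitInterval) => G n p.1 p.2 := fun n =>
    Finset.measurable_sum _ fun i _ => (measurable_martingaleDiff hΦ (hgm i)).div_const _
  have hGb : ∀ n u z, |G n u z| ≤ b n := by
    intro n u z
    refine (Finset.abs_sum_le_sum_abs _ _).trans ?_
    rw [hbdef]
    simp only
    rw [Finset.mul_sum]
    refine Finset.sum_le_sum fun i hi => ?_
    have hp := pw i (Finset.mem_filter.1 hi).1
    rw [abs_div, abs_of_pos (show (0 : ℝ) < 4 ^ (R - i) by positivity), ← hp, p24 i]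
    refine (div_le_div_of_nonneg_right (abs_martingaleDiff_le (hgb i) u z) (by positivity)).trans
      (le_of_eq ?_)
    field_simp
    ring
  have hGz : ∀ n u, ∫ z, G n u z ∂proposalLaw = 0 := by
    intro n u
    simp only [hG]
    rw [integral_finsetSum]
    · refine Finset.sum_eq_zero fun i _ => ?_
      rw [integral_div, integral_martingaleDiff hΦ (hgm i) (hgb i), zero_div]
    · intro i _
      exact (integrable_of_bounds ((measurable_martingaleDiff hΦ (hgm i)).comp
        (f := fun z : Param × unitInterval => (u, z)) (by fun_prop))
        fun z => abs_martingaleDiff_le (hgb i) u z).div_const _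
  clear_value G b
  obtain ⟨T, hT⟩ : ∃ T : ℕ, T = 4 ^ R := ⟨_, rfl⟩
  have key := integral_martingale hΦ hGm hGb hGz T
  refine ⟨fun ω => ∑ n ∈ Finset.range T, G n (chain Φ ω n) (ω.2 n), ?_, ?_, key.1,
    key.2.trans ?_, fun ω => ?_⟩
  · have hGc : ∀ n, Measurable fun ω : Noise => G n (chain Φ ω n) (ω.2 n) := fun n =>
      (hGm n).comp ((measurable_chain hΦ n).prodMk ((measurable_pi_apply n).comp measurable_snd))
    exact Finset.measurable_sum _ fun n _ => hGc n
  · exact ⟨∑ n ∈ Finset.range T, b n, fun ω =>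
      (Finset.abs_sum_le_sum_abs _ _).trans (Finset.sum_le_sum fun n _ => hGb _ _ _)⟩
  · have h1 : ∀ n, b n ^ 2 ≤ (4 * a / ε / 4 ^ R) ^ 2 * (4 * ∑ i ∈ s n, (4 : ℝ) ^ i) := fun n => by
      rw [hbdef, mul_pow]
      exact mul_le_mul_of_nonneg_left (sq_sum_two_pow_le _) (by positivity)
    refine (Finset.sum_le_sum fun n _ => h1 n).trans ?_
    rw [← Finset.mul_sum, ← Finset.mul_sum]
    have h2 : ∑ n ∈ Finset.range T, ∑ i ∈ s n, (4 : ℝ) ^ i = (R + 1) * 4 ^ R := by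
      simp only [hs, Finset.sum_filter]
      rw [Finset.sum_comm]
      have : ∀ i ∈ Finset.range (R + 1), ∑ n ∈ Finset.range T,
          (if n < 4 ^ (R - i) then (4 : ℝ) ^ i else 0) = 4 ^ R := by
        intro i hi
        rw [← Finset.sum_filter, Finset.sum_const, nsmul_eq_mul, ← pw i hi]
        congr 1
        have : (Finset.range T).filter (fun n => n < 4 ^ (R - i)) =
            Finset.range (4 ^ (R - i)) := by
          ext n
          simp only [Finset.mem_filter, Finset.mem_range]
          have : 4 ^ (R - i) ≤ T := hT ▸ Nat.pow_le_pow_right (by norm_num) (Nat.sub_le _ _)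
          omega
        rw [this]; simp
      rw [Finset.sum_congr rfl this]
      simp
    rw [h2]
    refine le_of_eq ?_
    field_simp
    ring
  · have h1 : ∀ i ∈ Finset.range (R + 1), sampleAverage Φ ω (4 ^ (R - i)) (h i) -
        ∫ u, h i u ∂gibbs Φ = (∑ n ∈ Finset.range T, if n < 4 ^ (R - i) then
          martingaleDiff Φ (g i) (chain Φ ω n) (ω.2 n) / 4 ^ (R - i) else 0) +
        (trans Φ (g i) (chain Φ ω 0) - trans Φ (g i) (chain Φ ω (4 ^ (R - i)))) /
          4 ^ (R - i) := by
      intro i _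
      rw [sampleAverage_sub_eq (hg i) ω (by positivity), ← Finset.sum_filter]
      have : (Finset.range T).filter (fun n => n < 4 ^ (R - i)) =
          Finset.range (4 ^ (R - i)) := by
        ext n
        simp only [Finset.mem_filter, Finset.mem_range]
        have : 4 ^ (R - i) ≤ T := hT ▸ Nat.pow_le_pow_right (by norm_num) (Nat.sub_le _ _)
        omega
      rw [this, Finset.sum_div]
      push_cast
      rfl
    rw [Finset.sum_congr rfl h1, Finset.sum_add_distrib, Finset.sum_comm]
    have h2 : ∑ n ∈ Finset.range T, G n (chain Φ ω n) (ω.2 n) =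
        ∑ n ∈ Finset.range T, ∑ i ∈ Finset.range (R + 1), if n < 4 ^ (R - i) then
          martingaleDiff Φ (g i) (chain Φ ω n) (ω.2 n) / 4 ^ (R - i) else 0 := by
      refine Finset.sum_congr rfl fun n _ => ?_
      simp only [hG, hs]
      rw [Finset.sum_filter]
    beta_reduce
    rw [h2, add_sub_cancel_left]
    refine (Finset.abs_sum_le_sum_abs _ _).trans ?_
    have h3 : ∀ i ∈ Finset.range (R + 1),
        |(trans Φ (g i) (chain Φ ω 0) - trans Φ (g i) (chain Φ ω (4 ^ (R - i)))) /
          (4 : ℝ) ^ (R - i)| ≤ 4 * a / ε / 4 ^ R * 2 ^ i := by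
      intro i hi
      rw [abs_div, abs_of_pos (show (0 : ℝ) < 4 ^ (R - i) by positivity), ← pw i hi, p24 i]
      have := (abs_sub (trans Φ (g i) (chain Φ ω 0))
        (trans Φ (g i) (chain Φ ω (4 ^ (R - i))))).trans (add_le_add
        (abs_trans_le (Φ := Φ) (hgb i) (chain Φ ω 0))
        (abs_trans_le (Φ := Φ) (hgb i) (chain Φ ω (4 ^ (R - i)))))
      refine (div_le_div_of_nonneg_right this (by positivity)).trans (le_of_eq ?_)
      field_simp
      ring
    refine (Finset.sum_le_sum h3).trans ?_
    rw [← Finset.mul_sum, geom_sum_eq (by norm_num)]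
    have : ((2 : ℝ) ^ (R + 1) - 1) / (2 - 1) ≤ 2 * 2 ^ R := by rw [pow_succ]; norm_num; linarith
    refine (mul_le_mul_of_nonneg_left this (by positivity)).trans (le_of_eq ?_)
    rw [p24 R]
    field_simp
    ring

/-! ### Sampling error of the multilevel estimator -/

instance : IsProbabilityMeasure noisesLaw := by
  unfold noisesLaw; infer_instance

lemma integral_noisesLaw_eval (l : ℕ) {F : Noise → ℝ} (hF : Measurable F) :
    ∫ ω, F (ω l) ∂noisesLaw = ∫ ω, F ω ∂noiseLaw := by
  have h := measurePreserving_eval_infinitePi (fun _ : ℕ => noiseLaw) l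
  rw [← h.map_eq, integral_map h.measurable.aemeasurable hF.aestronglyMeasurable]
  rfl

lemma integral_abs_le_of_integral_sq_le {α : Type*} [MeasurableSpace α] {μ : Measure α}
    [IsProbabilityMeasure μ] {X : α → ℝ} (hX : Measurable X) {c : ℝ} (hc : ∀ ω, |X ω| ≤ c)
    {b : ℝ} (hb : 0 ≤ b) (h : ∫ ω, X ω ^ 2 ∂μ ≤ b ^ 2) : ∫ ω, |X ω| ∂μ ≤ b := by
  have hm : MemLp (fun ω => |X ω|) 2 μ :=
    MemLp.of_bound (hX.abs).aestronglyMeasurable c (Eventually.of_forall fun ω => by simpa using hc ω)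
  have h1 := ProbabilityTheory.variance_nonneg (fun ω => |X ω|) μ
  rw [ProbabilityTheory.variance_eq_sub hm] at h1
  have h2 : ∫ ω, ((fun ω => |X ω|) ^ 2) ω ∂μ = ∫ ω, X ω ^ 2 ∂μ := by simp
  rw [h2] at h1
  exact abs_le_of_sq_le_sq' (by linarith) hb |>.2

/-- The chains are independent, so that the second moments of centred functions of the different
chains add up. -/
lemma integral_sum_sq_noisesLaw {Y : ℕ → Noise → ℝ} (hY : ∀ l, Measurable (Y l))
    (hb : ∀ l, ∃ c, ∀ ω, |Y l ω| ≤ c) (h0 : ∀ l, ∫ ω, Y l ω ∂noiseLaw = 0) (s : Finset ℕ) :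
    ∫ ω, (∑ l ∈ s, Y l (ω l)) ^ 2 ∂noisesLaw = ∑ l ∈ s, ∫ ω, Y l ω ^ 2 ∂noiseLaw := by
  have hm : ∀ l, Measurable fun ω : ℕ → Noise => Y l (ω l) := fun l =>
    (hY l).comp (measurable_pi_apply l)
  have hL : ∀ l, MemLp (fun ω : ℕ → Noise => Y l (ω l)) 2 noisesLaw := fun l => by
    obtain ⟨c, hc⟩ := hb l
    exact MemLp.of_bound (hm l).aestronglyMeasurable c (Eventually.of_forall fun ω => hc _)
  have hind : ProbabilityTheory.iIndepFun (fun l (ω : ℕ → Noise) => Y l (ω l)) noisesLaw :=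
    ProbabilityTheory.iIndepFun_infinitePi (P := fun _ : ℕ => noiseLaw) hY
  have hvar := ProbabilityTheory.IndepFun.variance_sum (s := s) (fun l _ => hL l)
    (fun i _ j _ hij => hind.indepFun hij)
  have hi : ∀ l, Integrable (fun ω : ℕ → Noise => Y l (ω l)) noisesLaw := fun l =>
    (hL l).integrable (by norm_num)
  rw [ProbabilityTheory.variance_of_integral_eq_zero
    (Finset.aemeasurable_sum s fun l _ => (hm l).aemeasurable)] at hvar
  · simp only [Finset.sum_apply] at hvar
    rw [hvar]
    refine Finset.sum_congr rfl fun l _ => ?_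
    rw [ProbabilityTheory.variance_of_integral_eq_zero (hm l).aemeasurable
      ((integral_noisesLaw_eval l (hY l)).trans (h0 l)),
      integral_noisesLaw_eval l ((hY l).pow_const 2)]
  · simp only [Finset.sum_apply]
    rw [integral_finsetSum _ fun l _ => hi l]
    exact Finset.sum_eq_zero fun l _ => (integral_noisesLaw_eval l (hY l)).trans (h0 l)

lemma sampleSize_eq (L l i : ℕ) : sampleSize L l i = 4 ^ (L - l - i) := by
  rw [sampleSize, pow_mul, Nat.sub_sub]; norm_num

/-- The errors of the sample averages of all the increments add up to `O(L 2^(-L))`: within one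
chain they are nearly orthogonal, and the chains are independent. -/
lemma integral_abs_multilevel_le {Φ : ℕ → Param → ℝ} (hΦ : ∀ l, Measurable (Φ l))
    (h0 : ∀ l u, 0 ≤ Φ l u) {ε : ℝ} (hε0 : 0 < ε) (hε : ∀ l u v, ε ≤ acceptance (Φ l) u v)
    {c : ℝ} (hc : 0 ≤ c) {h : ℕ → ℕ → Param → ℝ} (hh : ∀ l i, Measurable (h l i))
    (hb : ∀ l i u, |h l i u| ≤ c / 2 ^ l / 2 ^ i) (L : ℕ) :
    ∫ ω, |∑ l ∈ Finset.range (L + 1), ∑ i ∈ Finset.range (L - l + 1),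
      (sampleAverage (Φ l) (ω l) (sampleSize L l i) (h l i) - ∫ u, h l i u ∂gibbs (Φ l))|
        ∂noisesLaw ≤ 16 * c / ε * (L + 1) / 2 ^ L := by
  choose Y hYm hYb hY0 hY2 hYr using fun l =>
    exists_nested_decomposition (hΦ l) (h0 l) hε0 (hε l) (L - l) (a := c / 2 ^ l) (by positivity)
      (hh l) (hb l)
  have hYsm : Measurable fun ω : ℕ → Noise => ∑ l ∈ Finset.range (L + 1), Y l (ω l) :=
    Finset.measurable_sum _ fun l _ => (hYm l).comp (measurable_pi_apply l)
  choose k hk using hYb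
  have hYsb : ∀ ω : ℕ → Noise, |∑ l ∈ Finset.range (L + 1), Y l (ω l)| ≤
      ∑ l ∈ Finset.range (L + 1), k l := fun ω =>
    (Finset.abs_sum_le_sum_abs _ _).trans (Finset.sum_le_sum fun l _ => hk l _)
  have pw : ∀ l ∈ Finset.range (L + 1), (2 : ℝ) ^ l * 2 ^ (L - l) = 2 ^ L := fun l hl => by
    rw [← pow_add, Nat.add_sub_cancel' (Nat.lt_succ_iff.1 (Finset.mem_range.1 hl))]
  have p24 : ∀ i : ℕ, (4 : ℝ) ^ i = 2 ^ i * 2 ^ i := fun i => by rw [← mul_pow]; norm_num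
  have h1 : ∫ ω, |∑ l ∈ Finset.range (L + 1), Y l (ω l)| ∂noisesLaw ≤
      8 * c / ε * (L + 1) / 2 ^ L := by
    refine integral_abs_le_of_integral_sq_le hYsm hYsb (by positivity) ?_
    rw [integral_sum_sq_noisesLaw hYm (fun l => ⟨k l, hk l⟩) hY0]
    have : ∀ l ∈ Finset.range (L + 1), ∫ ω, Y l ω ^ 2 ∂noiseLaw ≤
        (8 * c / ε / 2 ^ L) ^ 2 * (L + 1) := by
      intro l hl
      refine (hY2 l).trans ?_
      rw [← pw l hl, p24]
      have hL : ((L - l : ℕ) : ℝ) ≤ L := by exact_mod_cast Nat.sub_le _ _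
      calc (8 * (c / 2 ^ l) / ε) ^ 2 * (((L - l : ℕ) : ℝ) + 1) / (2 ^ (L - l) * 2 ^ (L - l))
          = (8 * c / ε / (2 ^ l * 2 ^ (L - l))) ^ 2 * (((L - l : ℕ) : ℝ) + 1) := by
            field_simp
        _ ≤ _ := mul_le_mul_of_nonneg_left (by linarith) (by positivity)
    refine (Finset.sum_le_sum this).trans (le_of_eq ?_)
    simp only [Finset.sum_const, Finset.card_range, nsmul_eq_mul]
    push_cast
    field_simp
  have h2 : ∀ ω : ℕ → Noise, |∑ l ∈ Finset.range (L + 1), ∑ i ∈ Finset.range (L - l + 1),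
      (sampleAverage (Φ l) (ω l) (sampleSize L l i) (h l i) - ∫ u, h l i u ∂gibbs (Φ l))| ≤
      |∑ l ∈ Finset.range (L + 1), Y l (ω l)| + 8 * c / ε * (L + 1) / 2 ^ L := by
    intro ω
    rw [← sub_le_iff_le_add']
    refine (abs_sub_abs_le_abs_sub _ _).trans ?_
    rw [← Finset.sum_sub_distrib]
    refine (Finset.abs_sum_le_sum_abs _ _).trans ?_
    have : ∀ l ∈ Finset.range (L + 1), |∑ i ∈ Finset.range (L - l + 1),
        (sampleAverage (Φ l) (ω l) (sampleSize L l i) (h l i) - ∫ u, h l i u ∂gibbs (Φ l)) -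
          Y l (ω l)| ≤ 8 * c / ε / 2 ^ L := by
      intro l hl
      simp_rw [sampleSize_eq]
      refine (hYr l (ω l)).trans (le_of_eq ?_)
      rw [← pw l hl]
      field_simp
    refine (Finset.sum_le_sum this).trans (le_of_eq ?_)
    simp only [Finset.sum_const, Finset.card_range, nsmul_eq_mul]
    push_cast
    ring
  have hi : Integrable (fun ω : ℕ → Noise => |∑ l ∈ Finset.range (L + 1), Y l (ω l)|) noisesLaw :=
    (integrable_of_bounds hYsm hYsb).abs
  refine (integral_mono_of_nonneg (Eventually.of_forall fun _ => abs_nonneg _)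
    (hi.add (integrable_const _)) (Eventually.of_forall h2)).trans ?_
  simp only [Pi.add_apply]
  rw [integral_add hi (integrable_const _)]
  simp only [integral_const, smul_eq_mul, probReal_univ, one_mul]
  refine (add_le_add h1 le_rfl).trans (le_of_eq ?_)
  ring

/-- The change of the expectation under a change of the potential. -/
lemma integral_gibbs_sub {Φ Φ' h : Param → ℝ} (hΦ : Measurable Φ) (h0 : ∀ u, 0 ≤ Φ u)
    (hΦ' : Measurable Φ') (h0' : ∀ u, 0 ≤ Φ' u) (hh : Measurable h) {c : ℝ}
    (hc : ∀ u, |h u| ≤ c) :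
    ∫ u, h u ∂gibbs Φ' - ∫ u, h u ∂gibbs Φ =
      ∫ u, (1 - Real.exp (Φ' u - Φ u)) * h u ∂gibbs Φ' +
        (∫ u, -(1 - Real.exp (Φ' u - Φ u)) ∂gibbs Φ') * ∫ u, h u ∂gibbs Φ := by
  have i1 := integrable_exp_neg hΦ h0
  have i2 := integrable_exp_neg hΦ' h0'
  have i3 : Integrable (fun u => Real.exp (-Φ u) * h u) prior :=
    i1.mul_bdd hh.aestronglyMeasurable (Eventually.of_forall hc)
  have i4 : Integrable (fun u => Real.exp (-Φ' u) * h u) prior :=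
    i2.mul_bdd hh.aestronglyMeasurable (Eventually.of_forall hc)
  have e : ∀ u, Real.exp (-Φ' u) * Real.exp (Φ' u - Φ u) = Real.exp (-Φ u) := fun u => by
    rw [← Real.exp_add]; ring_nf
  simp only [integral_gibbs]
  have e1 : ∫ u, Real.exp (-Φ' u) * ((1 - Real.exp (Φ' u - Φ u)) * h u) ∂prior =
      ∫ u, Real.exp (-Φ' u) * h u ∂prior - ∫ u, Real.exp (-Φ u) * h u ∂prior := by
    rw [← integral_sub i4 i3]
    congr 1; ext u
    rw [← e u]; ring
  have e2 : ∫ u, Real.exp (-Φ' u) * -(1 - Real.exp (Φ' u - Φ u)) ∂prior =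
      ∫ u, Real.exp (-Φ u) ∂prior - ∫ u, Real.exp (-Φ' u) ∂prior := by
    rw [← integral_sub i1 i2]
    congr 1; ext u
    rw [← e u]; ring
  have z : 0 < ∫ u, Real.exp (-Φ u) ∂prior := integral_exp_pos i1
  have z' : 0 < ∫ u, Real.exp (-Φ' u) ∂prior := integral_exp_pos i2
  rw [e1, e2]
  field_simp
  ring

lemma abs_integral_gibbs_le {Φ h : Param → ℝ} (hΦ : Measurable Φ) (h0 : ∀ u, 0 ≤ Φ u) {c : ℝ}
    (hc : ∀ u, |h u| ≤ c) : |∫ u, h u ∂gibbs Φ| ≤ c := by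
  have := isProbabilityMeasure_gibbs hΦ h0
  exact abs_integral_le_of_abs_le hc

lemma integrable_gibbs {Φ h : Param → ℝ} (hΦ : Measurable Φ) (h0 : ∀ u, 0 ≤ Φ u)
    (hh : Measurable h) {c : ℝ} (hc : ∀ u, |h u| ≤ c) : Integrable h (gibbs Φ) := by
  have := isProbabilityMeasure_gibbs hΦ h0
  exact integrable_of_bounds hh hc

lemma abs_one_sub_exp_le {x B : ℝ} (hB : |x| ≤ B) : |1 - Real.exp x| ≤ Real.exp B * |x| := by
  have hx := abs_le.1 hB
  have h1 := Real.add_one_le_exp x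
  have h2 := Real.add_one_le_exp (-x)
  have h3 : Real.exp x ≤ Real.exp B := Real.exp_le_exp.2 hx.2
  have h4 : (1 : ℝ) ≤ Real.exp B := Real.one_le_exp ((abs_nonneg x).trans hB)
  have h5 : Real.exp x * Real.exp (-x) = 1 := by rw [← Real.exp_add]; simp
  have hp := Real.exp_pos x
  rcases le_total 0 x with h | h
  · rw [abs_of_nonneg h, abs_le]
    constructor <;> nlinarith
  · rw [abs_of_nonpos h, abs_le]
    constructor <;> nlinarith

namespace Problem

variable {d k : ℕ} (P : Problem d k) (Q : ℕ → Param → V P.D)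

/-- The posterior expectation on level `l - 1`; zero for `l = 0`. -/
def coarserMean (g : Param → ℝ) : ℕ → ℝ
  | 0 => 0
  | l + 1 => ∫ u, g u ∂gibbs (P.potential (Q l))

/-- The difference of the posterior expectations of `g` on the levels `l` and `l - 1`, in the form
that is sampled by the estimator. -/
def levelDiff (l : ℕ) (g : Param → ℝ) : ℝ :=
  ∫ u, P.weight Q l u * g u ∂gibbs (P.potential (Q l)) +
    (∫ u, -P.weight Q l u ∂gibbs (P.potential (Q l))) * P.coarserMean Q g l

/-- What the error analysis of the estimator uses of the hierarchy of approximate forward maps: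
measurability, nonnegative potentials, acceptance probabilities bounded below by `ε`, and weights
and increments that decay geometrically with the level. -/
structure GoodHierarchy (ε c : ℝ) : Prop where
  eps_pos : 0 < ε
  c_nonneg : 0 ≤ c
  measurable_potential : ∀ l, Measurable (P.potential (Q l))
  potential_nonneg : ∀ l u, 0 ≤ P.potential (Q l) u
  le_acceptance : ∀ l u v, ε ≤ acceptance (P.potential (Q l)) u v
  measurable_weight : ∀ l, Measurable (P.weight Q l)
  abs_weight_le : ∀ l u, |P.weight Q l u| ≤ c / 2 ^ l
  measurable_increment : ∀ l, Measurable (P.increment Q l)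
  abs_increment_le : ∀ l u, |P.increment Q l u| ≤ c / 2 ^ l

variable {P Q} {ε c : ℝ}

lemma abs_coarserMean_le (H : P.GoodHierarchy Q ε c) {g : Param → ℝ} {b : ℝ}
    (hb : ∀ u, |g u| ≤ b) (l : ℕ) : |P.coarserMean Q g l| ≤ b := by
  have hb0 : 0 ≤ b := (abs_nonneg _).trans (hb (fun _ => ⟨0, by simp⟩))
  cases l with
  | zero => simpa [coarserMean] using hb0
  | succ l => exact abs_integral_gibbs_le (H.measurable_potential l) (H.potential_nonneg l) hb

lemma measurable_coarserAverage (H : P.GoodHierarchy Q ε c) (M l' l : ℕ) :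
    Measurable fun ω => P.coarserAverage Q ω M (P.increment Q l') l := by
  cases l with
  | zero => exact measurable_const
  | succ l =>
    exact (measurable_sampleAverage (H.measurable_potential l) (H.measurable_increment l') M).comp
      (measurable_pi_apply l)

lemma abs_coarserAverage_le (H : P.GoodHierarchy Q ε c) (ω : ℕ → Noise) (M l' l : ℕ) :
    |P.coarserAverage Q ω M (P.increment Q l') l| ≤ c / 2 ^ l' := by
  have := H.c_nonneg
  cases l with
  | zero => simp only [coarserAverage, abs_zero]; positivity
  | succ l => exact abs_sampleAverage_le (H.abs_increment_le l') _

lemma measurable_estimator (H : P.GoodHierarchy Q ε c) (L : ℕ) :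
    Measurable (P.estimator Q L) := by
  unfold estimator
  refine Finset.measurable_sum _ fun l _ => Finset.measurable_sum _ fun l' _ => ?_
  refine ((measurable_sampleAverage (H.measurable_potential l)
    ((H.measurable_weight l).mul (H.measurable_increment l')) _).comp (measurable_pi_apply l)).add
    (((measurable_sampleAverage (H.measurable_potential l) (H.measurable_weight l).neg _).comp
    (measurable_pi_apply l)).mul (measurable_coarserAverage H _ _ _))

lemma abs_estimator_le (H : P.GoodHierarchy Q ε c) (L : ℕ) (ω : ℕ → Noise) :
    |P.estimator Q L ω| ≤ ∑ l ∈ Finset.range (L + 1), ∑ l' ∈ Finset.range (L - l + 1),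
      2 * (c / 2 ^ l * (c / 2 ^ l')) := by
  have hc := H.c_nonneg
  unfold estimator
  refine (Finset.abs_sum_le_sum_abs _ _).trans (Finset.sum_le_sum fun l _ => ?_)
  refine (Finset.abs_sum_le_sum_abs _ _).trans (Finset.sum_le_sum fun l' _ => ?_)
  refine (abs_add_le _ _).trans ?_
  rw [two_mul]
  refine add_le_add (abs_sampleAverage_le (fun u => ?_) _) ?_
  · rw [abs_mul]
    exact mul_le_mul (H.abs_weight_le l u) (H.abs_increment_le l' u) (abs_nonneg _) (by positivity)
  · rw [abs_mul]
    refine mul_le_mul (abs_sampleAverage_le (fun u => ?_) _) (abs_coarserAverage_le H ω _ _ _)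
      (abs_nonneg _) (by positivity)
    rw [abs_neg]
    exact H.abs_weight_le l u

lemma integrable_absError (H : P.GoodHierarchy Q ε c) (L : ℕ) :
    Integrable (P.absError Q L) noisesLaw := by
  unfold absError
  exact ((integrable_const _).sub
    (integrable_of_bounds (measurable_estimator H L) (abs_estimator_le H L))).abs

lemma sampleAverage_add (Φ : Param → ℝ) (ω : Noise) (M : ℕ) (g h : Param → ℝ) :
    sampleAverage Φ ω M (fun u => g u + h u) = sampleAverage Φ ω M g + sampleAverage Φ ω M h := by
  unfold sampleAverage
  rw [Finset.sum_add_distrib, add_div]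

lemma sampleAverage_const_mul (Φ : Param → ℝ) (ω : Noise) (M : ℕ) (a : ℝ) (g : Param → ℝ) :
    sampleAverage Φ ω M (fun u => a * g u) = a * sampleAverage Φ ω M g := by
  unfold sampleAverage
  rw [← Finset.mul_sum, mul_div_assoc]

/-- The products of two sampling errors are of higher order. -/
lemma integral_abs_mul_le (H : P.GoodHierarchy Q ε c) (L l l' : ℕ) :
    ∫ ω, |(sampleAverage (P.potential (Q l)) (ω l) (sampleSize L l l') (fun u => -P.weight Q l u) -
        ∫ u, -P.weight Q l u ∂gibbs (P.potential (Q l))) *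
      (P.coarserAverage Q ω (sampleSize L l l') (P.increment Q l') l -
        P.coarserMean Q (P.increment Q l') l)| ∂noisesLaw ≤
      64 * c ^ 2 / ε ^ 2 / 2 ^ l / 2 ^ l' / 4 ^ (L - l - l') := by
  have hc := H.c_nonneg
  have hε := H.eps_pos
  cases l with
  | zero =>
    simp only [coarserAverage, coarserMean, sub_self, mul_zero, abs_zero, integral_zero]
    positivity
  | succ l =>
    simp only [coarserAverage, coarserMean]
    rw [sampleSize_eq]
    set M : ℕ := 4 ^ (L - (l + 1) - l') with hM
    have hM0 : M ≠ 0 := by positivity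
    have hMr : (M : ℝ) = 4 ^ (L - (l + 1) - l') := by rw [hM]; push_cast; rfl
    set X : Noise → ℝ := fun ω => sampleAverage (P.potential (Q (l + 1))) ω M
      (fun u => -P.weight Q (l + 1) u) -
        ∫ u, -P.weight Q (l + 1) u ∂gibbs (P.potential (Q (l + 1))) with hX
    set Y : Noise → ℝ := fun ω => sampleAverage (P.potential (Q l)) ω M (P.increment Q l') -
        ∫ u, P.increment Q l' u ∂gibbs (P.potential (Q l)) with hY
    have hA : ∀ u, |-P.weight Q (l + 1) u| ≤ c / 2 ^ (l + 1) := fun u => by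
      rw [abs_neg]; exact H.abs_weight_le _ _
    have hX2 : ∫ ω, X ω ^ 2 ∂noiseLaw ≤ (8 * (c / 2 ^ (l + 1)) / ε) ^ 2 / M :=
      integral_sampleAverage_sub_sq_le (H.measurable_potential _) (H.potential_nonneg _)
        (H.measurable_weight _).neg hA hε (H.le_acceptance _) hM0
    have hY2 : ∫ ω, Y ω ^ 2 ∂noiseLaw ≤ (8 * (c / 2 ^ l') / ε) ^ 2 / M :=
      integral_sampleAverage_sub_sq_le (H.measurable_potential _) (H.potential_nonneg _)
        (H.measurable_increment _) (H.abs_increment_le l') hε (H.le_acceptance _) hM0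
    have hXm : Measurable X := (measurable_sampleAverage (H.measurable_potential _)
      (H.measurable_weight _).neg _).sub_const _
    have hYm : Measurable Y := (measurable_sampleAverage (H.measurable_potential _)
      (H.measurable_increment _) _).sub_const _
    have hXb : ∀ ω, |X ω| ≤ c / 2 ^ (l + 1) + c / 2 ^ (l + 1) := fun ω =>
      (abs_sub _ _).trans (add_le_add (abs_sampleAverage_le hA _)
        (abs_integral_gibbs_le (H.measurable_potential _) (H.potential_nonneg _) hA))
    have hYb : ∀ ω, |Y ω| ≤ c / 2 ^ l' + c / 2 ^ l' := fun ω =>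
      (abs_sub _ _).trans (add_le_add (abs_sampleAverage_le (H.abs_increment_le l') _)
        (abs_integral_gibbs_le (H.measurable_potential _) (H.potential_nonneg _)
          (H.abs_increment_le l')))
    have iX : Integrable (fun ω : ℕ → Noise => X (ω (l + 1)) ^ 2) noisesLaw :=
      integrable_of_bounds ((hXm.comp (measurable_pi_apply _)).pow_const 2)
        (c := (c / 2 ^ (l + 1) + c / 2 ^ (l + 1)) ^ 2) fun ω => by
          rw [abs_pow]; exact pow_le_pow_left₀ (abs_nonneg _) (hXb _) 2
    have iY : Integrable (fun ω : ℕ → Noise => Y (ω l) ^ 2) noisesLaw :=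
      integrable_of_bounds ((hYm.comp (measurable_pi_apply _)).pow_const 2)
        (c := (c / 2 ^ l' + c / 2 ^ l') ^ 2) fun ω => by
          rw [abs_pow]; exact pow_le_pow_left₀ (abs_nonneg _) (hYb _) 2
    -- the weight `t` balances the sizes of the two factors
    set t : ℝ := 2 ^ (l + 1) / 2 ^ l' with ht
    have ht0 : 0 < t := by positivity
    have hpt : ∀ ω : ℕ → Noise, |X (ω (l + 1)) * Y (ω l)| ≤
        t / 2 * X (ω (l + 1)) ^ 2 + t⁻¹ / 2 * Y (ω l) ^ 2 := by
      intro ω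
      rw [abs_mul]
      have h := sq_nonneg (t * |X (ω (l + 1))| - |Y (ω l)|)
      have e : t / 2 * X (ω (l + 1)) ^ 2 + t⁻¹ / 2 * Y (ω l) ^ 2 =
          (t ^ 2 * |X (ω (l + 1))| ^ 2 + |Y (ω l)| ^ 2) / (2 * t) := by
        rw [sq_abs, sq_abs]; field_simp
      rw [e, le_div_iff₀ (by positivity)]
      nlinarith
    refine (integral_mono_of_nonneg (Eventually.of_forall fun _ => abs_nonneg _)
      ((iX.const_mul _).add (iY.const_mul _)) (Eventually.of_forall hpt)).trans ?_
    simp only [Pi.add_apply]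
    rw [integral_add (iX.const_mul _) (iY.const_mul _), integral_const_mul, integral_const_mul,
      integral_noisesLaw_eval (l + 1) (F := fun ω => X ω ^ 2) (hXm.pow_const 2),
      integral_noisesLaw_eval l (F := fun ω => Y ω ^ 2) (hYm.pow_const 2), ← hMr]
    refine (add_le_add (mul_le_mul_of_nonneg_left hX2 (by positivity))
      (mul_le_mul_of_nonneg_left hY2 (by positivity))).trans (le_of_eq ?_)
    rw [ht]
    field_simp
    ring

lemma sum_two_pow_le (L : ℕ) : ∑ l ∈ Finset.range (L + 1), ∑ l' ∈ Finset.range (L - l + 1),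
    (1 : ℝ) / 2 ^ l / 2 ^ l' / 4 ^ (L - l - l') ≤ 2 * (L + 1) / 2 ^ L := by
  have h : ∀ l ∈ Finset.range (L + 1), ∑ l' ∈ Finset.range (L - l + 1),
      (1 : ℝ) / 2 ^ l / 2 ^ l' / 4 ^ (L - l - l') ≤ 2 / 2 ^ L := by
    intro l hl
    have hl := Nat.lt_succ_iff.1 (Finset.mem_range.1 hl)
    have e : ∀ l' ∈ Finset.range (L - l + 1), (1 : ℝ) / 2 ^ l / 2 ^ l' / 4 ^ (L - l - l') =
        1 / 2 ^ L * (1 / 2) ^ (L - l - l') := by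
      intro l' hl'
      have hl' := Nat.lt_succ_iff.1 (Finset.mem_range.1 hl')
      have : (2 : ℝ) ^ L = 2 ^ l * 2 ^ l' * 2 ^ (L - l - l') := by
        rw [← pow_add, ← pow_add]; congr 1; omega
      have p24 : (4 : ℝ) ^ (L - l - l') = 2 ^ (L - l - l') * 2 ^ (L - l - l') := by
        rw [← mul_pow]; norm_num
      rw [this, p24, one_div_pow]
      field_simp
    rw [Finset.sum_congr rfl e, ← Finset.mul_sum]
    have := Finset.sum_range_reflect (fun j => ((1 : ℝ) / 2) ^ j) (L - l + 1)
    simp only [Nat.add_sub_cancel] at this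
    rw [this]
    have h3 : ∑ j ∈ Finset.range (L - l + 1), ((1 : ℝ) / 2) ^ j ≤ 2 := by
      rw [geom_sum_eq (by norm_num)]
      have h2 : (0 : ℝ) ≤ (1 / 2) ^ (L - l + 1) := by positivity
      have e : ∀ y : ℝ, (y - 1) / (1 / 2 - 1) = 2 - 2 * y := fun y => by ring
      rw [e]
      linarith
    refine (mul_le_mul_of_nonneg_left h3 (by positivity)).trans (le_of_eq (by ring))
  refine (Finset.sum_le_sum h).trans (le_of_eq ?_)
  simp only [Finset.sum_const, Finset.card_range, nsmul_eq_mul]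
  push_cast
  ring

/-- The sampling error of the multilevel estimator. -/
lemma integral_abs_estimator_sub_le (H : P.GoodHierarchy Q ε c) {L : ℕ} (hL : 1 ≤ L) :
    ∫ ω, |P.estimator Q L ω - ∑ l ∈ Finset.range (L + 1), ∑ l' ∈ Finset.range (L - l + 1),
      P.levelDiff Q l (P.increment Q l')| ∂noisesLaw ≤
      (48 * c ^ 2 / ε + 128 * c ^ 2 / ε ^ 2) * (L + 1) / 2 ^ L := by
  have hc := H.c_nonneg
  have hε := H.eps_pos
  set A := P.weight Q with hA
  set B := P.increment Q with hB
  set Φ := fun l => P.potential (Q l) with hΦ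
  have hΦm : ∀ l, Measurable (Φ l) := H.measurable_potential
  have hΦ0 : ∀ l u, 0 ≤ Φ l u := H.potential_nonneg
  have hAB : ∀ l l' u, |A l u * B l' u| ≤ c ^ 2 / 2 ^ l / 2 ^ l' := fun l l' u => by
    rw [abs_mul]
    refine (mul_le_mul (H.abs_weight_le l u) (H.abs_increment_le l' u) (abs_nonneg _)
      (by positivity)).trans (le_of_eq (by ring))
  have hAn : ∀ l u, |-A l u| ≤ c / 2 ^ l := fun l u => by
    rw [abs_neg]; exact H.abs_weight_le l u
  set b : ℕ → ℕ → ℝ := fun l l' => P.coarserMean Q (B l') l with hb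
  have hbb : ∀ l l', |b l l'| ≤ c / 2 ^ l' := fun l l' =>
    abs_coarserMean_le H (H.abs_increment_le l') l
  set a : ℕ → ℝ := fun l => ∫ u, -A l u ∂gibbs (Φ l) with ha
  have hab : ∀ l, |a l| ≤ c / 2 ^ l := fun l => abs_integral_gibbs_le (hΦm l) (hΦ0 l) (hAn l)
  set h1 : ℕ → ℕ → Param → ℝ := fun l l' u => A l u * B l' u + b l l' * -A l u with hh1
  set h2 : ℕ → ℕ → Param → ℝ := fun l l' u => a (l + 1) * B l' u with hh2
  have hb1 : ∀ l l' u, |b l l' * -A l u| ≤ c ^ 2 / 2 ^ l / 2 ^ l' := fun l l' u => by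
    rw [abs_mul]
    refine (mul_le_mul (hbb l l') (hAn l u) (abs_nonneg _) (by positivity)).trans
      (le_of_eq (by ring))
  have h1m : ∀ l l', Measurable (h1 l l') := fun l l' =>
    ((H.measurable_weight l).mul (H.measurable_increment l')).add
      ((H.measurable_weight l).neg.const_mul _)
  have h1b : ∀ l l' u, |h1 l l' u| ≤ (2 * c ^ 2) / 2 ^ l / 2 ^ l' := fun l l' u => by
    refine (abs_add_le _ _).trans ((add_le_add (hAB l l' u) (hb1 l l' u)).trans
      (le_of_eq (by ring)))
  have h2m : ∀ l l', Measurable (h2 l l') := fun l l' => (H.measurable_increment l').const_mul _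
  have h2b : ∀ l l' u, |h2 l l' u| ≤ (c ^ 2 / 2) / 2 ^ l / 2 ^ l' := fun l l' u => by
    simp only [hh2]
    rw [abs_mul]
    refine (mul_le_mul (hab (l + 1)) (H.abs_increment_le l' u) (abs_nonneg _)
      (by positivity)).trans (le_of_eq (by rw [pow_succ]; ring))
  obtain ⟨L', rfl⟩ : ∃ L', L = L' + 1 := ⟨L - 1, by omega⟩
  set S1 : (ℕ → Noise) → ℝ := fun ω => ∑ l ∈ Finset.range (L' + 1 + 1),
    ∑ l' ∈ Finset.range (L' + 1 - l + 1),
    (sampleAverage (Φ l) (ω l) (sampleSize (L' + 1) l l') (h1 l l') -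
      ∫ u, h1 l l' u ∂gibbs (Φ l)) with hS1
  set S2 : (ℕ → Noise) → ℝ := fun ω => ∑ l ∈ Finset.range (L' + 1),
    ∑ l' ∈ Finset.range (L' - l + 1),
    (sampleAverage (Φ l) (ω l) (sampleSize L' l l') (h2 l l') -
      ∫ u, h2 l l' u ∂gibbs (Φ l)) with hS2
  set T : ℕ → ℕ → (ℕ → Noise) → ℝ := fun l l' ω =>
    |(sampleAverage (Φ l) (ω l) (sampleSize (L' + 1) l l') (fun u => -A l u) - a l) *
      (P.coarserAverage Q ω (sampleSize (L' + 1) l l') (B l') l - b l l')| with hT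
  have hsa : ∀ (L l l' : ℕ) (h : Param → ℝ), Measurable h → Measurable fun ω : ℕ → Noise =>
      sampleAverage (Φ l) (ω l) (sampleSize L l l') h := fun L l l' h hh =>
    (measurable_sampleAverage (hΦm l) hh _).comp (measurable_pi_apply l)
  have hS1i : Integrable S1 noisesLaw := integrable_finsetSum _ fun l _ =>
    integrable_finsetSum _ fun l' _ => (integrable_of_bounds (hsa _ l l' _ (h1m l l'))
      fun ω => abs_sampleAverage_le (h1b l l') _).sub (integrable_const _)
  have hS2i : Integrable S2 noisesLaw := integrable_finsetSum _ fun l _ =>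
    integrable_finsetSum _ fun l' _ => (integrable_of_bounds (hsa _ l l' _ (h2m l l'))
      fun ω => abs_sampleAverage_le (h2b l l') _).sub (integrable_const _)
  have hTi : ∀ l l', Integrable (T l l') noisesLaw := fun l l' => by
    refine Integrable.abs ?_
    refine Integrable.mul_bdd (c := c / 2 ^ l' + c / 2 ^ l') ((integrable_of_bounds
      (hsa _ l l' _ (H.measurable_weight l).neg) fun ω => abs_sampleAverage_le (hAn l) _).sub
      (integrable_const _))
      ((measurable_coarserAverage H _ _ _).sub_const _).aestronglyMeasurable
      (Eventually.of_forall fun ω => ?_)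
    exact (abs_sub _ _).trans (add_le_add (abs_coarserAverage_le H _ _ _ _) (hbb l l'))
  -- splitting of the error into two linear contributions and the products of errors
  have split : ∀ ω, |P.estimator Q (L' + 1) ω - ∑ l ∈ Finset.range (L' + 1 + 1),
      ∑ l' ∈ Finset.range (L' + 1 - l + 1), P.levelDiff Q l (B l')| ≤
      |S1 ω| + |S2 ω| + ∑ l ∈ Finset.range (L' + 1 + 1), ∑ l' ∈ Finset.range (L' + 1 - l + 1),
        T l l' ω := by
    intro ω
    have e1 : S2 ω = ∑ l ∈ Finset.range (L' + 1 + 1), ∑ l' ∈ Finset.range (L' + 1 - l + 1),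
        a l * (P.coarserAverage Q ω (sampleSize (L' + 1) l l') (B l') l - b l l') := by
      rw [Finset.sum_range_succ' _ (L' + 1)]
      have z : ∑ l' ∈ Finset.range (L' + 1 - 0 + 1),
          a 0 * (P.coarserAverage Q ω (sampleSize (L' + 1) 0 l') (B l') 0 - b 0 l') = 0 :=
        Finset.sum_eq_zero fun l' _ => by simp [coarserAverage, hb, coarserMean]
      rw [z, add_zero]
      refine Finset.sum_congr rfl fun l _ => ?_
      rw [Nat.add_sub_add_right]
      refine Finset.sum_congr rfl fun l' _ => ?_
      simp only [hh2, coarserAverage, hb, coarserMean]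
      rw [sampleAverage_const_mul, integral_const_mul, ← mul_sub]
      have : sampleSize (L' + 1) (l + 1) l' = sampleSize L' l l' := by
        rw [sampleSize_eq, sampleSize_eq, Nat.add_sub_add_right]
      rw [this]
    have e2 : P.estimator Q (L' + 1) ω - ∑ l ∈ Finset.range (L' + 1 + 1),
        ∑ l' ∈ Finset.range (L' + 1 - l + 1), P.levelDiff Q l (B l') = S1 ω + S2 ω +
        ∑ l ∈ Finset.range (L' + 1 + 1), ∑ l' ∈ Finset.range (L' + 1 - l + 1),
        (sampleAverage (Φ l) (ω l) (sampleSize (L' + 1) l l') (fun u => -A l u) - a l) *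
        (P.coarserAverage Q ω (sampleSize (L' + 1) l l') (B l') l - b l l') := by
      rw [e1, hS1, estimator]
      simp only [← Finset.sum_add_distrib, ← Finset.sum_sub_distrib]
      refine Finset.sum_congr rfl fun l _ => Finset.sum_congr rfl fun l' _ => ?_
      simp only [hh1, levelDiff]
      rw [sampleAverage_add, sampleAverage_const_mul, integral_add, integral_const_mul]
      · simp only [hb, ha, hΦ, hA]
        ring
      · exact integrable_gibbs (hΦm l) (hΦ0 l) ((H.measurable_weight l).mul
          (H.measurable_increment l')) (hAB l l')
      · exact integrable_gibbs (hΦm l) (hΦ0 l) ((H.measurable_weight l).neg.const_mul _) (hb1 l l')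
    rw [e2]
    refine (abs_add_le _ _).trans (add_le_add (abs_add_le _ _) ?_)
    exact (Finset.abs_sum_le_sum_abs _ _).trans (Finset.sum_le_sum fun l _ =>
      Finset.abs_sum_le_sum_abs _ _)
  have hTs : Integrable (fun ω => ∑ l ∈ Finset.range (L' + 1 + 1),
      ∑ l' ∈ Finset.range (L' + 1 - l + 1), T l l' ω) noisesLaw :=
    integrable_finsetSum _ fun l _ => integrable_finsetSum _ fun l' _ => hTi l l'
  have hTb : ∫ ω, ∑ l ∈ Finset.range (L' + 1 + 1), ∑ l' ∈ Finset.range (L' + 1 - l + 1), T l l' ω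
      ∂noisesLaw ≤ 64 * c ^ 2 / ε ^ 2 * (2 * ((L' + 1 : ℕ) + 1) / 2 ^ (L' + 1)) := by
    rw [integral_finsetSum _ fun l _ => integrable_finsetSum _ fun l' _ => hTi l l']
    refine le_trans ?_ (mul_le_mul_of_nonneg_left (sum_two_pow_le (L' + 1)) (by positivity))
    rw [Finset.mul_sum]
    refine Finset.sum_le_sum fun l _ => ?_
    rw [integral_finsetSum _ fun l' _ => hTi l l', Finset.mul_sum]
    refine Finset.sum_le_sum fun l' _ => (integral_abs_mul_le H (L' + 1) l l').trans (le_of_eq ?_)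
    ring
  have b1 := integral_abs_multilevel_le hΦm hΦ0 hε H.le_acceptance (by positivity) h1m h1b (L' + 1)
  have b2 := integral_abs_multilevel_le hΦm hΦ0 hε H.le_acceptance (by positivity) h2m h2b L'
  refine (integral_mono_of_nonneg (Eventually.of_forall fun _ => abs_nonneg _)
    ((hS1i.abs.add hS2i.abs).add hTs) (Eventually.of_forall split)).trans ?_
  simp only [Pi.add_apply]
  rw [integral_add (f := fun ω => |S1 ω| + |S2 ω|) (hS1i.abs.add hS2i.abs) hTs,
    integral_add hS1i.abs hS2i.abs]
  refine (add_le_add (add_le_add b1 b2) hTb).trans ?_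
  have e : 16 * (c ^ 2 / 2) / ε * ((L' : ℝ) + 1) / 2 ^ L' =
      16 * c ^ 2 / ε * ((L' : ℝ) + 1) / 2 ^ (L' + 1) := by
    rw [pow_succ]; field_simp; ring
  rw [e]
  have e3 : 16 * c ^ 2 / ε * ((L' : ℝ) + 1) / 2 ^ (L' + 1) ≤
      16 * c ^ 2 / ε * (((L' + 1 : ℕ) : ℝ) + 1) / 2 ^ (L' + 1) := by
    refine div_le_div_of_nonneg_right (mul_le_mul_of_nonneg_left ?_ (by positivity))
      (by positivity)
    push_cast
    linarith
  refine (add_le_add (add_le_add le_rfl e3) le_rfl).trans (le_of_eq ?_)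
  ring

end Problem

namespace Problem

variable {d k : ℕ} {P : Problem d k} {Q : ℕ → Param → V P.D} {ε c : ℝ}

/-! ### Bias of the multilevel estimator -/

lemma coarserMean_sub (H : P.GoodHierarchy Q ε c) {g h : Param → ℝ} (hg : Measurable g)
    (hh : Measurable h) {b : ℝ} (hgb : ∀ u, |g u| ≤ b) (hhb : ∀ u, |h u| ≤ b) (l : ℕ) :
    P.coarserMean Q (fun u => g u - h u) l = P.coarserMean Q g l - P.coarserMean Q h l := by
  cases l with
  | zero => simp [coarserMean]
  | succ l =>
    exact integral_sub
      (integrable_gibbs (H.measurable_potential l) (H.potential_nonneg l) hg hgb)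
      (integrable_gibbs (H.measurable_potential l) (H.potential_nonneg l) hh hhb)

lemma abs_weight_mul_le (H : P.GoodHierarchy Q ε c) {g : Param → ℝ} {b : ℝ}
    (hgb : ∀ u, |g u| ≤ b) (l : ℕ) (u : Param) : |P.weight Q l u * g u| ≤ c / 2 ^ l * b := by
  have := H.c_nonneg
  rw [abs_mul]
  exact mul_le_mul (H.abs_weight_le l u) (hgb u) (abs_nonneg _) (by positivity)

lemma levelDiff_sub (H : P.GoodHierarchy Q ε c) {g h : Param → ℝ} (hg : Measurable g)
    (hh : Measurable h) {b : ℝ} (hgb : ∀ u, |g u| ≤ b) (hhb : ∀ u, |h u| ≤ b) (l : ℕ) :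
    P.levelDiff Q l (fun u => g u - h u) = P.levelDiff Q l g - P.levelDiff Q l h := by
  unfold levelDiff
  rw [coarserMean_sub H hg hh hgb hhb]
  simp_rw [mul_sub]
  rw [integral_sub]
  · ring
  · exact integrable_gibbs (H.measurable_potential l) (H.potential_nonneg l)
      ((H.measurable_weight l).mul hg) (abs_weight_mul_le H hgb l)
  · exact integrable_gibbs (H.measurable_potential l) (H.potential_nonneg l)
      ((H.measurable_weight l).mul hh) (abs_weight_mul_le H hhb l)

lemma abs_levelDiff_le (H : P.GoodHierarchy Q ε c) {g : Param → ℝ} {b : ℝ}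
    (hgb : ∀ u, |g u| ≤ b) (l : ℕ) : |P.levelDiff Q l g| ≤ 2 * (c / 2 ^ l * b) := by
  have hc := H.c_nonneg
  unfold levelDiff
  refine (abs_add_le _ _).trans ?_
  rw [two_mul]
  refine add_le_add (abs_integral_gibbs_le (H.measurable_potential l) (H.potential_nonneg l)
    (abs_weight_mul_le H hgb l)) ?_
  rw [abs_mul]
  refine mul_le_mul (abs_integral_gibbs_le (H.measurable_potential l) (H.potential_nonneg l)
    fun u => ?_) (abs_coarserMean_le H hgb l) (abs_nonneg _) (by positivity)
  rw [abs_neg]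
  exact H.abs_weight_le l u

/-- Telescoping over the levels of the posterior approximation. -/
lemma sum_levelDiff (H : P.GoodHierarchy Q ε c) {g : Param → ℝ} (hg : Measurable g) {b : ℝ}
    (hgb : ∀ u, |g u| ≤ b) (L : ℕ) :
    ∑ l ∈ Finset.range (L + 1), P.levelDiff Q l g = ∫ u, g u ∂gibbs (P.potential (Q L)) := by
  induction L with
  | zero => simp [levelDiff, coarserMean, weight]
  | succ L ih =>
    rw [Finset.sum_range_succ, ih]
    have := integral_gibbs_sub (H.measurable_potential L) (H.potential_nonneg L)
      (H.measurable_potential (L + 1)) (H.potential_nonneg (L + 1)) hg hgb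
    simp only [levelDiff, weight, coarserMean]
    linarith

/-- Telescoping over the levels of the approximation of the quantity of interest. -/
lemma sum_levelDiff_increment (H : P.GoodHierarchy Q ε c)
    (hg : ∀ l, Measurable fun u => P.qoi (Q l u)) {b : ℝ} (hgb : ∀ l u, |P.qoi (Q l u)| ≤ b)
    (l R : ℕ) :
    ∑ l' ∈ Finset.range (R + 1), P.levelDiff Q l (P.increment Q l') =
      P.levelDiff Q l fun u => P.qoi (Q R u) := by
  induction R with
  | zero => simp only [zero_add, Finset.sum_range_one]; rfl
  | succ R ih =>
    rw [Finset.sum_range_succ, ih]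
    have := levelDiff_sub H (hg (R + 1)) (hg R) (hgb (R + 1)) (hgb R) l
    have e : P.increment Q (R + 1) = fun u => P.qoi (Q (R + 1) u) - P.qoi (Q R u) := rfl
    rw [e, this]
    ring

/-- The multilevel estimator converges with the rate `L 2^(-L)` if the potentials and the
quantities of interest on level `l` are uniformly bounded and have errors `O(2^(-l))`. -/
theorem exists_meanError_le {B K : ℝ}
    (hΦm : ∀ l, Measurable (P.potential (Q l))) (hΦ0 : ∀ l u, 0 ≤ P.potential (Q l) u)
    (hΦB : ∀ l u, P.potential (Q l) u ≤ B)
    (hΦm' : Measurable (P.potential P.solution)) (hΦ0' : ∀ u, 0 ≤ P.potential P.solution u)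
    (hΦB' : ∀ u, P.potential P.solution u ≤ B)
    (hg : ∀ l, Measurable fun u => P.qoi (Q l u)) (hgb : ∀ l u, |P.qoi (Q l u)| ≤ K)
    (hg' : Measurable fun u => P.qoi (P.solution u)) (hgb' : ∀ u, |P.qoi (P.solution u)| ≤ K)
    (hΦd : ∀ l u, |P.potential P.solution u - P.potential (Q l) u| ≤ K / 2 ^ l)
    (hgd : ∀ l u, |P.qoi (P.solution u) - P.qoi (Q l u)| ≤ K / 2 ^ l) :
    ∃ C : ℝ, 0 ≤ C ∧ ∀ L : ℕ, 1 ≤ L → Integrable (P.absError Q L) noisesLaw ∧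
      P.meanError Q L ≤ C * L / 2 ^ L := by
  have u₀ : Param := fun _ => ⟨0, by simp⟩
  have hK : 0 ≤ K := (abs_nonneg _).trans (hgb' u₀)
  have hB : 0 ≤ B := (hΦ0' u₀).trans (hΦB' u₀)
  have hE : 1 ≤ Real.exp B := Real.one_le_exp hB
  set c : ℝ := 1 + 3 * K * Real.exp B with hc
  have hc0 : 0 ≤ c := by positivity
  have hKc : 3 * K ≤ c := by nlinarith
  have range : ∀ {x y : ℝ}, 0 ≤ x → x ≤ B → 0 ≤ y → y ≤ B → |x - y| ≤ B := fun h1 h2 h3 h4 => by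
    rw [abs_le]; constructor <;> linarith
  have consec : ∀ {x y z : ℝ} (l : ℕ), |x - y| ≤ K / 2 ^ (l + 1) → |x - z| ≤ K / 2 ^ l →
      |y - z| ≤ 3 * K / 2 ^ (l + 1) := fun {x y z} l h1 h2 => by
    have e : 3 * K / 2 ^ (l + 1) = K / 2 ^ (l + 1) + K / 2 ^ l := by
      rw [pow_succ]; field_simp; ring
    rw [e]
    have := abs_sub_le y x z
    rw [abs_sub_comm y x] at this
    linarith
  have H : P.GoodHierarchy Q (Real.exp (-B)) c :=
    { eps_pos := Real.exp_pos _
      c_nonneg := hc0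
      measurable_potential := hΦm
      potential_nonneg := hΦ0
      le_acceptance := fun l u v => le_acceptance (hΦ0 l) (hΦB l) u v
      measurable_weight := fun l => by
        cases l with
        | zero => exact measurable_const
        | succ l => exact measurable_const.sub ((hΦm (l + 1)).sub (hΦm l)).exp
      abs_weight_le := fun l u => by
        cases l with
        | zero =>
          simp only [weight, abs_one, pow_zero, div_one]
          have : 0 ≤ 3 * K * Real.exp B := by positivity
          linarith
        | succ l =>
          refine (abs_one_sub_exp_le (range (hΦ0 (l + 1) u) (hΦB (l + 1) u) (hΦ0 l u)
            (hΦB l u))).trans ?_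
          refine (mul_le_mul_of_nonneg_left (consec l (hΦd (l + 1) u) (hΦd l u))
            (Real.exp_pos _).le).trans ?_
          rw [← mul_div_assoc]
          refine div_le_div_of_nonneg_right ?_ (by positivity)
          rw [hc]; linarith
      measurable_increment := fun l => by
        cases l with
        | zero => exact hg 0
        | succ l => exact (hg (l + 1)).sub (hg l)
      abs_increment_le := fun l u => by
        cases l with
        | zero =>
          simp only [increment, pow_zero, div_one]
          linarith [hgb 0 u]
        | succ l =>
          exact (consec l (hgd (l + 1) u) (hgd l u)).trans
            (div_le_div_of_nonneg_right hKc (by positivity)) }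
  have hmain := fun {L : ℕ} (hL : 1 ≤ L) => integral_abs_estimator_sub_le H hL
  have bias : ∀ L : ℕ, |P.target - ∑ l ∈ Finset.range (L + 1), ∑ l' ∈ Finset.range (L - l + 1),
      P.levelDiff Q l (P.increment Q l')| ≤ 4 * c * K * (L + 1) / 2 ^ L := by
    intro L
    simp_rw [sum_levelDiff_increment H hg hgb]
    have e : P.target - ∑ l ∈ Finset.range (L + 1), P.levelDiff Q l (fun u => P.qoi (Q (L - l) u)) =
        (P.target - ∫ u, P.qoi (P.solution u) ∂gibbs (P.potential (Q L))) +
        ∑ l ∈ Finset.range (L + 1),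
          P.levelDiff Q l (fun u => P.qoi (P.solution u) - P.qoi (Q (L - l) u)) := by
      simp_rw [fun l => levelDiff_sub H hg' (hg (L - l)) hgb' (hgb (L - l)) l]
      rw [Finset.sum_sub_distrib, sum_levelDiff H hg' hgb']
      ring
    have b1 : |P.target - ∫ u, P.qoi (P.solution u) ∂gibbs (P.potential (Q L))| ≤
        2 * c * K / 2 ^ L := by
      have hw : ∀ u, |1 - Real.exp (P.potential P.solution u - P.potential (Q L) u)| ≤
          c / 2 ^ L := fun u => by
        refine (abs_one_sub_exp_le (range (hΦ0' u) (hΦB' u) (hΦ0 L u) (hΦB L u))).trans ?_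
        refine (mul_le_mul_of_nonneg_left (hΦd L u) (Real.exp_pos _).le).trans ?_
        rw [← mul_div_assoc]
        refine div_le_div_of_nonneg_right ?_ (by positivity)
        nlinarith [mul_nonneg hK (Real.exp_pos B).le]
      have := integral_gibbs_sub (hΦm L) (hΦ0 L) hΦm' hΦ0' hg' hgb'
      rw [target, posterior]
      change |∫ u, P.qoi (P.solution u) ∂gibbs (P.potential P.solution) - _| ≤ _
      rw [this]
      refine (abs_add_le _ _).trans ?_
      have t1 := abs_integral_gibbs_le hΦm' hΦ0' (h := fun u =>
        (1 - Real.exp (P.potential P.solution u - P.potential (Q L) u)) * P.qoi (P.solution u))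
        (c := c / 2 ^ L * K) fun u => by
          rw [abs_mul]; exact mul_le_mul (hw u) (hgb' u) (abs_nonneg _) (by positivity)
      have t2 := abs_integral_gibbs_le hΦm' hΦ0' (h := fun u =>
        -(1 - Real.exp (P.potential P.solution u - P.potential (Q L) u)))
        (c := c / 2 ^ L) fun u => by rw [abs_neg]; exact hw u
      have t3 := abs_integral_gibbs_le (hΦm L) (hΦ0 L) hgb'
      refine (add_le_add t1 ((abs_mul _ _).le.trans (mul_le_mul t2 t3 (abs_nonneg _)
        (by positivity)))).trans (le_of_eq (by ring))
    have b2 : ∀ l ∈ Finset.range (L + 1),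
        |P.levelDiff Q l (fun u => P.qoi (P.solution u) - P.qoi (Q (L - l) u))| ≤
        2 * c * K / 2 ^ L := by
      intro l hl
      refine (abs_levelDiff_le H (hgd (L - l)) l).trans (le_of_eq ?_)
      have : (2 : ℝ) ^ L = 2 ^ l * 2 ^ (L - l) := by
        rw [← pow_add, Nat.add_sub_cancel' (Nat.lt_succ_iff.1 (Finset.mem_range.1 hl))]
      rw [this]
      field_simp
    rw [e]
    refine (abs_add_le _ _).trans ((add_le_add b1 ((Finset.abs_sum_le_sum_abs _ _).trans
      (Finset.sum_le_sum b2))).trans ?_)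
    simp only [Finset.sum_const, Finset.card_range, nsmul_eq_mul]
    push_cast
    rw [← mul_div_assoc, ← add_div]
    refine div_le_div_of_nonneg_right ?_ (by positivity)
    have : 0 ≤ c * K := by positivity
    have hL0 : (0 : ℝ) ≤ L := Nat.cast_nonneg _
    nlinarith
  set C' := 48 * c ^ 2 / Real.exp (-B) + 128 * c ^ 2 / Real.exp (-B) ^ 2 + 4 * c * K with hC'
  have hC0 : 0 ≤ C' := by positivity
  refine ⟨2 * C', by positivity, fun L hL => ⟨integrable_absError H L, ?_⟩⟩
  set m := ∑ l ∈ Finset.range (L + 1), ∑ l' ∈ Finset.range (L - l + 1),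
      P.levelDiff Q l (P.increment Q l') with hm
  have hi : Integrable (fun ω => |P.estimator Q L ω - m|) noisesLaw :=
    ((integrable_of_bounds (measurable_estimator H L) (abs_estimator_le H L)).sub
      (integrable_const _)).abs
  have hpt : ∀ ω, P.absError Q L ω ≤ |P.estimator Q L ω - m| + 4 * c * K * (L + 1) / 2 ^ L := by
    intro ω
    have := abs_sub_le P.target m (P.estimator Q L ω)
    rw [abs_sub_comm m] at this
    unfold absError
    linarith [bias L]
  have h1 : P.meanError Q L ≤ C' * (L + 1) / 2 ^ L := by
    refine (integral_mono (integrable_absError H L) (hi.add (integrable_const _)) hpt).trans ?_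
    simp only [Pi.add_apply]
    rw [integral_add hi (integrable_const _)]
    simp only [integral_const, smul_eq_mul, probReal_univ, one_mul]
    refine (add_le_add (hmain hL) le_rfl).trans (le_of_eq ?_)
    rw [hC']
    ring
  refine h1.trans (div_le_div_of_nonneg_right ?_ (by positivity))
  have : (1 : ℝ) ≤ L := by exact_mod_cast hL
  nlinarith

end Problem

/-! ### Poincaré inequality -/

section Poincare

variable {d : ℕ} {D : Set (E d)}

lemma norm_gradient_eq (φ : E d → ℝ) (x : E d) : ‖gradient φ x‖ = ‖fderiv ℝ φ x‖ := by
  unfold gradient; simp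

lemma exists_poincare_testFunction (hd : d = 2 ∨ d = 3) (hD : Bornology.IsBounded D)
    (hDm : MeasurableSet D) :
    ∃ C : ℝ, ∀ φ : E d → ℝ, IsTestFunction D φ →
      ∀ p : WithLp 2 (L2 D × L2Vec D), (p.fst : E d → ℝ) =ᵐ[volume.restrict D] φ →
      (p.snd : E d → E d) =ᵐ[volume.restrict D] gradient φ → ‖p.fst‖ ≤ C * ‖p.snd‖ := by
  set C₁ := eLpNormLESNormFDerivOfLeConst ℝ (volume : Measure (E d)) D (6 / 5) 2 with hC₁
  set C₂ : ℝ≥0∞ := (volume.restrict D) Set.univ ^ (1 / (6 / 5 : ℝ) - 1 / 2) with hC₂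
  have hC₂t : C₂ ≠ ∞ := by
    refine ENNReal.rpow_ne_top_of_nonneg (by norm_num) ?_
    rw [Measure.restrict_apply_univ]
    exact hD.measure_lt_top.ne
  refine ⟨((C₁ : ℝ≥0∞) * C₂).toReal, fun φ hφ p h1 h2 => ?_⟩
  have hsupp : Function.support φ ⊆ D := (subset_tsupport φ).trans hφ.2.2
  have hfsupp : Function.support (fderiv ℝ φ) ⊆ D :=
    (support_fderiv_subset ℝ).trans hφ.2.2
  have hφ1 : ContDiff ℝ 1 φ := hφ.1.of_le (by exact_mod_cast le_top)
  -- the Gagliardo-Nirenberg-Sobolev inequality with an exponent below both dimensions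
  have gns : eLpNorm φ 2 volume ≤ C₁ * eLpNorm (fderiv ℝ φ) (6 / 5 : NNReal) volume := by
    refine eLpNorm_le_eLpNorm_fderiv_of_le (F := ℝ) (μ := (volume : Measure (E d))) (q := 2)
      hφ1 hsupp ?_ ?_ ?_ hD
    · rw [← NNReal.coe_le_coe]; push_cast; norm_num
    · rw [finrank_euclideanSpace, Fintype.card_fin]
      calc (6 / 5 : NNReal) < 2 := by rw [← NNReal.coe_lt_coe]; push_cast; norm_num
        _ ≤ d := by rcases hd with rfl | rfl <;> norm_num
    · rw [finrank_euclideanSpace, Fintype.card_fin]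
      rcases hd with rfl | rfl <;> (push_cast; norm_num)
  have e1 : eLpNorm p.fst 2 (volume.restrict D) ≤ eLpNorm φ 2 volume := by
    rw [eLpNorm_congr_ae h1]
    exact eLpNorm_mono_measure _ Measure.restrict_le_self
  have e2 : eLpNorm (fderiv ℝ φ) (6 / 5 : NNReal) volume ≤
      eLpNorm p.snd 2 (volume.restrict D) * C₂ := by
    rw [eLpNorm_congr_ae h2,
      ← eLpNorm_restrict_eq_of_support_subset (f := fderiv ℝ φ) hfsupp]
    have : eLpNorm (gradient φ) 2 (volume.restrict D) =
        eLpNorm (fderiv ℝ φ) 2 (volume.restrict D) :=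
      eLpNorm_congr_norm_ae (Eventually.of_forall fun x => norm_gradient_eq φ x)
    rw [this]
    have hp2 : ((6 / 5 : NNReal) : ℝ≥0∞) ≤ 2 := by
      have : (6 / 5 : NNReal) ≤ 2 := by rw [← NNReal.coe_le_coe]; push_cast; norm_num
      exact_mod_cast this
    have := eLpNorm_le_eLpNorm_mul_rpow_measure_univ (μ := volume.restrict D)
      (p := ((6 / 5 : NNReal) : ℝ≥0∞)) (q := 2) (f := fderiv ℝ φ) hp2
      (hφ1.continuous_fderiv one_ne_zero).aestronglyMeasurable
    convert this using 3
    simp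
  have e3 : eLpNorm p.fst 2 (volume.restrict D) ≤
      C₁ * C₂ * eLpNorm p.snd 2 (volume.restrict D) := by
    refine e1.trans (gns.trans ?_)
    calc (C₁ : ℝ≥0∞) * eLpNorm (fderiv ℝ φ) (6 / 5 : NNReal) volume
        ≤ C₁ * (eLpNorm p.snd 2 (volume.restrict D) * C₂) := by gcongr
      _ = _ := by ring
  rw [Lp.norm_def, Lp.norm_def, ← ENNReal.toReal_mul]
  refine ENNReal.toReal_mono ?_ e3
  exact ENNReal.mul_ne_top (ENNReal.mul_ne_top ENNReal.coe_ne_top hC₂t) (Lp.eLpNorm_ne_top _)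

lemma IsTestFunction.add {φ χ : E d → ℝ} (hφ : IsTestFunction D φ) (hχ : IsTestFunction D χ) :
    IsTestFunction D fun x => φ x + χ x :=
  ⟨hφ.1.add hχ.1, hφ.2.1.add hχ.2.1,
    (tsupport_add φ χ).trans (Set.union_subset hφ.2.2 hχ.2.2)⟩

lemma IsTestFunction.const_mul {φ : E d → ℝ} (c : ℝ) (hφ : IsTestFunction D φ) :
    IsTestFunction D fun x => c * φ x :=
  ⟨contDiff_const.mul hφ.1, hφ.2.1.mul_left, (tsupport_mul_subset_right).trans hφ.2.2⟩

lemma IsTestFunction.differentiable {φ : E d → ℝ} (hφ : IsTestFunction D φ) :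
    Differentiable ℝ φ := hφ.1.differentiable (by norm_num)

/-- The pairs of a test function and its gradient form a linear space, so that taking the span in
the definition of `sobolevH10` adds no elements. -/
lemma exists_testFunction_of_mem_span {p : WithLp 2 (L2 D × L2Vec D)}
    (hp : p ∈ Submodule.span ℝ {p : WithLp 2 (L2 D × L2Vec D) | ∃ φ : E d → ℝ,
      IsTestFunction D φ ∧ (p.fst : E d → ℝ) =ᵐ[volume.restrict D] φ ∧
      (p.snd : E d → E d) =ᵐ[volume.restrict D] gradient φ}) :
    ∃ φ : E d → ℝ, IsTestFunction D φ ∧ (p.fst : E d → ℝ) =ᵐ[volume.restrict D] φ ∧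
      (p.snd : E d → E d) =ᵐ[volume.restrict D] gradient φ := by
  induction hp using Submodule.span_induction with
  | mem p hp => exact hp
  | zero =>
    refine ⟨fun _ => 0, ⟨contDiff_const, HasCompactSupport.zero, by simp [tsupport]⟩, ?_, ?_⟩
    · exact Lp.coeFn_zero ℝ 2 (volume.restrict D)
    · have e : gradient (fun _ : E d => (0 : ℝ)) = 0 := by ext1 x; simp [gradient]
      rw [e]
      exact Lp.coeFn_zero (E d) 2 (volume.restrict D)
  | add p q _ _ hp hq =>
    obtain ⟨φ, hφ, h1, h2⟩ := hp
    obtain ⟨χ, hχ, h3, h4⟩ := hq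
    refine ⟨_, hφ.add hχ, ?_, ?_⟩
    · filter_upwards [h1, h3, Lp.coeFn_add p.fst q.fst] with x a b c
      have c : ((p + q).fst : E d → ℝ) x = (p.fst : E d → ℝ) x + (q.fst : E d → ℝ) x := c
      rw [c, a, b]
    · filter_upwards [h2, h4, Lp.coeFn_add p.snd q.snd] with x a b c
      have c : ((p + q).snd : E d → E d) x = (p.snd : E d → E d) x + (q.snd : E d → E d) x := c
      rw [c, a, b]
      unfold gradient
      rw [← map_add, ← fderiv_fun_add (hφ.differentiable x) (hχ.differentiable x)]
  | smul t p _ hp =>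
    obtain ⟨φ, hφ, h1, h2⟩ := hp
    refine ⟨_, hφ.const_mul t, ?_, ?_⟩
    · filter_upwards [h1, Lp.coeFn_smul t p.fst] with x a c
      have c : ((t • p).fst : E d → ℝ) x = t • (p.fst : E d → ℝ) x := c
      rw [c, a, smul_eq_mul]
    · filter_upwards [h2, Lp.coeFn_smul t p.snd] with x a c
      have c : ((t • p).snd : E d → E d) x = t • (p.snd : E d → E d) x := c
      rw [c, a]
      unfold gradient
      rw [fderiv_const_mul (hφ.differentiable x)]
      simp

lemma exists_poincare (hd : d = 2 ∨ d = 3) (hD : Bornology.IsBounded D) (hDm : MeasurableSet D) :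
    ∃ C : ℝ, 0 ≤ C ∧ ∀ v : V D, ‖v.1.fst‖ ≤ C * vNorm v := by
  obtain ⟨C, hC⟩ := exists_poincare_testFunction hd hD hDm
  refine ⟨|C|, abs_nonneg _, fun v => ?_⟩
  have hcl : IsClosed {p : WithLp 2 (L2 D × L2Vec D) | ‖p.fst‖ ≤ |C| * ‖p.snd‖} :=
    isClosed_le (by fun_prop) (by fun_prop)
  refine (closure_minimal (fun p hp => ?_) hcl) v.2
  obtain ⟨φ, hφ, h1, h2⟩ := exists_testFunction_of_mem_span hp
  exact (hC φ hφ p h1 h2).trans (mul_le_mul_of_nonneg_right (le_abs_self C) (norm_nonneg _))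

lemma vNorm_nonneg (v : V D) : 0 ≤ vNorm v := norm_nonneg _

lemma vNorm_le_norm (v : V D) : vNorm v ≤ ‖v‖ := by
  have h : ‖v‖ ^ 2 = ‖v.1.fst‖ ^ 2 + ‖v.1.snd‖ ^ 2 := WithLp.prod_norm_sq_eq_of_L2 v.1
  exact abs_le_of_sq_le_sq' (by unfold vNorm; nlinarith [sq_nonneg ‖v.1.fst‖]) (norm_nonneg _) |>.2

/-- On a bounded domain the norm of the gradient controls the norm of `H¹₀`. -/
lemma exists_norm_le_vNorm (hd : d = 2 ∨ d = 3) (hD : Bornology.IsBounded D) (hDm : MeasurableSet D) :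
    ∃ C : ℝ, 0 < C ∧ ∀ v : V D, ‖v‖ ≤ C * vNorm v := by
  obtain ⟨C, hC0, hC⟩ := exists_poincare hd hD hDm
  refine ⟨C + 1, by linarith, fun v => ?_⟩
  have h : ‖v‖ ^ 2 = ‖v.1.fst‖ ^ 2 + ‖v.1.snd‖ ^ 2 := WithLp.prod_norm_sq_eq_of_L2 v.1
  have h1 := hC v
  have h2 := vNorm_nonneg v
  refine abs_le_of_sq_le_sq' ?_ (by positivity) |>.2
  rw [h]
  change ‖v.1.fst‖ ^ 2 + vNorm v ^ 2 ≤ _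
  have h3 : ‖v.1.fst‖ ^ 2 ≤ (C * vNorm v) ^ 2 := pow_le_pow_left₀ (norm_nonneg _) h1 2
  nlinarith [mul_nonneg hC0 (sq_nonneg (vNorm v))]

end Poincare

/-! ### Galerkin solutions: existence and stability -/

section Elliptic

variable {d : ℕ} {D : Set (E d)}

instance : CompleteSpace (V D) := by
  unfold V sobolevH10; infer_instance

lemma integral_form_eq (a : LInf D) (v φ : V D) :
    ∫ x in D, a x * inner ℝ (grad v x) (grad φ x) =
      inner ℝ ((a • v.1.snd : L2Vec D)) φ.1.snd := by
  rw [L2.inner_def]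
  refine integral_congr_ae ?_
  filter_upwards [Lp.coeFn_lpSMul (r := 2) a v.1.snd] with x hx
  rw [hx]
  simp [inner_smul_left, grad]

lemma integral_load_eq (f : L2 D) (φ : V D) :
    ∫ x in D, f x * fn φ x = inner ℝ f φ.1.fst := by
  rw [L2.inner_def]
  refine integral_congr_ae (Eventually.of_forall fun x => ?_)
  simp [fn, mul_comm]

lemma abs_form_le (a : LInf D) (v φ : V D) :
    |∫ x in D, a x * inner ℝ (grad v x) (grad φ x)| ≤ ‖a‖ * vNorm v * vNorm φ := by
  rw [integral_form_eq]
  refine (abs_real_inner_le_norm _ _).trans ?_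
  exact mul_le_mul_of_nonneg_right (Lp.norm_smul_le a v.1.snd) (norm_nonneg _)

/-- Coercivity of the form with a coefficient bounded below. -/
lemma le_form {a : LInf D} {α : ℝ} (ha : ∀ᵐ x ∂volume.restrict D, α ≤ a x) (v : V D) :
    α * vNorm v ^ 2 ≤ ∫ x in D, a x * inner ℝ (grad v x) (grad v x) := by
  have e : α * vNorm v ^ 2 = ∫ x in D, α * inner ℝ (grad v x) (grad v x) := by
    rw [integral_const_mul, vNorm, ← real_inner_self_eq_norm_sq, L2.inner_def]
    rfl
  have i1 : Integrable (fun x => inner ℝ (grad v x) (grad v x)) (volume.restrict D) :=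
    L2.integrable_inner v.1.snd v.1.snd
  have i2 : Integrable (fun x => a x * inner ℝ (grad v x) (grad v x)) (volume.restrict D) := by
    refine (L2.integrable_inner (𝕜 := ℝ) (a • v.1.snd : L2Vec D) v.1.snd).congr ?_
    filter_upwards [Lp.coeFn_lpSMul (r := 2) a v.1.snd] with x hx
    rw [hx]
    simp [inner_smul_left, grad]
  rw [e]
  refine integral_mono_ae (i1.const_mul _) i2 ?_
  filter_upwards [ha] with x hx
  exact mul_le_mul_of_nonneg_right hx real_inner_self_nonneg

/-- Lax-Milgram on a complete subspace. -/
lemma exists_mem_forall_mem_eq {H : Type*} [NormedAddCommGroup H] [InnerProductSpace ℝ H]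
    (B : H →L[ℝ] H →L[ℝ] ℝ) {C : ℝ} (hC : 0 < C) (hB : ∀ v, C * ‖v‖ * ‖v‖ ≤ B v v)
    (l : H →L[ℝ] ℝ) (S : Submodule ℝ H) (hS : IsComplete (S : Set H)) :
    ∃ v ∈ S, ∀ φ ∈ S, B v φ = l φ := by
  have : CompleteSpace S := hS.completeSpace_coe
  set B' : S →L[ℝ] S →L[ℝ] ℝ := B.bilinearComp S.subtypeL S.subtypeL with hB'
  have hco : IsCoercive B' := ⟨C, hC, fun v => hB v⟩
  set v : S := hco.continuousLinearEquivOfBilin.symm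
    ((InnerProductSpace.toDual ℝ S).symm (l.comp S.subtypeL)) with hv
  refine ⟨v, v.2, fun φ hφ => ?_⟩
  have h1 := hco.continuousLinearEquivOfBilin_apply v ⟨φ, hφ⟩
  rw [hv, ContinuousLinearEquiv.apply_symm_apply, ← hv,
    InnerProductSpace.toDual_symm_apply] at h1
  exact h1.symm

/-- The bilinear form of the elliptic problem. -/
def form (a : LInf D) : V D →L[ℝ] V D →L[ℝ] ℝ :=
  LinearMap.mkContinuous₂
    (LinearMap.mk₂ ℝ (fun v φ : V D => inner ℝ ((a • v.1.snd : L2Vec D)) φ.1.snd)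
      (fun v w φ => by
        change inner ℝ ((a • (v.1.snd + w.1.snd) : L2Vec D)) φ.1.snd = _
        rw [Lp.add_smul, inner_add_left])
      (fun c v φ => by
        change inner ℝ ((a • (c • v.1.snd) : L2Vec D)) φ.1.snd = _
        rw [← Lp.smul_comm, real_inner_smul_left]; rfl)
      (fun v φ χ => by
        change inner ℝ ((a • v.1.snd : L2Vec D)) (φ.1.snd + χ.1.snd) = _
        rw [inner_add_right])
      (fun c v φ => by
        change inner ℝ ((a • v.1.snd : L2Vec D)) (c • φ.1.snd) = _
        rw [real_inner_smul_right]; rfl))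
    ‖a‖ fun v φ => by
      have h := abs_form_le a v φ
      rw [integral_form_eq] at h
      refine h.trans ?_
      have h1 := vNorm_le_norm v
      have h2 := vNorm_le_norm φ
      exact mul_le_mul (mul_le_mul_of_nonneg_left h1 (norm_nonneg _)) h2 (vNorm_nonneg _)
        (by positivity)

lemma form_apply (a : LInf D) (v φ : V D) :
    form a v φ = ∫ x in D, a x * inner ℝ (grad v x) (grad φ x) := by
  rw [integral_form_eq]; rfl

/-- The functional given by the source. -/
def loadFunctional (f : L2 D) : V D →L[ℝ] ℝ :=
  ((innerSL ℝ f).comp (WithLp.fstL 2 ℝ (L2 D) (L2Vec D))).comp (sobolevH10 D).subtypeL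

lemma loadFunctional_apply (f : L2 D) (φ : V D) :
    loadFunctional f φ = ∫ x in D, f x * fn φ x := by
  rw [integral_load_eq]; rfl

/-- Existence of the Galerkin solution. -/
lemma isGalerkinSolution_galerkin (hd : d = 2 ∨ d = 3) (hD : Bornology.IsBounded D)
    (hDm : MeasurableSet D) {S : Submodule ℝ (V D)} (hS : IsComplete (S : Set (V D)))
    {a : LInf D} {α : ℝ} (hα : 0 < α) (ha : ∀ᵐ x ∂volume.restrict D, α ≤ a x) (f : L2 D) :
    IsGalerkinSolution S a f (galerkin S a f) := by
  have hex : ∃ v, IsGalerkinSolution S a f v := by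
    obtain ⟨C, hC0, hC⟩ := exists_norm_le_vNorm hd hD hDm
    have hco : ∀ v : V D, α / C ^ 2 * ‖v‖ * ‖v‖ ≤ form a v v := by
      intro v
      rw [form_apply]
      refine le_trans ?_ (le_form ha v)
      rw [mul_assoc, div_mul_eq_mul_div, div_le_iff₀ (by positivity), mul_assoc]
      refine mul_le_mul_of_nonneg_left ?_ hα.le
      have := mul_self_le_mul_self (norm_nonneg v) (hC v)
      linarith
    obtain ⟨v, hv, h⟩ := exists_mem_forall_mem_eq (form a) (by positivity) hco
      (loadFunctional f) S hS
    refine ⟨v, hv, fun φ hφ => ?_⟩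
    rw [← form_apply, ← loadFunctional_apply]
    exact h φ hφ
  unfold galerkin
  rw [dif_pos hex]
  exact hex.choose_spec

/-- A priori bound for Galerkin solutions. -/
lemma IsGalerkinSolution.vNorm_le {S : Submodule ℝ (V D)} {a : LInf D} {α C : ℝ} (hα : 0 < α) (hC0 : 0 ≤ C)
    (hC : ∀ v : V D, ‖v.1.fst‖ ≤ C * vNorm v)
    (ha : ∀ᵐ x ∂volume.restrict D, α ≤ a x) {f : L2 D} {v : V D}
    (hv : IsGalerkinSolution S a f v) : vNorm v ≤ ‖f‖ * C / α := by
  have h1 := le_form ha v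
  rw [hv.2 v hv.1, integral_load_eq] at h1
  have h2 := (le_abs_self _).trans (abs_real_inner_le_norm f v.1.fst)
  have h3 := mul_le_mul_of_nonneg_left (hC v) (norm_nonneg f)
  rcases (vNorm_nonneg v).eq_or_lt with h0 | h0
  · rw [← h0]; positivity
  · rw [le_div_iff₀ hα]
    refine le_of_mul_le_mul_right ?_ h0
    nlinarith

/-- Dependence of Galerkin solutions on the coefficient. -/
lemma IsGalerkinSolution.vNorm_sub_le {S : Submodule ℝ (V D)} {a b : LInf D} {α : ℝ} (hα : 0 < α)
    (ha : ∀ᵐ x ∂volume.restrict D, α ≤ a x) {f : L2 D} {v w : V D}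
    (hv : IsGalerkinSolution S a f v) (hw : IsGalerkinSolution S b f w) :
    vNorm (v - w) ≤ ‖a - b‖ * vNorm w / α := by
  have hφ : v - w ∈ S := S.sub_mem hv.1 hw.1
  have h1 := le_form ha (v - w)
  have e1 := hv.2 _ hφ
  have e2 := hw.2 _ hφ
  rw [← e2] at e1
  have h2 := abs_form_le (b - a) w (v - w)
  rw [integral_form_eq] at e1 e2 h1 h2
  rw [integral_form_eq] at e1
  have s1 : (a • (v - w).1.snd : L2Vec D) = a • v.1.snd - a • w.1.snd := by
    change (a • (v.1.snd - w.1.snd) : L2Vec D) = _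
    rw [sub_eq_add_neg, Lp.add_smul, Lp.smul_neg, ← sub_eq_add_neg]
  have s2 : ((b - a) • w.1.snd : L2Vec D) = b • w.1.snd - a • w.1.snd := by
    rw [sub_eq_add_neg b a, Lp.smul_add, Lp.neg_smul, ← sub_eq_add_neg]
  rw [s1, inner_sub_left, e1, ← inner_sub_left, ← s2] at h1
  have h3 := h1.trans ((le_abs_self _).trans h2)
  rw [norm_sub_rev] at h3
  rcases (vNorm_nonneg (v - w)).eq_or_lt with h0 | h0
  · rw [← h0]
    have := vNorm_nonneg w
    positivity
  · rw [le_div_iff₀ hα]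
    refine le_of_mul_le_mul_right ?_ h0
    nlinarith

end Elliptic

/-! ### Uniform bounds and error estimates for the parametric problem -/

lemma ae_abs_le_norm {d : ℕ} {D : Set (E d)} (a : LInf D) :
    ∀ᵐ x ∂volume.restrict D, |a x| ≤ ‖a‖ := by
  have h := ae_le_eLpNormEssSup (f := (a : E d → ℝ)) (μ := volume.restrict D)
  filter_upwards [h] with x hx
  rw [← eLpNorm_exponent_top] at hx
  have := ENNReal.toReal_mono (Lp.eLpNorm_ne_top a) hx
  rwa [toReal_enorm, Real.norm_eq_abs, ← Lp.norm_def] at this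

lemma abs_param_le_one (u : Param) (j : ℕ) : |(u j : ℝ)| ≤ 1 := abs_le.2 (u j).2

namespace Problem

variable {d k : ℕ} {P : Problem d k}

lemma norm_smul_psi_le (u : Param) (j : ℕ) : ‖(u j : ℝ) • P.ψ j‖ ≤ ‖P.ψ j‖ := by
  rw [norm_smul, Real.norm_eq_abs]
  exact mul_le_of_le_one_left (norm_nonneg _) (abs_param_le_one u j)

lemma ConvexPolyhedralDomain.isOpen (h : P.ConvexPolyhedralDomain) : IsOpen P.D := by
  obtain ⟨_, s, _, hs⟩ := h
  rw [hs]; exact isOpen_interior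

lemma ConvexPolyhedralDomain.isBounded (h : P.ConvexPolyhedralDomain) :
    Bornology.IsBounded P.D := by
  obtain ⟨_, s, hf, hs⟩ := h
  rw [hs]
  exact (isBounded_convexHull.2 hf.isBounded).subset interior_subset

/-- A lower bound of the coefficients. -/
def lowerBound (P : Problem d k) (κ : ℝ) : ℝ :=
  essInf P.Kbar (volume.restrict P.D) / (1 + κ)

lemma EllipticityAssumption.lowerBound_pos {κ : ℝ} (hκ : 0 < κ) (h : P.EllipticityAssumption κ) :
    0 < P.lowerBound κ := div_pos h.1 (by linarith)

lemma EllipticityAssumption.ae_le {κ : ℝ} (hκ : 0 < κ) (h : P.EllipticityAssumption κ)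
    {r : LInf P.D} (hr : ‖r‖ ≤ ∑' j, ‖P.ψ j‖) :
    ∀ᵐ x ∂volume.restrict P.D, P.lowerBound κ ≤ (P.Kbar + r) x := by
  have hK : ∀ᵐ x ∂volume.restrict P.D, essInf P.Kbar (volume.restrict P.D) ≤ P.Kbar x := by
    refine ae_essInf_le ⟨-‖P.Kbar‖, ?_⟩
    rw [eventually_map]
    filter_upwards [ae_abs_le_norm P.Kbar] with x hx
    exact (abs_le.1 hx).1
  filter_upwards [hK, ae_abs_le_norm r, Lp.coeFn_add P.Kbar r] with x h1 h2 h3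
  rw [h3, Pi.add_apply]
  have h4 := hr.trans h.2.2
  have h5 := (abs_le.1 h2).1
  have e : P.lowerBound κ = essInf P.Kbar (volume.restrict P.D) -
      κ / (1 + κ) * essInf P.Kbar (volume.restrict P.D) := by
    unfold lowerBound
    field_simp
    ring
  rw [e]
  linarith

lemma EllipticityAssumption.ae_le_coeff {κ : ℝ} (hκ : 0 < κ) (h : P.EllipticityAssumption κ)
    (u : Param) : ∀ᵐ x ∂volume.restrict P.D, P.lowerBound κ ≤ P.coeff u x :=
  h.ae_le hκ (tsum_of_norm_bounded h.2.1.hasSum (norm_smul_psi_le u))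

lemma EllipticityAssumption.ae_le_coeffTrunc {κ : ℝ} (hκ : 0 < κ)
    (h : P.EllipticityAssumption κ) (J : ℕ) (u : Param) :
    ∀ᵐ x ∂volume.restrict P.D, P.lowerBound κ ≤ P.coeffTrunc J u x :=
  h.ae_le hκ ((norm_sum_le_of_le _ fun j _ => norm_smul_psi_le u j).trans
    (h.2.1.sum_le_tsum _ fun _ _ => norm_nonneg _))

lemma EllipticityAssumption.norm_coeff_sub_le {κ : ℝ} (h : P.EllipticityAssumption κ) (J : ℕ)
    (u : Param) : ‖P.coeff u - P.coeffTrunc J u‖ ≤ ∑' j, ‖P.ψ (J + j)‖ := by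
  have hs : Summable fun j => (u j : ℝ) • P.ψ j :=
    Summable.of_norm_bounded h.2.1 (norm_smul_psi_le u)
  unfold coeff coeffTrunc
  rw [add_sub_add_left_eq_sub, ← hs.sum_add_tsum_nat_add J, add_sub_cancel_left]
  have := tsum_of_norm_bounded (f := fun j => (u (j + J) : ℝ) • P.ψ (j + J))
    ((summable_nat_add_iff J).2 h.2.1).hasSum (fun j => norm_smul_psi_le u (j + J))
  simpa only [add_comm J] using this

lemma EllipticityAssumption.continuous_coeff {κ : ℝ} (h : P.EllipticityAssumption κ) :
    Continuous P.coeff := by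
  unfold coeff
  refine continuous_const.add (continuous_tsum (fun j => ?_) h.2.1 fun j u =>
    norm_smul_psi_le u j)
  fun_prop

lemma continuous_coeffTrunc (J : ℕ) : Continuous (P.coeffTrunc J) := by
  unfold coeffTrunc
  fun_prop

/-- Galerkin solutions depend continuously on the parameter. -/
lemma continuous_galerkin (hd : d = 2 ∨ d = 3) (hD : P.ConvexPolyhedralDomain)
    {S : Submodule ℝ (V P.D)} (hS : IsComplete (S : Set (V P.D))) {α : ℝ} (hα : 0 < α)
    {a : Param → LInf P.D} (ha : ∀ u, ∀ᵐ x ∂volume.restrict P.D, α ≤ a u x)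
    (hc : Continuous a) : Continuous fun u => galerkin S (a u) P.f := by
  obtain ⟨C, hC0, hC⟩ := exists_norm_le_vNorm hd hD.isBounded hD.isOpen.measurableSet
  have hsol := fun u => isGalerkinSolution_galerkin hd hD.isBounded hD.isOpen.measurableSet hS hα
    (ha u) P.f
  refine continuous_iff_continuousAt.2 fun u₀ => ?_
  refine tendsto_iff_dist_tendsto_zero.2 ?_
  have hlim : Tendsto (fun u => C * (‖a u - a u₀‖ * vNorm (galerkin S (a u₀) P.f) / α)) (𝓝 u₀)
      (𝓝 0) := by
    have : Continuous fun u => C * (‖a u - a u₀‖ * vNorm (galerkin S (a u₀) P.f) / α) := by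
      fun_prop
    simpa using this.tendsto u₀
  refine squeeze_zero (fun _ => dist_nonneg) (fun u => ?_) hlim
  rw [dist_eq_norm]
  exact (hC _).trans (mul_le_mul_of_nonneg_left ((hsol u).vNorm_sub_le hα (ha u) (hsol u₀)) hC0.le)

lemma isComplete_top : IsComplete ((⊤ : Submodule ℝ (V P.D)) : Set (V P.D)) :=
  completeSpace_coe_iff_isComplete.1 (by
    rw [Submodule.top_coe]; exact (isClosed_univ).completeSpace_coe)

/-- The solutions are uniformly bounded. -/
lemma exists_vNorm_solution_le (hd : d = 2 ∨ d = 3) (hD : P.ConvexPolyhedralDomain) {κ : ℝ}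
    (hκ : 0 < κ) (hell : P.EllipticityAssumption κ) :
    ∃ R : ℝ, 0 ≤ R ∧ (∀ u, vNorm (P.solution u) ≤ R) ∧
      ∀ J u, vNorm (P.solutionTrunc J u) ≤ R := by
  obtain ⟨C, hC0, hC⟩ := exists_poincare hd hD.isBounded hD.isOpen.measurableSet
  have hα := hell.lowerBound_pos hκ
  refine ⟨‖P.f‖ * C / P.lowerBound κ, by positivity, fun u => ?_, fun J u => ?_⟩
  · exact (isGalerkinSolution_galerkin hd hD.isBounded hD.isOpen.measurableSet isComplete_top hα
      (hell.ae_le_coeff hκ u) P.f).vNorm_le hα hC0 hC (hell.ae_le_coeff hκ u)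
  · exact (isGalerkinSolution_galerkin hd hD.isBounded hD.isOpen.measurableSet isComplete_top hα
      (hell.ae_le_coeffTrunc hκ J u) P.f).vNorm_le hα hC0 hC (hell.ae_le_coeffTrunc hκ J u)

lemma one_le_truncLevel (q : ℝ) (l : ℕ) : 1 ≤ truncLevel q l := Nat.one_le_two_pow

lemma truncLevel_rpow_neg_le {q : ℝ} (hq : 0 < q) (l : ℕ) :
    ((truncLevel q l : ℕ) : ℝ) ^ (-q) ≤ 1 / 2 ^ l := by
  have h1 : (l : ℝ) ≤ ⌈(l : ℝ) / q⌉₊ * q := by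
    rw [← div_le_iff₀ hq]; exact Nat.le_ceil _
  unfold truncLevel
  rw [Nat.cast_pow, Nat.cast_ofNat, ← Real.rpow_natCast, ← Real.rpow_mul (by norm_num), one_div,
    ← Real.rpow_natCast, ← Real.rpow_neg (by norm_num)]
  exact Real.rpow_le_rpow_of_exponent_le (by norm_num) (by linarith)

/-- The error of the Galerkin solutions of the hierarchy: truncation of the coefficient and finite
element error are both `O(2^(-l))`. -/
lemma exists_vNorm_levels_le (hd : d = 2 ∨ d = 3) (hD : P.ConvexPolyhedralDomain) {κ q : ℝ}
    (hκ : 0 < κ) (hq : 0 < q) (hell : P.EllipticityAssumption κ) (hdecay : P.DecayAssumption q)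
    (X : Discretization P) (hFE : X.FEAssumption) :
    ∃ C : ℝ, ∀ l u, vNorm (P.solution u - X.levels q l u) ≤ C / 2 ^ l := by
  obtain ⟨R, hR0, _, hR⟩ := exists_vNorm_solution_le hd hD hκ hell
  obtain ⟨B, hB⟩ := hFE.regular
  obtain ⟨C₁, hC₁⟩ := hFE.accurate
  obtain ⟨_, _, C₂, hC₂⟩ := hdecay
  have hα := hell.lowerBound_pos hκ
  have hC₂0 : 0 ≤ C₂ := by
    have := hC₂ 1 le_rfl
    simp only [Nat.cast_one, Real.one_rpow, mul_one] at this
    exact (tsum_nonneg fun _ => norm_nonneg _).trans this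
  refine ⟨C₂ * R / P.lowerBound κ + |C₁| * |B|, fun l u => ?_⟩
  have hJ := one_le_truncLevel q l
  set J := truncLevel q l with hJdef
  have t1 : vNorm (P.solution u - P.solutionTrunc J u) ≤ C₂ * R / P.lowerBound κ / 2 ^ l := by
    have h := (isGalerkinSolution_galerkin hd hD.isBounded hD.isOpen.measurableSet isComplete_top
      hα (hell.ae_le_coeff hκ u) P.f).vNorm_sub_le hα (hell.ae_le_coeff hκ u)
      (isGalerkinSolution_galerkin hd hD.isBounded hD.isOpen.measurableSet isComplete_top hα
        (hell.ae_le_coeffTrunc hκ J u) P.f)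
    refine h.trans ?_
    rw [div_right_comm]
    refine div_le_div_of_nonneg_right ?_ hα.le
    have h2 : ‖P.coeff u - P.coeffTrunc J u‖ ≤ C₂ / 2 ^ l := by
      refine (hell.norm_coeff_sub_le J u).trans ((hC₂ J hJ).trans ?_)
      refine (mul_le_mul_of_nonneg_left (truncLevel_rpow_neg_le hq l) hC₂0).trans
        (le_of_eq (by ring))
    refine (mul_le_mul h2 (hR J u) (vNorm_nonneg _) (by positivity)).trans (le_of_eq (by ring))
  have t2 : vNorm (P.solutionTrunc J u - X.levels q l u) ≤ |C₁| * |B| / 2 ^ l := by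
    obtain ⟨H, hH, hHB⟩ := hB J hJ u
    refine (hC₁ J hJ l u H hH).trans ?_
    have : 0 ≤ h2Norm (P.solutionTrunc J u) H := Real.sqrt_nonneg _
    rw [div_mul_eq_mul_div]
    refine div_le_div_of_nonneg_right ?_ (by positivity)
    exact mul_le_mul (le_abs_self _) (hHB.trans (le_abs_self _)) this (abs_nonneg _)
  have e : P.solution u - X.levels q l u = (P.solution u - P.solutionTrunc J u) +
      (P.solutionTrunc J u - X.levels q l u) := by abel
  rw [e, add_div]
  refine le_trans ?_ (add_le_add t1 t2)
  exact norm_add_le (P.solution u - P.solutionTrunc J u).1.snd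
    (P.solutionTrunc J u - X.levels q l u).1.snd

lemma potential_eq_sum (F : Param → V P.D) (u : Param) :
    P.potential F u = 1 / 2 * ∑ i, ∑ j, P.cov⁻¹ i j *
      ((P.data i - P.obs i (F u)) * (P.data j - P.obs j (F u))) := by
  unfold potential
  simp only [dotProduct, Matrix.mulVec, Finset.mul_sum]
  refine Finset.sum_congr rfl fun i _ => Finset.sum_congr rfl fun j _ => ?_
  ring

lemma potential_nonneg_of_posDef (hcov : P.cov.PosDef) (F : Param → V P.D) (u : Param) :
    0 ≤ P.potential F u := by
  unfold potential
  have h := hcov.inv.posSemidef.dotProduct_mulVec_nonneg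
    (fun i => P.data i - P.obs i (F u))
  simp only [star_trivial] at h
  positivity

lemma measurable_potential_of_obs {F : Param → V P.D}
    (hF : ∀ i, Measurable fun u => P.obs i (F u)) : Measurable (P.potential F) := by
  have : P.potential F = fun u => 1 / 2 * ∑ i, ∑ j, P.cov⁻¹ i j *
      ((P.data i - P.obs i (F u)) * (P.data j - P.obs j (F u))) :=
    funext (potential_eq_sum F)
  rw [this]
  fun_prop

lemma abs_quadratic_le {n : ℕ} (A : Matrix (Fin n) (Fin n) ℝ) {r : ℝ} (hr : 0 ≤ r)
    {x : Fin n → ℝ} (hx : ∀ i, |x i| ≤ r) :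
    |∑ i, ∑ j, A i j * (x i * x j)| ≤ (∑ i, ∑ j, |A i j|) * r ^ 2 := by
  rw [Finset.sum_mul]
  refine (Finset.abs_sum_le_sum_abs _ _).trans (Finset.sum_le_sum fun i _ => ?_)
  rw [Finset.sum_mul]
  refine (Finset.abs_sum_le_sum_abs _ _).trans (Finset.sum_le_sum fun j _ => ?_)
  rw [abs_mul, abs_mul, sq]
  exact mul_le_mul_of_nonneg_left (mul_le_mul (hx i) (hx j) (abs_nonneg _) hr) (abs_nonneg _)

lemma abs_quadratic_sub_le {n : ℕ} (A : Matrix (Fin n) (Fin n) ℝ) {r e : ℝ} (hr : 0 ≤ r)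
    (he : 0 ≤ e) {x y : Fin n → ℝ} (hx : ∀ i, |x i| ≤ r) (hy : ∀ i, |y i| ≤ r)
    (hxy : ∀ i, |x i - y i| ≤ e) :
    |∑ i, ∑ j, A i j * (x i * x j) - ∑ i, ∑ j, A i j * (y i * y j)| ≤
      (∑ i, ∑ j, |A i j|) * (2 * r * e) := by
  rw [Finset.sum_mul, ← Finset.sum_sub_distrib]
  refine (Finset.abs_sum_le_sum_abs _ _).trans (Finset.sum_le_sum fun i _ => ?_)
  rw [Finset.sum_mul, ← Finset.sum_sub_distrib]
  refine (Finset.abs_sum_le_sum_abs _ _).trans (Finset.sum_le_sum fun j _ => ?_)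
  rw [← mul_sub, abs_mul]
  refine mul_le_mul_of_nonneg_left ?_ (abs_nonneg _)
  have e1 : x i * x j - y i * y j = x i * (x j - y j) + (x i - y i) * y j := by ring
  rw [e1]
  refine (abs_add_le _ _).trans ?_
  rw [abs_mul, abs_mul]
  have a1 := mul_le_mul (hx i) (hxy j) (abs_nonneg _) hr
  have a2 := mul_le_mul (hxy i) (hy j) (abs_nonneg _) he
  linarith

/-- Boundedness and Lipschitz continuity of the potential with respect to the observations. -/
lemma exists_potential_bounds (P : Problem d k) {r : ℝ} (hr : 0 ≤ r) :
    ∃ K : ℝ, 0 ≤ K ∧ ∀ (F G : Param → V P.D) (u : Param) (e : ℝ), 0 ≤ e →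
      (∀ i, |P.data i - P.obs i (F u)| ≤ r) → (∀ i, |P.data i - P.obs i (G u)| ≤ r) →
      (∀ i, |P.obs i (F u) - P.obs i (G u)| ≤ e) →
      |P.potential F u| ≤ K ∧ |P.potential F u - P.potential G u| ≤ K * e := by
  set T := ∑ i, ∑ j, |P.cov⁻¹ i j| with hT
  have hT0 : 0 ≤ T := Finset.sum_nonneg fun i _ => Finset.sum_nonneg fun j _ => abs_nonneg _
  have h2 : |(1 / 2 : ℝ)| = 1 / 2 := by norm_num
  have h4 : 0 ≤ T * r ^ 2 := by positivity
  refine ⟨T * r ^ 2 + T * (2 * r), by positivity, fun F G u e he hF hG hFG => ⟨?_, ?_⟩⟩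
  · have h1 := abs_quadratic_le P.cov⁻¹ hr (x := fun i => P.data i - P.obs i (F u)) hF
    rw [potential_eq_sum, abs_mul, h2]
    have h3 : 0 ≤ T * (2 * r) := by positivity
    linarith
  · have h1 := abs_quadratic_sub_le P.cov⁻¹ hr he (x := fun i => P.data i - P.obs i (F u))
      (y := fun i => P.data i - P.obs i (G u)) hF hG fun i => by
        rw [sub_sub_sub_cancel_left, abs_sub_comm]; exact hFG i
    rw [potential_eq_sum, potential_eq_sum, ← mul_sub, abs_mul, h2]
    have h3 : 0 ≤ T * (2 * r * e) := by positivity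
    have h5 : 0 ≤ T * r ^ 2 * e := by positivity
    linarith

set_option maxHeartbeats 1000000 in
/-- The error bound for every hierarchy of measurable forward maps which approximates the solution
with the error `O(2^(-l))` uniformly in the parameter. -/
theorem exists_meanError_le_of_levels (hd : d = 2 ∨ d = 3) (hD : P.ConvexPolyhedralDomain)
    (hcov : P.cov.PosDef) {κ : ℝ} (hκ : 0 < κ) (hell : P.EllipticityAssumption κ)
    {Q : ℕ → Param → V P.D} (hobs : ∀ l i, Measurable fun u => P.obs i (Q l u))
    (hqoi : ∀ l, Measurable fun u => P.qoi (Q l u)) {C : ℝ}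
    (hQ : ∀ l u, vNorm (P.solution u - Q l u) ≤ C / 2 ^ l) :
    Integrable (fun u => P.qoi (P.solution u)) (P.posterior P.solution) ∧
    ∃ C : ℝ, 0 ≤ C ∧ ∀ L : ℕ, 1 ≤ L → Integrable (P.absError Q L) noisesLaw ∧
      P.meanError Q L ≤ C * L / 2 ^ L := by
  obtain ⟨R, hR0, hR, _⟩ := exists_vNorm_solution_le hd hD hκ hell
  obtain ⟨C₁, hC₁0, hC₁⟩ := exists_norm_le_vNorm (D := P.D) hd hD.isBounded
    hD.isOpen.measurableSet
  have hα := hell.lowerBound_pos hκ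
  have hcont : Continuous P.solution := continuous_galerkin hd hD isComplete_top hα
    (hell.ae_le_coeff hκ) hell.continuous_coeff
  have u₀ : Param := fun _ => ⟨0, by simp⟩
  have hC0 : 0 ≤ C := by
    have := (vNorm_nonneg _).trans (hQ 0 u₀)
    simpa using this
  have hQn : ∀ l u, ‖P.solution u - Q l u‖ ≤ C₁ * C / 2 ^ l := fun l u =>
    (hC₁ _).trans ((mul_le_mul_of_nonneg_left (hQ l u) hC₁0.le).trans (le_of_eq (by ring)))
  have hPn : ∀ u, ‖P.solution u‖ ≤ C₁ * R := fun u =>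
    (hC₁ _).trans (mul_le_mul_of_nonneg_left (hR u) hC₁0.le)
  have hQb : ∀ l u, ‖Q l u‖ ≤ C₁ * R + C₁ * C := fun l u => by
    have e : Q l u = P.solution u - (P.solution u - Q l u) := by abel
    rw [e]
    refine (norm_sub_le _ _).trans (add_le_add (hPn u) ((hQn l u).trans ?_))
    exact div_le_self (by positivity) (one_le_pow₀ (by norm_num))
  -- a common bound for the norms of the functionals and for the data
  set N := ‖P.qoi‖ + ∑ i, ‖P.obs i‖ with hN
  have hNq : ‖P.qoi‖ ≤ N := le_add_of_nonneg_right (Finset.sum_nonneg fun i _ =>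
    norm_nonneg (P.obs i))
  have hNo : ∀ i, ‖P.obs i‖ ≤ N := fun i =>
    (Finset.single_le_sum (f := fun i => ‖P.obs i‖) (fun j _ => norm_nonneg (P.obs j))
      (Finset.mem_univ i)).trans (le_add_of_nonneg_left (norm_nonneg P.qoi))
  have hN0 : 0 ≤ N := (norm_nonneg P.qoi).trans hNq
  have happ : ∀ (F : V P.D →L[ℝ] ℝ), ‖F‖ ≤ N → ∀ (v : V P.D) (b : ℝ), ‖v‖ ≤ b → |F v| ≤ N * b :=
    fun F hF v b hv => (F.le_opNorm v).trans
      (mul_le_mul hF hv (norm_nonneg _) hN0)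
  set b := C₁ * R + C₁ * C with hb
  have hb0 : 0 ≤ b := by positivity
  have hPb : ∀ u, ‖P.solution u‖ ≤ b := fun u => (hPn u).trans
    (le_add_of_nonneg_right (by positivity))
  set r := ∑ i, |P.data i| + N * b with hr
  have hr0 : 0 ≤ r := add_nonneg (Finset.sum_nonneg fun _ _ => abs_nonneg _) (by positivity)
  have hdata : ∀ i (v : V P.D), ‖v‖ ≤ b → |P.data i - P.obs i v| ≤ r := fun i v hv => by
    refine (abs_sub _ _).trans (add_le_add ?_ (happ _ (hNo i) v b hv))
    exact Finset.single_le_sum (f := fun i => |P.data i|) (fun _ _ => abs_nonneg _)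
      (Finset.mem_univ i)
  obtain ⟨K, hK0, hK⟩ := exists_potential_bounds P hr0
  have hdiff : ∀ (F : V P.D →L[ℝ] ℝ), ‖F‖ ≤ N → ∀ l u,
      |F (P.solution u) - F (Q l u)| ≤ N * (C₁ * C / 2 ^ l) := fun F hF l u => by
    rw [← map_sub]
    exact happ F hF _ _ (hQn l u)
  have hsolm : ∀ F : V P.D →L[ℝ] ℝ, Measurable fun u => F (P.solution u) := fun F =>
    (F.continuous.comp hcont).measurable
  have hΦm' : Measurable (P.potential P.solution) :=
    measurable_potential_of_obs fun i => hsolm (P.obs i)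
  have hpos := fun F u => potential_nonneg_of_posDef (P := P) hcov F u
  set K' := K * (N * (C₁ * C)) + N * b + N * (C₁ * C) with hK'
  have hK1 : K * (N * (C₁ * C)) ≤ K' := by
    have : 0 ≤ N * b := by positivity
    have : 0 ≤ N * (C₁ * C) := by positivity
    linarith
  have hK2 : N * b ≤ K' := by
    have : 0 ≤ K * (N * (C₁ * C)) := by positivity
    have : 0 ≤ N * (C₁ * C) := by positivity
    linarith
  have hK3 : N * (C₁ * C) ≤ K' := by
    have : 0 ≤ K * (N * (C₁ * C)) := by positivity
    have : 0 ≤ N * b := by positivity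
    linarith
  refine ⟨integrable_gibbs hΦm' (hpos _) (hsolm P.qoi) (fun u => happ _ hNq _ _ (hPb u)), ?_⟩
  refine exists_meanError_le (B := K) (K := K')
    (fun l => measurable_potential_of_obs (hobs l)) (fun l => hpos _) (fun l u => ?_) hΦm'
    (hpos _) (fun u => ?_) hqoi (fun l u => ?_) (hsolm P.qoi) (fun u => ?_) (fun l u => ?_)
    (fun l u => ?_)
  · exact (le_abs_self _).trans (hK (Q l) (Q l) u 0 le_rfl (fun i => hdata i _ (hQb l u))
      (fun i => hdata i _ (hQb l u)) (fun i => by simp)).1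
  · exact (le_abs_self _).trans (hK P.solution P.solution u 0 le_rfl
      (fun i => hdata i _ (hPb u)) (fun i => hdata i _ (hPb u)) (fun i => by simp)).1
  · exact (happ _ hNq _ _ (hQb l u)).trans hK2
  · exact (happ _ hNq _ _ (hPb u)).trans hK2
  · refine (hK P.solution (Q l) u (N * (C₁ * C / 2 ^ l)) (by positivity)
      (fun i => hdata i _ (hPb u)) (fun i => hdata i _ (hQb l u))
      (fun i => hdiff _ (hNo i) l u)).2.trans ?_
    have e : K * (N * (C₁ * C / 2 ^ l)) = K * (N * (C₁ * C)) / 2 ^ l := by ring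
    rw [e]
    exact div_le_div_of_nonneg_right hK1 (by positivity)
  · refine (hdiff _ hNq l u).trans ?_
    have e : N * (C₁ * C / 2 ^ l) = N * (C₁ * C) / 2 ^ l := by ring
    rw [e]
    exact div_le_div_of_nonneg_right hK3 (by positivity)

lemma isComplete_feSpace (X : Discretization P) (l : ℕ) :
    IsComplete (feSpace X.meshes l : Set (V P.D)) := by
  have : FiniteDimensional ℝ (feSpace X.meshes l) := Module.Basis.finiteDimensional_of_finite (X.basis l)
  exact Submodule.complete_of_finiteDimensional _

/-- The error bound for the exact Galerkin solutions. -/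
theorem exists_meanError_galerkin_le (hd : d = 2 ∨ d = 3) (hD : P.ConvexPolyhedralDomain)
    (hcov : P.cov.PosDef) {κ q : ℝ} (hκ : 0 < κ) (hq : 0 < q) (hell : P.EllipticityAssumption κ)
    (hdecay : P.DecayAssumption q) (X : Discretization P) (hFE : X.FEAssumption) :
    Integrable (fun u => P.qoi (P.solution u)) (P.posterior P.solution) ∧
    ∃ C : ℝ, 0 ≤ C ∧ ∀ L : ℕ, 1 ≤ L → Integrable (P.absError (X.levels q) L) noisesLaw ∧
      P.meanError (X.levels q) L ≤ C * L / 2 ^ L := by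
  obtain ⟨C, hC⟩ := exists_vNorm_levels_le hd hD hκ hq hell hdecay X hFE
  have hcont : ∀ l, Continuous (X.levels q l) := fun l =>
    continuous_galerkin hd hD (isComplete_feSpace X l) (hell.lowerBound_pos hκ)
      (hell.ae_le_coeffTrunc hκ _) (continuous_coeffTrunc _)
  exact exists_meanError_le_of_levels hd hD hcov hκ hell
    (fun l i => ((P.obs i).continuous.comp (hcont l)).measurable)
    (fun l => (P.qoi.continuous.comp (hcont l)).measurable) hC

/-- The error bound for the computed solutions of a linear scaling solver. -/
theorem exists_meanError_solver_le (hd : d = 2 ∨ d = 3) (hD : P.ConvexPolyhedralDomain)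
    (hcov : P.cov.PosDef) {κ q : ℝ} (hκ : 0 < κ) (hq : 0 < q) (hell : P.EllipticityAssumption κ)
    (hdecay : P.DecayAssumption q) (X : Discretization P) (hFE : X.FEAssumption)
    (S : Solver X) (hS : S.IsLinearScaling q) :
    ∃ C : ℝ, 0 ≤ C ∧ ∀ L : ℕ, 1 ≤ L → Integrable (P.absError (S.levels q) L) noisesLaw ∧
      P.meanError (S.levels q) L ≤ C * L / 2 ^ L := by
  obtain ⟨C, hC⟩ := exists_vNorm_levels_le hd hD hκ hq hell hdecay X hFE
  obtain ⟨C', hC'⟩ := hS.accurate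
  have hm : ∀ (F : V P.D →L[ℝ] ℝ) l, Measurable fun u => F (S.levels q l u) := fun F l => by
    have e : (fun u => F (S.levels q l u)) =
        fun u => ∑ i, S.coeffs q l u i * F (X.w l i) := by
      ext u
      simp only [Solver.levels, map_sum, map_smul, smul_eq_mul]
    rw [e]
    exact Finset.measurable_sum _ fun i _ =>
      ((measurable_pi_apply i).comp (hS.measurable l)).mul_const _
  refine (exists_meanError_le_of_levels hd hD hcov hκ hell (fun l i => hm (P.obs i) l)
    (fun l => hm P.qoi l) (C := C + C') fun l u => ?_).2
  have e : P.solution u - S.levels q l u = (P.solution u - X.levels q l u) +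
      (X.levels q l u - S.levels q l u) := by abel
  rw [e, add_div]
  exact (norm_add_le (P.solution u - X.levels q l u).1.snd
    (X.levels q l u - S.levels q l u).1.snd).trans (add_le_add (hC l u) (hC' l u))

end Problem

/-! ### Piecewise affine functions belong to `H¹₀` -/

section Mollification

open scoped Convolution

variable {d : ℕ} {D : Set (E d)}

lemma gradient_eq_of_affine_near {u : E d → ℝ} {x b : E d} {r : ℝ} (hr : 0 < r)
    (h : ∀ y ∈ Metric.ball x r, u y = u x + inner ℝ b (y - x)) : gradient u x = b := by
  refine HasGradientAt.gradient ?_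
  rw [hasGradientAt_iff_hasFDerivAt]
  have h1 : HasFDerivAt (fun y => u x + inner ℝ b (y - x))
      (InnerProductSpace.toDual ℝ (E d) b) x := by
    have h2 := (InnerProductSpace.toDual ℝ (E d) b).hasFDerivAt (x := x)
    have h3 := h2.const_add (u x - inner ℝ b x)
    refine h3.congr_of_eventuallyEq (Eventually.of_forall fun y => ?_)
    simp only [inner_sub_right, InnerProductSpace.toDual_apply_apply]
    ring
  refine h1.congr_of_eventuallyEq ?_
  filter_upwards [Metric.ball_mem_nhds x hr] with y hy using h y hy

/-- Mollification of a Lipschitz function: it keeps the Lipschitz constant, and it keeps the slope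
at points near which the function is affine. -/
lemma exists_mollification {u : E d → ℝ} {K : NNReal} (hu : LipschitzWith K u)
    {ε : ℝ} (hε : 0 < ε) :
    ∃ φ : E d → ℝ, ContDiff ℝ (⊤ : ℕ∞) φ ∧ tsupport φ ⊆ Metric.cthickening ε (tsupport u) ∧
      LipschitzWith K φ ∧ (∀ x, |φ x - u x| ≤ K * ε) ∧
      ∀ x b, (∀ y ∈ Metric.ball x (2 * ε), u y = u x + inner ℝ b (y - x)) → gradient φ x = b := by
  let η : ContDiffBump (0 : E d) := ⟨ε / 2, ε, by linarith, by linarith⟩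
  set ρ : E d → ℝ := η.normed volume with hρ
  have hsupp : Function.support ρ = Metric.ball 0 ε := η.support_normed_eq
  have hρ0 : ∀ x, 0 ≤ ρ x := η.nonneg_normed
  have hρ1 : ∫ x, ρ x = 1 := η.integral_normed
  have hρi : Integrable ρ := η.integrable_normed
  have hρc : HasCompactSupport ρ := η.hasCompactSupport_normed
  set φ : E d → ℝ := ρ ⋆[ContinuousLinearMap.lsmul ℝ ℝ, volume] u with hφ
  have hval : ∀ x, φ x = ∫ t, ρ t * u (x - t) := fun x => by
    rw [hφ, convolution_def]; simp
  have hint : ∀ x, Integrable fun t => ρ t * u (x - t) := fun x => by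
    have hcont : Continuous fun t => ρ t * u (x - t) :=
      (η.continuous_normed).mul (hu.continuous.comp (by fun_prop))
    exact hcont.integrable_of_hasCompactSupport hρc.mul_right
  -- integrals against the bump only see the ball of radius `ε`
  have hbound : ∀ (g : E d → ℝ) (B : ℝ), (∀ t ∈ Metric.ball (0 : E d) ε, |g t| ≤ B) →
      |∫ t, ρ t * g t| ≤ B := by
    intro g B hB
    calc |∫ t, ρ t * g t| ≤ ∫ t, ρ t * B := by
          rw [← Real.norm_eq_abs]
          refine norm_integral_le_of_norm_le (hρi.mul_const B) (Eventually.of_forall fun t => ?_)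
          rw [norm_mul, Real.norm_eq_abs, Real.norm_eq_abs, abs_of_nonneg (hρ0 t)]
          by_cases ht : t ∈ Metric.ball (0 : E d) ε
          · exact mul_le_mul_of_nonneg_left (hB t ht) (hρ0 t)
          · rw [← hsupp, Function.notMem_support] at ht
            simp [ht]
      _ = B := by rw [integral_mul_const, hρ1, one_mul]
  refine ⟨φ, ?_, ?_, ?_, ?_, ?_⟩
  · exact hρc.contDiff_convolution_left _ η.contDiff_normed hu.continuous.locallyIntegrable
  · refine closure_minimal ?_ Metric.isClosed_cthickening
    refine (support_convolution_subset _).trans ?_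
    rintro _ ⟨a, ha, b, hb, rfl⟩
    rw [hsupp, mem_ball_zero_iff] at ha
    refine Metric.mem_cthickening_of_dist_le _ b ε _ (subset_tsupport u hb) ?_
    simpa [dist_eq_norm] using ha.le
  · refine LipschitzWith.of_dist_le_mul fun x y => ?_
    rw [Real.dist_eq, hval, hval, ← integral_sub (hint x) (hint y)]
    simp_rw [← mul_sub]
    refine hbound (fun t => u (x - t) - u (y - t)) _ fun t _ => ?_
    have := hu.dist_le_mul (x - t) (y - t)
    rwa [Real.dist_eq, dist_sub_right] at this
  · intro x
    have h2 : φ x - u x = ∫ t, ρ t * (u (x - t) - u x) := by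
      simp_rw [mul_sub]
      rw [integral_sub (hint x) (hρi.mul_const _), integral_mul_const, hρ1, one_mul, hval]
    rw [h2]
    refine hbound (fun t => u (x - t) - u x) _ fun t ht => ?_
    have := hu.dist_le_mul (x - t) x
    rw [Real.dist_eq] at this
    refine this.trans (mul_le_mul_of_nonneg_left ?_ K.coe_nonneg)
    rw [mem_ball_zero_iff] at ht
    simpa [dist_eq_norm] using ht.le
  · intro x b hb
    have key : ∀ y ∈ Metric.ball x ε, φ y = φ x + inner ℝ b (y - x) := by
      intro y hy
      have h3 : φ y - φ x - inner ℝ b (y - x) =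
          ∫ t, ρ t * (u (y - t) - u (x - t) - inner ℝ b (y - x)) := by
        simp_rw [mul_sub (ρ _)]
        have h6 : Integrable fun t => ρ t * u (y - t) - ρ t * u (x - t) := (hint y).sub (hint x)
        rw [integral_sub h6 (hρi.mul_const _), integral_mul_const, hρ1,
          one_mul, integral_sub (hint y) (hint x), hval, hval]
      have h4 : |φ y - φ x - inner ℝ b (y - x)| ≤ 0 := by
        rw [h3]
        refine hbound (fun t => u (y - t) - u (x - t) - inner ℝ b (y - x)) 0 fun t ht => ?_
        rw [mem_ball_zero_iff] at ht
        rw [mem_ball_iff_norm] at hy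
        have e1 := hb (x - t) (by rw [mem_ball_iff_norm]; simp; linarith)
        have e2 := hb (y - t) (by
          rw [mem_ball_iff_norm]
          calc ‖y - t - x‖ = ‖(y - x) - t‖ := by congr 1; abel
            _ ≤ ‖y - x‖ + ‖t‖ := norm_sub_le _ _
            _ < _ := by linarith)
        rw [e1, e2, show y - t - x = (y - x) + (x - t - x) by abel, inner_add_right]
        simp
      have := abs_nonpos_iff.1 h4
      linarith
    exact gradient_eq_of_affine_near hε key

/-- Bounded convergence in `L²` of a finite measure. -/
lemma tendsto_eLpNorm_sub_of_bounded {α F : Type*} [MeasurableSpace α] [NormedAddCommGroup F]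
    {μ : Measure α} [IsFiniteMeasure μ] {f : ℕ → α → F} {g : α → F} {B : ℝ}
    (hf : ∀ n, AEStronglyMeasurable (f n) μ) (hg : AEStronglyMeasurable g μ)
    (hfB : ∀ n, ∀ᵐ x ∂μ, ‖f n x - g x‖ ≤ B)
    (hlim : ∀ᵐ x ∂μ, Tendsto (fun n => f n x) atTop (𝓝 (g x))) :
    Tendsto (fun n => eLpNorm (f n - g) 2 μ) atTop (𝓝 0) := by
  have h1 : Tendsto (fun n => ∫⁻ x, ‖f n x - g x‖ₑ ^ (2 : ℝ) ∂μ) atTop (𝓝 (∫⁻ _, 0 ∂μ)) := by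
    refine tendsto_lintegral_of_dominated_convergence' (fun _ => ENNReal.ofReal B ^ (2 : ℝ))
      (fun n => ((hf n).sub hg).enorm.pow_const _) (fun n => ?_) ?_ ?_
    · filter_upwards [hfB n] with x hx
      gcongr
      rw [← ofReal_norm]
      exact ENNReal.ofReal_le_ofReal hx
    · rw [lintegral_const]
      exact ENNReal.mul_ne_top (by simp) (measure_ne_top _ _)
    · filter_upwards [hlim] with x hx
      have h2 : Tendsto (fun n => f n x - g x) atTop (𝓝 0) := by
        simpa using hx.sub_const (g x)
      have h3 := (h2.enorm).ennrpow_const 2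
      simpa using h3
  have h4 := h1.ennrpow_const (1 / 2)
  simp only [lintegral_zero] at h4
  rw [ENNReal.zero_rpow_of_pos (by norm_num)] at h4
  refine h4.congr fun n => ?_
  rw [eLpNorm_eq_lintegral_rpow_enorm_toReal (by norm_num) (by norm_num)]
  simp

/-- A Lipschitz function with compact support in `D` which is affine near almost every point of `D`
belongs to `H¹₀(D)`. -/
lemma exists_fn_ae_eq_of_lipschitz (hD : IsOpen D) (hDb : Bornology.IsBounded D)
    {u : E d → ℝ} {K : NNReal} (hu : LipschitzWith K u) (hc : HasCompactSupport u)
    (hs : tsupport u ⊆ D)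
    (haff : ∀ᵐ x ∂(volume.restrict D), ∃ r > 0, ∃ b : E d, ∀ y ∈ Metric.ball x r,
      u y = u x + inner ℝ b (y - x)) :
    ∃ v : V D, fn v =ᵐ[volume.restrict D] u := by
  have : IsFiniteMeasure (volume.restrict D) :=
    ⟨by rw [Measure.restrict_apply_univ]; exact hDb.measure_lt_top⟩
  obtain ⟨δ, hδ, hδD⟩ := hc.isCompact.exists_cthickening_subset_open hD hs
  have hε : ∀ n : ℕ, 0 < δ / (n + 1) := fun n => by positivity
  have hεδ : ∀ n : ℕ, δ / (n + 1) ≤ δ := fun n => div_le_self hδ.le (by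
    have : (0 : ℝ) ≤ n := n.cast_nonneg
    linarith)
  have hεlim : Tendsto (fun n : ℕ => δ / ((n : ℝ) + 1)) atTop (𝓝 0) := by
    have := (tendsto_one_div_add_atTop_nhds_zero_nat (𝕜 := ℝ)).const_mul δ
    simpa [div_eq_mul_inv] using this
  choose φ h1 h2 h3 h4 h5 using fun n : ℕ => exists_mollification hu (hε n)
  have htest : ∀ n, IsTestFunction D (φ n) := fun n => by
    have hsub : tsupport (φ n) ⊆ Metric.cthickening δ (tsupport u) :=
      (h2 n).trans (Metric.cthickening_mono (hεδ n) _)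
    refine ⟨h1 n, ?_, hsub.trans hδD⟩
    exact (hc.isCompact.cthickening).of_isClosed_subset (isClosed_tsupport _) hsub
  have hgm : ∀ f : E d → ℝ, Measurable (gradient f) := fun f =>
    (InnerProductSpace.toDual ℝ (E d)).symm.continuous.measurable.comp (measurable_fderiv ℝ f)
  have hgb : ∀ f : E d → ℝ, LipschitzWith K f → ∀ x, ‖gradient f x‖ ≤ K := fun f hf x => by
    rw [norm_gradient_eq]; exact norm_fderiv_le_of_lipschitz ℝ hf
  obtain ⟨B, hB⟩ := hc.exists_bound_of_continuous hu.continuous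
  have hφB : ∀ n x, ‖φ n x‖ ≤ B + K * δ := fun n x => by
    have e := h4 n x
    have e1 : (K : ℝ) * (δ / (n + 1)) ≤ K * δ := mul_le_mul_of_nonneg_left (hεδ n) K.coe_nonneg
    have e2 : ‖φ n x‖ ≤ ‖φ n x - u x‖ + ‖u x‖ := by
      simpa using norm_add_le (φ n x - u x) (u x)
    rw [Real.norm_eq_abs (φ n x - u x)] at e2
    linarith [hB x]
  have m1 : ∀ n, MemLp (φ n) 2 (volume.restrict D) := fun n =>
    MemLp.of_bound (h3 n).continuous.aestronglyMeasurable _ (Eventually.of_forall (hφB n))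
  have m2 : ∀ n, MemLp (gradient (φ n)) 2 (volume.restrict D) := fun n =>
    MemLp.of_bound (hgm _).aestronglyMeasurable K (Eventually.of_forall (hgb _ (h3 n)))
  have m3 : MemLp u 2 (volume.restrict D) :=
    MemLp.of_bound hu.continuous.aestronglyMeasurable _ (Eventually.of_forall hB)
  have m4 : MemLp (gradient u) 2 (volume.restrict D) :=
    MemLp.of_bound (hgm _).aestronglyMeasurable K (Eventually.of_forall (hgb _ hu))
  have l1 : Tendsto (fun n => (m1 n).toLp (φ n)) atTop (𝓝 (m3.toLp u)) := by
    rw [Lp.tendsto_Lp_iff_tendsto_eLpNorm'']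
    refine tendsto_eLpNorm_sub_of_bounded (B := K * δ) (fun n => (m1 n).1) m3.1
      (fun n => Eventually.of_forall fun x => ?_) (Eventually.of_forall fun x => ?_)
    · rw [Real.norm_eq_abs]
      exact (h4 n x).trans (mul_le_mul_of_nonneg_left (hεδ n) K.coe_nonneg)
    · rw [tendsto_iff_dist_tendsto_zero]
      refine squeeze_zero (fun _ => dist_nonneg) (fun n => (Real.dist_eq _ _).trans_le (h4 n x)) ?_
      simpa using hεlim.const_mul (K : ℝ)
  have l2 : Tendsto (fun n => (m2 n).toLp (gradient (φ n))) atTop (𝓝 (m4.toLp (gradient u))) := by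
    rw [Lp.tendsto_Lp_iff_tendsto_eLpNorm'']
    refine tendsto_eLpNorm_sub_of_bounded (B := K + K) (fun n => (m2 n).1) m4.1
      (fun n => Eventually.of_forall fun x => ?_) ?_
    · exact (norm_sub_le _ _).trans (add_le_add (hgb _ (h3 n) x) (hgb _ hu x))
    · filter_upwards [haff] with x hx
      obtain ⟨r, hr, b, hb⟩ := hx
      have hub : gradient u x = b := gradient_eq_of_affine_near hr hb
      refine tendsto_const_nhds.congr' ?_
      have : ∀ᶠ n : ℕ in atTop, δ / ((n : ℝ) + 1) < r / 2 := hεlim.eventually_lt_const (by linarith)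
      filter_upwards [this] with n hn
      rw [hub]
      refine (h5 n x b fun y hy => hb y ?_).symm
      exact Metric.ball_subset_ball (by linarith) hy
  have hmem : WithLp.toLp 2 (m3.toLp u, m4.toLp (gradient u)) ∈ sobolevH10 D := by
    refine mem_closure_of_tendsto (f := fun n =>
      WithLp.toLp 2 ((m1 n).toLp (φ n), (m2 n).toLp (gradient (φ n)))) (b := atTop) ?_ ?_
    · exact ((WithLp.prod_continuous_toLp 2 (L2 D) (L2Vec D)).tendsto _).comp
        (l1.prodMk_nhds l2)
    · refine Eventually.of_forall fun n => Submodule.subset_span ⟨φ n, htest n, ?_, ?_⟩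
      · exact (m1 n).coeFn_toLp
      · exact (m2 n).coeFn_toLp
  exact ⟨⟨_, hmem⟩, m3.coeFn_toLp⟩

end Mollification

/-! ### Nodal interpolation on a simplicial mesh -/

section Interpolation

variable {d : ℕ} {D : Set (E d)} {K : Geometry.SimplicialComplex ℝ (E d)}

/-- Prescribed values at the vertices of a nondegenerate simplex are attained by an affine
function. -/
lemma exists_affine_interpolant {s : Finset (E d)} (hs : s ∈ cells K) (c : E d → ℝ) :
    ∃ (a : ℝ) (b : E d), ∀ w ∈ s, a + inner ℝ b w = c w := by
  have hi := K.indep hs.1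
  have ht : affineSpan ℝ (Set.range ((↑) : s → E d)) = ⊤ := by
    rw [hi.affineSpan_eq_top_iff_card_eq_finrank_add_one]
    simp [hs.2]
  let B : AffineBasis s ℝ (E d) := ⟨(↑), hi, ht⟩
  let F : E d →ᵃ[ℝ] ℝ := ∑ w : s, c w • B.coord w
  refine ⟨F 0, (InnerProductSpace.toDual ℝ (E d)).symm F.linear.toContinuousLinearMap,
    fun w hw => ?_⟩
  rw [InnerProductSpace.toDual_symm_apply]
  have h1 : F w = F.linear w + F 0 := congrFun F.decomp w
  have h2 : F w = c w := by
    have h3 : ∀ (t : Finset s) (x : E d), (∑ w ∈ t, c w • B.coord w : E d →ᵃ[ℝ] ℝ) x =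
        ∑ w ∈ t, c w * B.coord w x := by
      intro t x
      induction t using Finset.cons_induction with
      | empty => simp
      | cons i t hi ih => rw [Finset.sum_cons, Finset.sum_cons, ← ih]; rfl
    have h4 : B (⟨w, hw⟩ : s) = w := rfl
    rw [h3, ← h4, Finset.sum_eq_single (⟨w, hw⟩ : s)]
    · rw [AffineBasis.coord_apply_eq]; simp [h4]
    · intro i _ hi
      rw [AffineBasis.coord_apply_ne _ hi, mul_zero]
    · simp
  rw [← h2, h1]
  simp [add_comm]

/-- Affine functions which agree at the points of a set agree on its convex hull. -/
lemma eqOn_convexHull_of_affine {t : Set (E d)} {a a' : ℝ} {b b' : E d}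
    (h : ∀ w ∈ t, a + inner ℝ b w = a' + inner ℝ b' w) :
    ∀ x ∈ convexHull ℝ t, a + inner ℝ b x = a' + inner ℝ b' x := by
  have hconv : Convex ℝ {x : E d | a + inner ℝ b x = a' + inner ℝ b' x} := by
    intro x hx y hy α β _ _ hαβ
    simp only [Set.mem_ofPred_eq] at hx hy ⊢
    simp only [inner_add_right, real_inner_smul_right]
    have e1 : a = (α + β) * a := by rw [hαβ, one_mul]
    have e2 : a' = (α + β) * a' := by rw [hαβ, one_mul]
    rw [e1, e2]
    linear_combination α * hx + β * hy
  exact convexHull_min h hconv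

/-- The continuous piecewise affine function with given values at the vertices of the mesh, extended
by zero outside the mesh. -/
lemma exists_nodal_interpolant (c : E d → ℝ) :
    ∃ u : E d → ℝ, (∀ s ∈ cells K, ∃ (a : ℝ) (b : E d),
        ∀ x ∈ convexHull ℝ (s : Set (E d)), u x = a + inner ℝ b x) ∧
      (∀ s ∈ cells K, ∀ w ∈ s, u w = c w) ∧
      ∀ x, u x ≠ 0 → ∃ s ∈ cells K, x ∈ convexHull ℝ (s : Set (E d)) ∧ ∃ w ∈ s, c w ≠ 0 := by
  classical
  have hex : ∀ s : Finset (E d), ∃ (a : ℝ) (b : E d), s ∈ cells K →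
      ∀ w ∈ s, a + inner ℝ b w = c w := fun s => by
    by_cases hs : s ∈ cells K
    · obtain ⟨a, b, h⟩ := exists_affine_interpolant hs c
      exact ⟨a, b, fun _ => h⟩
    · exact ⟨0, 0, fun h => absurd h hs⟩
  choose a b hab using hex
  let u : E d → ℝ := fun x =>
    if h : ∃ s ∈ cells K, x ∈ convexHull ℝ (s : Set (E d)) then
      a h.choose + inner ℝ (b h.choose) x else 0
  have hu : ∀ s ∈ cells K, ∀ x ∈ convexHull ℝ (s : Set (E d)), u x = a s + inner ℝ (b s) x := by
    intro s hs x hx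
    have h : ∃ s ∈ cells K, x ∈ convexHull ℝ (s : Set (E d)) := ⟨s, hs, hx⟩
    have e : u x = a h.choose + inner ℝ (b h.choose) x := dif_pos h
    rw [e]
    -- both affine functions have the nodal values at the common vertices
    refine eqOn_convexHull_of_affine (t := ((h.choose : Set (E d)) ∩ s)) (fun w hw => ?_) x
      (K.inter_subset_convexHull h.choose_spec.1.1 hs.1 ⟨h.choose_spec.2, hx⟩)
    rw [hab _ h.choose_spec.1 w hw.1, hab s hs w hw.2]
  refine ⟨u, fun s hs => ⟨a s, b s, hu s hs⟩, fun s hs w hw => ?_, fun x hx => ?_⟩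
  · rw [hu s hs w (subset_convexHull ℝ _ hw), hab s hs w hw]
  · have h : ∃ s ∈ cells K, x ∈ convexHull ℝ (s : Set (E d)) := by
      by_contra h
      exact hx (dif_neg h)
    obtain ⟨s, hs, hxs⟩ := h
    refine ⟨s, hs, hxs, ?_⟩
    by_contra! hw
    refine hx ?_
    rw [hu s hs x hxs]
    have := eqOn_convexHull_of_affine (a' := 0) (b' := 0) (t := (s : Set (E d)))
      (fun w hws => by rw [hab s hs w hws, hw w hws]; simp) x hxs
    simpa using this

/-- Every point of an open set covered by the mesh lies in a simplex of full dimension, because the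
other simplices form a null set. -/
lemma exists_mem_cell (hfin : K.faces.Finite) (hD : IsOpen D) (hcov : D ⊆ K.space) {x : E d}
    (hx : x ∈ D) : ∃ s ∈ cells K, x ∈ convexHull ℝ (s : Set (E d)) := by
  have hcf : (cells K).Finite := hfin.subset fun s hs => hs.1
  have hcl : IsClosed (⋃ s ∈ cells K, convexHull ℝ (s : Set (E d))) :=
    hcf.isClosed_biUnion fun s _ => (s.finite_toSet.isCompact_convexHull ℝ).isClosed
  have hnull : volume (⋃ s ∈ K.faces \ cells K, convexHull ℝ (s : Set (E d))) = 0 := by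
    rw [measure_biUnion_null_iff (hfin.subset Set.sdiff_subset).countable]
    intro s hs
    refine measure_mono_null (convexHull_subset_affineSpan _) (Measure.addHaar_affineSubspace _ _ ?_)
    intro ht
    refine hs.2 ⟨hs.1, ?_⟩
    have := (K.indep hs.1).affineSpan_eq_top_iff_card_eq_finrank_add_one.1 (by simpa using ht)
    simpa using this
  have hempty : D \ (⋃ s ∈ cells K, convexHull ℝ (s : Set (E d))) = ∅ := by
    rw [← (hD.sdiff hcl).measure_eq_zero_iff (μ := volume)]
    refine measure_mono_null (fun y hy => ?_) hnull
    obtain ⟨s, hs, hys⟩ := Geometry.SimplicialComplex.mem_space_iff.1 (hcov hy.1)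
    simp only [Set.mem_iUnion]
    refine ⟨s, ⟨hs, fun hc => hy.2 ?_⟩, hys⟩
    simp only [Set.mem_iUnion]
    exact ⟨s, hc, hys⟩
  by_contra! h
  have : x ∈ D \ (⋃ s ∈ cells K, convexHull ℝ (s : Set (E d))) := by
    refine ⟨hx, ?_⟩
    simpa using h
  rw [hempty] at this
  exact this

/-- On a normed space a uniform local Lipschitz condition at every point is a global one. -/
lemma lipschitzWith_of_local {F : Type*} [NormedAddCommGroup F] [NormedSpace ℝ F] {u : F → ℝ}
    {C : NNReal} (h : ∀ x, ∀ᶠ y in 𝓝 x, |u y - u x| ≤ C * dist y x) : LipschitzWith C u := by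
  have hcont : Continuous u := by
    rw [continuous_iff_continuousAt]
    intro x
    rw [ContinuousAt, tendsto_iff_dist_tendsto_zero]
    have h1 : Tendsto (fun y => (C : ℝ) * dist y x) (𝓝 x) (𝓝 0) := by
      have : Continuous fun y => (C : ℝ) * dist y x := by fun_prop
      simpa using this.tendsto x
    refine squeeze_zero' (Eventually.of_forall fun _ => dist_nonneg) ?_ h1
    simpa [Real.dist_eq] using h x
  refine LipschitzWith.of_dist_le_mul fun y x => ?_
  -- continuous induction along the segment from `x` to `y`
  set γ : ℝ → F := fun t => x + t • (y - x) with hγ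
  have hγd : ∀ t t', dist (γ t) (γ t') = |t - t'| * dist y x := fun t t' => by
    simp only [hγ, dist_eq_norm]
    rw [add_sub_add_left_eq_sub, ← sub_smul, norm_smul, Real.norm_eq_abs]
  have hγc : Continuous γ := by fun_prop
  set s : Set ℝ := {t | |u (γ t) - u x| ≤ C * (t * dist y x)} with hs
  have hsub : Set.Icc (0 : ℝ) 1 ⊆ s := by
    refine IsClosed.Icc_subset_of_forall_exists_gt ?_ (by simp [hs, hγ]) fun t ht t' ht' => ?_
    · refine IsClosed.inter (isClosed_le ?_ (by fun_prop)) isClosed_Icc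
      exact ((hcont.comp hγc).sub continuous_const).abs
    · have h1 : ∀ᶠ r in 𝓝[>] t, |u (γ r) - u (γ t)| ≤ C * dist (γ r) (γ t) :=
        (hγc.continuousAt.eventually (h (γ t))).filter_mono nhdsWithin_le_nhds
      obtain ⟨r, hr, hrt⟩ := (h1.and (Ioc_mem_nhdsGT ht')).exists
      refine ⟨r, ?_, hrt⟩
      rw [hγd, abs_of_pos (sub_pos.2 hrt.1)] at hr
      have h2 : |u (γ t) - u x| ≤ C * (t * dist y x) := ht.1
      have h3 := abs_sub_le (u (γ r)) (u (γ t)) (u x)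
      change |u (γ r) - u x| ≤ C * (r * dist y x)
      calc |u (γ r) - u x| ≤ C * ((r - t) * dist y x) + C * (t * dist y x) := by linarith
        _ = _ := by ring
  have h1 : |u (γ 1) - u x| ≤ C * (1 * dist y x) := hsub ⟨zero_le_one, le_rfl⟩
  have h2 : γ 1 = y := by simp [hγ]
  rwa [h2, one_mul, ← Real.dist_eq] at h1

/-- Nodal values which vanish at all simplices that are not contained in a compact subset of the
domain define an element of the finite element space. -/
lemma exists_feFunction (T : NestedMeshes D) (l : ℕ) (hD : IsOpen D) (hDb : Bornology.IsBounded D)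
    {B : Set (E d)} (hB : IsCompact B) (hBD : B ⊆ D) {c : E d → ℝ}
    (hc : ∀ s ∈ cells (T.mesh l), (∃ w ∈ s, c w ≠ 0) → convexHull ℝ (s : Set (E d)) ⊆ B) :
    ∃ (v : feSpace T l) (u : E d → ℝ), Continuous u ∧ fn v.1 =ᵐ[volume.restrict D] u ∧
      ∀ s ∈ cells (T.mesh l), ∀ w ∈ s, u w = c w := by
  obtain ⟨u, h1, h2, h3⟩ := exists_nodal_interpolant (K := T.mesh l) c
  have hcov : D ⊆ (T.mesh l).space := by rw [T.covers l]; exact subset_closure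
  have hcf : (cells (T.mesh l)).Finite := (T.finite l).subset fun s hs => hs.1
  have hcl : ∀ s : Finset (E d), IsClosed (convexHull ℝ (s : Set (E d))) := fun s =>
    (s.finite_toSet.isCompact_convexHull ℝ).isClosed
  have hsuppB : Function.support u ⊆ B := fun x hx => by
    obtain ⟨s, hs, hxs, hw⟩ := h3 x hx
    exact hc s hs hw hxs
  have hts : tsupport u ⊆ B := closure_minimal hsuppB hB.isClosed
  have hcs : HasCompactSupport u := hB.of_isClosed_subset (isClosed_tsupport u) hts
  have h1' : ∀ s : Finset (E d), ∃ (a : ℝ) (b : E d), s ∈ cells (T.mesh l) →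
      ∀ x ∈ convexHull ℝ (s : Set (E d)), u x = a + inner ℝ b x := fun s => by
    by_cases hs : s ∈ cells (T.mesh l)
    · obtain ⟨a, b, h⟩ := h1 s hs
      exact ⟨a, b, fun _ => h⟩
    · exact ⟨0, 0, fun h => absurd h hs⟩
  choose a b hab using h1'
  obtain ⟨C, hC⟩ : ∃ C : NNReal, ∀ s ∈ cells (T.mesh l), ‖b s‖ ≤ C := by
    obtain ⟨C, hC⟩ := (hcf.image fun s => ‖b s‖₊).bddAbove
    exact ⟨C, fun s hs => by exact_mod_cast hC ⟨s, hs, rfl⟩⟩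
  have hlip : LipschitzWith C u := by
    refine lipschitzWith_of_local fun x => ?_
    by_cases hx : x ∈ D
    · -- near `x` there are only simplices that contain `x`
      have hclosed : IsClosed (⋃ s ∈ {s ∈ cells (T.mesh l) | x ∉ convexHull ℝ (s : Set (E d))},
          convexHull ℝ (s : Set (E d))) :=
        (hcf.subset fun s hs => hs.1).isClosed_biUnion fun s _ => hcl s
      have hxn : x ∉ ⋃ s ∈ {s ∈ cells (T.mesh l) | x ∉ convexHull ℝ (s : Set (E d))},
          convexHull ℝ (s : Set (E d)) := by
        simp only [Set.mem_iUnion, not_exists]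
        exact fun s hs hxs => hs.2 hxs
      filter_upwards [hD.mem_nhds hx, hclosed.isOpen_compl.mem_nhds hxn] with y hy hyn
      obtain ⟨s, hs, hys⟩ := exists_mem_cell (T.finite l) hD hcov hy
      have hxs : x ∈ convexHull ℝ (s : Set (E d)) := by
        by_contra hxs
        refine hyn ?_
        simp only [Set.mem_iUnion]
        exact ⟨s, ⟨hs, hxs⟩, hys⟩
      rw [hab s hs y hys, hab s hs x hxs, add_sub_add_left_eq_sub, ← inner_sub_right, dist_eq_norm]
      exact (abs_real_inner_le_norm _ _).trans
        (mul_le_mul_of_nonneg_right (hC s hs) (norm_nonneg _))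
    · have hxt : x ∈ (tsupport u)ᶜ := fun h => hx (hBD (hts h))
      filter_upwards [(isClosed_tsupport u).isOpen_compl.mem_nhds hxt] with y hy
      rw [image_eq_zero_of_notMem_tsupport hy, image_eq_zero_of_notMem_tsupport hxt]
      simp only [sub_zero, abs_zero]
      positivity
  have hfr : ∀ᵐ x ∂(volume.restrict D), ∀ s ∈ cells (T.mesh l),
      x ∉ frontier (convexHull ℝ (s : Set (E d))) := by
    rw [ae_ball_iff hcf.countable]
    intro s _
    refine ae_restrict_of_ae ?_
    exact measure_eq_zero_iff_ae_notMem.1 ((convex_convexHull ℝ _).addHaar_frontier volume)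
  have haff : ∀ᵐ x ∂(volume.restrict D), ∃ r > 0, ∃ b : E d, ∀ y ∈ Metric.ball x r,
      u y = u x + inner ℝ b (y - x) := by
    filter_upwards [hfr, ae_restrict_mem hD.measurableSet] with x hx hxD
    obtain ⟨s, hs, hxs⟩ := exists_mem_cell (T.finite l) hD hcov hxD
    have hxi : x ∈ interior (convexHull ℝ (s : Set (E d))) := by
      by_contra hxi
      exact hx s hs ⟨subset_closure hxs, hxi⟩
    obtain ⟨r, hr, hball⟩ := Metric.mem_nhds_iff.1 (mem_interior_iff_mem_nhds.1 hxi)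
    refine ⟨r, hr, b s, fun y hy => ?_⟩
    rw [hab s hs y (hball hy), hab s hs x hxs, inner_sub_right]
    ring
  obtain ⟨v, hv⟩ := exists_fn_ae_eq_of_lipschitz hD hDb hlip hcs (hts.trans hBD) haff
  refine ⟨⟨v, fun s hs => ⟨a s, b s, ?_⟩⟩, u, hlip.continuous, hv, h2⟩
  filter_upwards [hv] with x hx hxs
  rw [hx, hab s hs x hxs]

end Interpolation

/-! ### The dimension of the finite element spaces -/

section Dimension

variable {d : ℕ} {D : Set (E d)}

/-- An element of `H¹₀(D)` with vanishing function has vanishing weak gradient; elements of `H¹₀(D)`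
are pairs, so this is not automatic. -/
lemma eq_zero_of_fn_ae_eq_zero (hD : IsOpen D) {v : V D} (hv : fn v =ᵐ[volume.restrict D] 0) :
    v = 0 := by
  have h1 : v.1.fst = 0 := by
    refine Lp.ext ?_
    filter_upwards [hv, Lp.coeFn_zero ℝ 2 (volume.restrict D)] with x hx h0
    rw [h0]; exact hx
  -- integration by parts against a test function, for all elements of the closure
  have hparts : ∀ (g : E d → ℝ), IsTestFunction D g → ∀ e : E d,
      ∀ (m1 : MemLp (fun x => fderiv ℝ g x e) 2 (volume.restrict D))
        (m2 : MemLp (fun x => g x • e) 2 (volume.restrict D)),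
      inner ℝ (m1.toLp _) v.1.fst + inner ℝ (m2.toLp _) v.1.snd = 0 := by
    intro g hg e m1 m2
    have hcl : IsClosed {p : WithLp 2 (L2 D × L2Vec D) |
        inner ℝ (m1.toLp _) p.fst + inner ℝ (m2.toLp _) p.snd = 0} :=
      isClosed_eq ((continuous_const.inner (WithLp.prod_continuous_ofLp 2 _ _).fst).add
        (continuous_const.inner (WithLp.prod_continuous_ofLp 2 _ _).snd)) continuous_const
    refine closure_minimal (fun p hp => ?_) hcl v.2
    obtain ⟨φ, hφ, e1, e2⟩ := exists_testFunction_of_mem_span hp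
    change inner ℝ (m1.toLp _) p.fst + inner ℝ (m2.toLp _) p.snd = 0
    rw [L2.inner_def, L2.inner_def]
    have i1 : ∫ x, inner ℝ (m1.toLp _ x) (p.fst x) ∂(volume.restrict D) =
        ∫ x, φ x * fderiv ℝ g x e := by
      refine Eq.trans (integral_congr_ae (g := fun x => φ x * fderiv ℝ g x e) ?_)
        (setIntegral_eq_integral_of_forall_compl_eq_zero fun x hx => ?_)
      · filter_upwards [m1.coeFn_toLp, e1] with x a b
        rw [a, b]; rfl
      · rw [image_eq_zero_of_notMem_tsupport fun h => hx (hφ.2.2 h), zero_mul]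
    have i2 : ∫ x, inner ℝ (m2.toLp _ x) (p.snd x) ∂(volume.restrict D) =
        ∫ x, fderiv ℝ φ x e * g x := by
      refine Eq.trans (integral_congr_ae (g := fun x => fderiv ℝ φ x e * g x) ?_)
        (setIntegral_eq_integral_of_forall_compl_eq_zero fun x hx => ?_)
      · filter_upwards [m2.coeFn_toLp, e2] with x a b
        rw [a, b, real_inner_smul_left, real_inner_comm]
        unfold gradient
        rw [InnerProductSpace.toDual_symm_apply, mul_comm]
      · rw [image_eq_zero_of_notMem_tsupport fun h => hx (hg.2.2 h), mul_zero]
    have cφ := hφ.1.continuous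
    have cg := hg.1.continuous
    have cφ' : Continuous fun x => fderiv ℝ φ x e :=
      (hφ.1.continuous_fderiv (by norm_num)).clm_apply continuous_const
    have cg' : Continuous fun x => fderiv ℝ g x e :=
      (hg.1.continuous_fderiv (by norm_num)).clm_apply continuous_const
    rw [i1, i2, integral_mul_fderiv_eq_neg_fderiv_mul_of_integrable]
    · ring
    · exact (cφ'.mul cg).integrable_of_hasCompactSupport hg.2.1.mul_left
    · exact (cφ.mul cg').integrable_of_hasCompactSupport hφ.2.1.mul_right
    · exact (cφ.mul cg).integrable_of_hasCompactSupport hg.2.1.mul_left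
    · exact fun x _ => hφ.differentiable x
    · exact fun x _ => hg.differentiable x
  have h2 : v.1.snd = 0 := by
    have hloc : LocallyIntegrable (fun x => (v.1.snd : E d → E d) x) (volume.restrict D) :=
      (Lp.memLp v.1.snd).locallyIntegrable (by norm_num)
    have h3 := hD.ae_eq_zero_of_integral_contDiff_smul_eq_zero (μ := volume)
      (locallyIntegrableOn_of_locallyIntegrable_restrict hloc) fun g hg1 hg2 hg3 => ?_
    · refine Lp.ext ?_
      filter_upwards [(ae_restrict_iff' hD.measurableSet).2 h3,
        Lp.coeFn_zero (E d) 2 (volume.restrict D)] with x hx h0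
      rw [hx, h0]; rfl
    · rw [← setIntegral_eq_integral_of_forall_compl_eq_zero (s := D) fun x hx => by
        rw [image_eq_zero_of_notMem_tsupport fun h => hx (hg3 h), zero_smul]]
      refine ext_inner_left ℝ fun e => ?_
      have hgi : Integrable (fun x => g x • (v.1.snd : E d → E d) x) (volume.restrict D) :=
        hloc.integrable_smul_left_of_hasCompactSupport hg1.continuous hg2
      have cg' : Continuous fun x => fderiv ℝ g x e :=
        (hg1.continuous_fderiv (by norm_num)).clm_apply continuous_const
      have m1 : MemLp (fun x => fderiv ℝ g x e) 2 (volume.restrict D) :=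
        cg'.memLp_of_hasCompactSupport (hg2.fderiv_apply ℝ e)
      have m2 : MemLp (fun x => g x • e) 2 (volume.restrict D) :=
        (hg1.continuous.smul continuous_const).memLp_of_hasCompactSupport hg2.smul_right
      have h4 := hparts g ⟨hg1, hg2, hg3⟩ e m1 m2
      rw [h1, inner_zero_right, zero_add, L2.inner_def] at h4
      rw [← integral_inner hgi, inner_zero_right, ← h4]
      refine integral_congr_ae ?_
      filter_upwards [m2.coeFn_toLp] with x hx
      rw [hx, real_inner_smul_left, real_inner_smul_right]
  exact Subtype.ext ((WithLp.equiv 2 _).injective (Prod.ext h1 h2))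

lemma finite_cells (T : NestedMeshes D) (l : ℕ) : (cells (T.mesh l)).Finite :=
  (T.finite l).subset fun _ hs => hs.1

lemma fn_sum_smul {ι : Type*} (s : Finset ι) (c : ι → ℝ) (v : ι → V D) :
    fn (∑ i ∈ s, c i • v i) =ᵐ[volume.restrict D] fun x => ∑ i ∈ s, c i * fn (v i) x := by
  classical
  induction s using Finset.induction_on with
  | empty =>
    simp only [Finset.sum_empty]
    exact Lp.coeFn_zero ℝ 2 (volume.restrict D)
  | insert i s hi ih =>
    rw [Finset.sum_insert hi]
    filter_upwards [ih, Lp.coeFn_add (c i • v i).1.fst (∑ j ∈ s, c j • v j).1.fst,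
      Lp.coeFn_smul (c i) (v i).1.fst] with x h1 h2 h3
    have e2 : fn (c i • v i + ∑ j ∈ s, c j • v j) x =
      fn (c i • v i) x + fn (∑ j ∈ s, c j • v j) x := h2
    have e3 : fn (c i • v i) x = c i * fn (v i) x := h3
    rw [e2, e3, h1, Finset.sum_insert hi]

/-- Every simplex of a mesh is one of the `2^d` parts of a simplex of the mesh before. -/
lemma ncard_cells_le (T : NestedMeshes D) (l : ℕ) :
    (cells (T.mesh l)).ncard ≤ (cells (T.mesh 0)).ncard * 2 ^ (d * l) := by
  classical
  induction l with
  | zero => simp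
  | succ l ih =>
    have hsub : cells (T.mesh (l + 1)) ⊆ ((finite_cells T l).toFinset.biUnion fun t =>
        ((finite_cells T (l + 1)).subset (Set.sep_subset (cells (T.mesh (l + 1)))
          fun s => convexHull ℝ (s : Set (E d)) ⊆ convexHull ℝ (t : Set (E d)))).toFinset :
        Finset (Finset (E d))) := by
      intro s hs
      obtain ⟨t, ht, hst⟩ := T.nested l s hs
      simp only [Finset.coe_biUnion, Set.mem_iUnion]
      refine ⟨t, by simpa using ht, ?_⟩
      simp only [Set.Finite.coe_toFinset]
      exact ⟨hs, hst⟩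
    calc (cells (T.mesh (l + 1))).ncard ≤ _ := Set.ncard_le_ncard hsub (Finset.finite_toSet _)
      _ = _ := Set.ncard_coe_finset _
      _ ≤ (finite_cells T l).toFinset.card * 2 ^ d := by
          refine Finset.card_biUnion_le_card_mul _ _ _ fun t ht => ?_
          exact (Set.ncard_eq_toFinset_card _ _).symm.trans_le
            (T.children l t (by simpa using ht)).le
      _ = (cells (T.mesh l)).ncard * 2 ^ d := by
          rw [← Set.ncard_eq_toFinset_card _ (finite_cells T l)]
      _ ≤ (cells (T.mesh 0)).ncard * 2 ^ (d * l) * 2 ^ d := Nat.mul_le_mul_right _ ih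
      _ = _ := by rw [mul_assoc, ← pow_add, mul_add, mul_one]

/-- A finite element function is determined by its affine pieces. -/
lemma card_basis_le (T : NestedMeshes D) (hD : IsOpen D) (l n : ℕ)
    (b : Module.Basis (Fin n) ℝ (feSpace T l)) :
    n ≤ (cells (T.mesh l)).ncard * (d + 1) := by
  classical
  have := (finite_cells T l).fintype
  choose α β h using fun i (s : cells (T.mesh l)) => (b i).2 s.1 s.2
  have hli : LinearIndependent ℝ fun i (s : cells (T.mesh l)) => (α i s, β i s) := by
    rw [Fintype.linearIndependent_iff]
    intro c hc
    refine Fintype.linearIndependent_iff.1 b.linearIndependent c ?_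
    refine Subtype.ext ?_
    refine eq_zero_of_fn_ae_eq_zero hD ?_
    rw [AddSubmonoidClass.coe_finsetSum]
    have h1 : ∀ᵐ x ∂(volume.restrict D), ∀ i (s : cells (T.mesh l)),
        x ∈ convexHull ℝ (s.1 : Set (E d)) → fn (b i).1 x = α i s + inner ℝ (β i s) x :=
      ae_all_iff.2 fun i => ae_all_iff.2 fun s => h i s
    have hcov : D ⊆ (T.mesh l).space := by rw [T.covers l]; exact subset_closure
    filter_upwards [fn_sum_smul Finset.univ c fun i => (b i).1, h1,
      ae_restrict_mem hD.measurableSet] with x hx h2 hxD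
    obtain ⟨s, hs, hxs⟩ := exists_mem_cell (T.finite l) hD hcov hxD
    have hc1 : ∑ i, c i * α i ⟨s, hs⟩ = 0 := by
      have := congrArg Prod.fst (congrFun hc ⟨s, hs⟩)
      simpa [Finset.sum_apply, Prod.fst_sum] using this
    have hc2 : ∑ i, c i • β i ⟨s, hs⟩ = 0 := by
      have := congrArg Prod.snd (congrFun hc ⟨s, hs⟩)
      simpa [Finset.sum_apply, Prod.snd_sum] using this
    refine hx.trans ?_
    calc ∑ i, c i * fn (b i).1 x
        = ∑ i, (c i * α i ⟨s, hs⟩ + inner ℝ (c i • β i ⟨s, hs⟩) x) :=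
          Finset.sum_congr rfl fun i _ => by
            rw [h2 i ⟨s, hs⟩ hxs, real_inner_smul_left, mul_add]
      _ = 0 := by
          rw [Finset.sum_add_distrib, hc1, ← sum_inner, hc2, inner_zero_left, add_zero]
  have := hli.fintype_card_le_finrank
  rw [Fintype.card_fin, Module.finrank_pi_fintype] at this
  have e : Module.finrank ℝ (ℝ × E d) = d + 1 := by
    rw [Module.finrank_prod, Module.finrank_self, finrank_euclideanSpace, Fintype.card_fin, add_comm]
  rw [Finset.sum_const, e, smul_eq_mul, Finset.card_univ] at this
  rwa [← Nat.card_coe_set_eq, Nat.card_eq_fintype_card]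

lemma dist_le_of_diam_convexHull_le {s : Finset (E d)} {h : ℝ}
    (hh : Metric.diam (convexHull ℝ (s : Set (E d))) ≤ h) {x w : E d}
    (hx : x ∈ convexHull ℝ (s : Set (E d))) (hw : w ∈ s) : dist x w ≤ h :=
  (Metric.dist_le_diam_of_mem (s.finite_toSet.isCompact_convexHull ℝ).isBounded hx
    (subset_convexHull ℝ _ hw)).trans hh

/-- There are at least as many nodal basis functions as vertices of simplices well inside the
domain, and the balls around these vertices with radius the meshwidth cover a fixed ball. -/
lemma exists_le_card_basis (T : NestedMeshes D) (hD : IsOpen D) (hDb : Bornology.IsBounded D)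
    (hDn : D.Nonempty) :
    ∃ c : ℝ, 0 < c ∧ ∃ l₀ : ℕ, ∀ l, l₀ ≤ l → ∀ (n : ℕ) (_ : Module.Basis (Fin n) ℝ (feSpace T l)),
      c * 2 ^ (d * l) ≤ n := by
  classical
  obtain ⟨x₀, hx₀⟩ := hDn
  obtain ⟨R, hR, hRD⟩ := Metric.nhds_basis_closedBall.mem_iff.1 (hD.mem_nhds hx₀)
  obtain ⟨h₀, hh₀⟩ := T.meshwidth
  set r := R / 3 with hr
  have hr0 : 0 < r := by positivity
  set H := |h₀| + 1 with hH
  have hH0 : 0 < H := by positivity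
  have hlim : Tendsto (fun l : ℕ => H / 2 ^ l) atTop (𝓝 0) := by
    have := (tendsto_pow_atTop_nhds_zero_of_lt_one (r := (1 / 2 : ℝ)) (by norm_num)
      (by norm_num)).const_mul H
    simpa [div_eq_mul_inv] using this
  obtain ⟨l₀, hl₀⟩ := eventually_atTop.1 (hlim.eventually_le_const hr0)
  refine ⟨(r / H) ^ d, by positivity, l₀, fun l hl n b => ?_⟩
  set h := H / 2 ^ l with hh
  have hhr : h ≤ r := hl₀ l hl
  have hpos : 0 < h := by positivity
  have hdiam : ∀ s ∈ cells (T.mesh l), Metric.diam (convexHull ℝ (s : Set (E d))) ≤ h :=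
    fun s hs => (hh₀ l s hs).trans (by
      rw [hh]; gcongr; rw [hH]; linarith [le_abs_self h₀])
  let W : Finset (E d) := ((finite_cells T l).toFinset.biUnion id).filter
    fun w => dist w x₀ ≤ r + h
  have hW : ∀ w, w ∈ W ↔ (∃ s ∈ cells (T.mesh l), w ∈ s) ∧ dist w x₀ ≤ r + h := fun w => by
    simp [W]
  have hv : ∀ w : W, ∃ (v : feSpace T l) (u : E d → ℝ), Continuous u ∧
      fn v.1 =ᵐ[volume.restrict D] u ∧
      ∀ s ∈ cells (T.mesh l), ∀ w' ∈ s, u w' = if w' = w then 1 else 0 := by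
    intro w
    refine exists_feFunction T l hD hDb (isCompact_closedBall x₀ R) hRD fun s hs ⟨w', hw', hne⟩ => ?_
    have e : w' = w := by
      by_contra e
      exact hne (if_neg e)
    subst e
    intro y hy
    have h1 := dist_le_of_diam_convexHull_le (hdiam s hs) hy hw'
    have h2 := ((hW w).1 w.2).2
    rw [Metric.mem_closedBall]
    have h3 := dist_triangle y w x₀
    linarith
  choose v u hu1 hu2 hu3 using hv
  have hli : LinearIndependent ℝ v := by
    rw [Fintype.linearIndependent_iff]
    intro c hc w
    have hc' : ∑ i, c i • (v i).1 = 0 := by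
      have := congrArg (Subtype.val) hc
      rwa [AddSubmonoidClass.coe_finsetSum] at this
    have h1 : (fun x => ∑ i, c i * u i x) =ᵐ[volume.restrict D] fun _ => 0 := by
      have h2 : ∀ᵐ x ∂(volume.restrict D), ∀ i, fn (v i).1 x = u i x := ae_all_iff.2 hu2
      have h3 := fn_sum_smul (D := D) Finset.univ c fun i => (v i).1
      rw [hc'] at h3
      filter_upwards [h2, h3, Lp.coeFn_zero ℝ 2 (volume.restrict D)] with x a b e
      have e' : fn (0 : V D) x = 0 := e
      rw [← e', b]
      exact Finset.sum_congr rfl fun i _ => by rw [a i]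
    have h4 := Measure.eqOn_open_of_ae_eq h1 hD
      (continuous_finsetSum _ fun i _ => continuous_const.mul (hu1 i)).continuousOn
      continuousOn_const
    obtain ⟨⟨s, hs, hws⟩, hwd⟩ := (hW w).1 w.2
    have h5 := h4 (hRD (by rw [Metric.mem_closedBall]; linarith : (w : E d) ∈ _))
    simp only at h5
    rw [Finset.sum_eq_single w] at h5
    · rw [hu3 w s hs w hws, if_pos rfl, mul_one] at h5
      exact h5
    · intro i _ hi
      rw [hu3 i s hs w hws, if_neg fun e => hi (Subtype.ext e.symm), mul_zero]
    · simp
  have hfd : Module.Finite ℝ (feSpace T l) := Module.Finite.of_basis b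
  have hcard : W.card ≤ n := by
    have := hli.fintype_card_le_finrank
    rwa [Fintype.card_coe, Module.finrank_eq_card_basis b, Fintype.card_fin] at this
  have hcover : Metric.ball x₀ r ⊆ ⋃ w ∈ W, Metric.closedBall w h := by
    intro y hy
    have hyD : y ∈ D := hRD (Metric.ball_subset_closedBall (Metric.ball_subset_ball (by linarith) hy))
    have hcov : D ⊆ (T.mesh l).space := by rw [T.covers l]; exact subset_closure
    obtain ⟨s, hs, hys⟩ := exists_mem_cell (T.finite l) hD hcov hyD
    obtain ⟨w, hw⟩ := (T.mesh l).nonempty_of_mem_faces hs.1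
    have h1 := dist_le_of_diam_convexHull_le (hdiam s hs) hys hw
    simp only [Set.mem_iUnion]
    refine ⟨w, (hW w).2 ⟨⟨s, hs, hw⟩, ?_⟩, h1⟩
    rw [Metric.mem_ball] at hy
    have h3 := dist_triangle_left w x₀ y
    linarith
  have hvol : ENNReal.ofReal (r ^ d) * volume (Metric.ball (0 : E d) 1) ≤
      W.card * ENNReal.ofReal (h ^ d) * volume (Metric.ball (0 : E d) 1) := by
    calc ENNReal.ofReal (r ^ d) * volume (Metric.ball (0 : E d) 1)
        = volume (Metric.ball x₀ r) := by
          rw [Measure.addHaar_ball_of_pos _ _ hr0, finrank_euclideanSpace, Fintype.card_fin]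
      _ ≤ volume (⋃ w ∈ W, Metric.closedBall w h) := measure_mono hcover
      _ ≤ ∑ w ∈ W, volume (Metric.closedBall w h) := measure_biUnion_finset_le _ _
      _ = _ := by
          simp_rw [Measure.addHaar_closedBall _ _ hpos.le, finrank_euclideanSpace, Fintype.card_fin]
          rw [Finset.sum_const, nsmul_eq_mul, mul_assoc]
  have hvol2 : r ^ d ≤ W.card * h ^ d := by
    rw [ENNReal.mul_le_mul_iff_left (Metric.measure_ball_pos volume _ one_pos).ne'
      measure_ball_lt_top.ne] at hvol
    have e : (W.card : ℝ≥0∞) * ENNReal.ofReal (h ^ d) = ENNReal.ofReal (W.card * h ^ d) := by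
      rw [ENNReal.ofReal_mul (by positivity), ENNReal.ofReal_natCast]
    rw [e] at hvol
    exact (ENNReal.ofReal_le_ofReal_iff (by positivity)).1 hvol
  have hh2 : h ^ d = H ^ d / 2 ^ (d * l) := by rw [hh, div_pow, ← pow_mul, mul_comm l d]
  rw [hh2, mul_div_assoc', le_div_iff₀ (by positivity)] at hvol2
  calc (r / H) ^ d * 2 ^ (d * l) = r ^ d * 2 ^ (d * l) / H ^ d := by rw [div_pow]; ring
    _ ≤ W.card := by rw [div_le_iff₀ (by positivity)]; exact hvol2
    _ ≤ n := by exact_mod_cast hcard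

variable {k : ℕ} {P : Problem d k}

lemma Discretization.exists_dim_le (X : Discretization P) (hD : IsOpen P.D) :
    ∃ C : ℝ, 0 ≤ C ∧ ∀ l, (X.dim l : ℝ) ≤ C * 2 ^ (d * l) := by
  refine ⟨(cells (X.meshes.mesh 0)).ncard * (d + 1), by positivity, fun l => ?_⟩
  have h1 := card_basis_le X.meshes hD l _ (X.basis l)
  have h2 : X.dim l ≤ (cells (X.meshes.mesh 0)).ncard * 2 ^ (d * l) * (d + 1) :=
    h1.trans (Nat.mul_le_mul_right _ (ncard_cells_le _ l))
  calc (X.dim l : ℝ) ≤ ((cells (X.meshes.mesh 0)).ncard * 2 ^ (d * l) * (d + 1) : ℕ) := by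
        exact_mod_cast h2
    _ = _ := by push_cast; ring

lemma Discretization.exists_le_dim (X : Discretization P) (hD : IsOpen P.D)
    (hDb : Bornology.IsBounded P.D) (hDn : P.D.Nonempty) :
    ∃ c : ℝ, 0 < c ∧ ∃ l₀ : ℕ, ∀ l, l₀ ≤ l → c * 2 ^ (d * l) ≤ X.dim l := by
  obtain ⟨c, hc, l₀, h⟩ := exists_le_card_basis X.meshes hD hDb hDn
  exact ⟨c, hc, l₀, fun l hl => h l hl _ (X.basis l)⟩

end Dimension

/-! ### The value and the number of unknowns of a run of the algorithm -/

namespace Counted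

variable {α β ι : Type}

@[simp] lemma val_bind (x : Counted α) (f : α → Counted β) : (x >>= f).val = (f x.val).val := rfl

@[simp] lemma flops_bind (x : Counted α) (f : α → Counted β) :
    (x >>= f).flops = x.flops + (f x.val).flops := rfl

@[simp] lemma dofs_bind (x : Counted α) (f : α → Counted β) :
    (x >>= f).dofs = x.dofs + (f x.val).dofs := rfl

@[simp] lemma val_pure (x : α) : (pure x : Counted α).val = x := rfl

@[simp] lemma flops_pure (x : α) : (pure x : Counted α).flops = 0 := rfl

@[simp] lemma dofs_pure (x : α) : (pure x : Counted α).dofs = 0 := rfl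

@[simp] lemma val_flop (x : α) : (flop x).val = x := rfl

@[simp] lemma flops_flop (x : α) : (flop x).flops = 1 := rfl

@[simp] lemma dofs_flop (x : α) : (flop x).dofs = 0 := rfl

@[simp] lemma val_sum (s : Finset ι) (g : ι → Counted ℝ) :
    (sum s g).val = ∑ i ∈ s, (g i).val := rfl

@[simp] lemma flops_sum (s : Finset ι) (g : ι → Counted ℝ) :
    (sum s g).flops = ∑ i ∈ s, ((g i).flops + 1) := rfl

@[simp] lemma dofs_sum (s : Finset ι) (g : ι → Counted ℝ) :
    (sum s g).dofs = ∑ i ∈ s, (g i).dofs := rfl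

open Classical in
@[simp] lemma val_table (s : Finset ι) (g : ι → Counted ℝ) :
    (table s g).val = fun i => if i ∈ s then (g i).val else 0 := rfl

@[simp] lemma flops_table (s : Finset ι) (g : ι → Counted ℝ) :
    (table s g).flops = ∑ i ∈ s, (g i).flops := rfl

@[simp] lemma dofs_table (s : Finset ι) (g : ι → Counted ℝ) :
    (table s g).dofs = ∑ i ∈ s, (g i).dofs := rfl

end Counted

section Assembly

variable {d k : ℕ} {P : Problem d k} (X : Discretization P)

/-- The stiffness matrix is affine in the parameters. -/
lemma Discretization.stiffness_eq (J l : ℕ) (u : Param) (i j : Fin (X.dim l)) :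
    X.stiffness J l u i j = X.formMatrix l P.Kbar i j +
      ∑ m ∈ Finset.range J, (u m : ℝ) * X.formMatrix l (P.ψ m) i j := by
  let F : LInf P.D →ₗ[ℝ] ℝ :=
    { toFun := fun a => inner ℝ ((a • (X.w l j).1.snd : L2Vec P.D)) (X.w l i).1.snd
      map_add' := fun a b => by rw [Lp.smul_add, inner_add_left]
      map_smul' := fun c a => by rw [Lp.smul_assoc, real_inner_smul_left]; rfl }
  have h : ∀ a : LInf P.D, X.formMatrix l a i j = F a := fun a => integral_form_eq a _ _
  unfold Discretization.stiffness Problem.coeffTrunc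
  simp only [h, map_add, map_sum, map_smul, smul_eq_mul]

end Assembly

namespace Solver

variable {d k : ℕ} {P : Problem d k} {X : Discretization P} (S : Solver X) (q : ℝ)

lemma val_assemble (l : ℕ) (u : Param) :
    (assemble (X := X) q l u).val = fun p => X.stiffness (truncLevel q l) l u p.1 p.2 := by
  funext p
  simp only [assemble, Counted.val_table, Counted.val_bind, Counted.val_sum, Counted.val_flop]
  split_ifs with hp
  · rw [X.stiffness_eq]
  · simp only [pattern, Finset.mem_filter, Finset.mem_univ, true_and, not_exists, not_not] at hp
    exact (hp u).symm

lemma val_forward (l : ℕ) (u : Param) : (S.forward q l u).val = S.coeffs q l u := by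
  simp only [forward, Counted.val_bind, val_assemble]
  rfl

lemma val_applyFunctional (l : ℕ) (F : V P.D →L[ℝ] ℝ) (x : Fin (X.dim l) → ℝ) :
    (applyFunctional l F x).val = F (∑ i, x i • X.w l i) := by
  simp [applyFunctional, map_sum]

lemma val_runPotential (l : ℕ) (u : Param) :
    (S.runPotential q l u).val = P.potential (S.levels q l) u := by
  simp [runPotential, val_forward, val_applyFunctional, Problem.potential, levels, dotProduct,
    Matrix.mulVec]

lemma val_runQoi (l : ℕ) (u : Param) : (S.runQoi q l u).val = P.qoi (S.levels q l u) := by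
  simp only [runQoi, Counted.val_bind, val_forward, val_applyFunctional]
  rfl

lemma val_runWeight (l : ℕ) (u : Param) :
    (S.runWeight q l u).val = P.weight (S.levels q) l u := by
  cases l with
  | zero => rfl
  | succ l => simp [runWeight, val_runPotential, Problem.weight]

lemma val_runIncrement (l : ℕ) (u : Param) :
    (S.runIncrement q l u).val = P.increment (S.levels q) l u := by
  cases l with
  | zero => exact S.val_runQoi q 0 u
  | succ l => simp [runIncrement, val_runQoi, Problem.increment]

lemma val_runChain (l : ℕ) (ω : Noise) (g : Param → Counted ℝ) (n : ℕ) :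
    (S.runChain q l ω g n).val = (chain (P.potential (S.levels q l)) ω n,
      P.potential (S.levels q l) (chain (P.potential (S.levels q l)) ω n),
      ∑ m ∈ Finset.range n, (g (chain (P.potential (S.levels q l)) ω (m + 1))).val) := by
  induction n with
  | zero => simp [runChain, chain, val_runPotential]
  | succ n ih =>
    -- one step of the recursion, read off from the definition of the monad
    have hstep : ∀ (z : Param × ℝ × ℝ) (p : ℝ) (_ : (S.runChain q l ω g n).val = z)
        (_ : (S.runPotential q l (ω.2 n).1).val = p), (S.runChain q l ω g (n + 1)).val =
          ((if ((ω.2 n).2 : ℝ) ≤ min 1 (Real.exp (z.2.1 - p)) then ((ω.2 n).1, p)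
              else (z.1, z.2.1)).1,
            (if ((ω.2 n).2 : ℝ) ≤ min 1 (Real.exp (z.2.1 - p)) then ((ω.2 n).1, p)
              else (z.1, z.2.1)).2,
            z.2.2 + (g (if ((ω.2 n).2 : ℝ) ≤ min 1 (Real.exp (z.2.1 - p)) then ((ω.2 n).1, p)
              else (z.1, z.2.1)).1).val) := by
      rintro _ _ rfl rfl
      rfl
    rw [hstep _ _ ih (S.val_runPotential q l _), Finset.sum_range_succ, chain]
    split_ifs with h
    · rfl
    · rfl

lemma val_runAverage (l : ℕ) (ω : Noise) (M : ℕ) (g : Param → Counted ℝ) :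
    (S.runAverage q l ω M g).val =
      sampleAverage (P.potential (S.levels q l)) ω M fun u => (g u).val := by
  simp [runAverage, val_runChain, sampleAverage]

/-- The algorithm returns the estimator built on the computed solutions. -/
lemma val_run (L : ℕ) (ω : ℕ → Noise) :
    (S.run q L ω).val = P.estimator (S.levels q) L ω := by
  unfold run Problem.estimator
  simp only [Counted.val_sum]
  refine Finset.sum_congr rfl fun l _ => Finset.sum_congr rfl fun l' _ => ?_
  cases l with
  | zero =>
    simp [runTerm, val_runAverage, val_runIncrement, Problem.weight, Problem.coarserAverage]
  | succ l =>
    simp [runTerm, val_runAverage, val_runIncrement, val_runWeight, Problem.coarserAverage]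

@[simp] lemma dofs_forward (l : ℕ) (u : Param) : (S.forward q l u).dofs = X.dim l := by
  simp [forward, assemble]

@[simp] lemma dofs_applyFunctional (l : ℕ) (F : V P.D →L[ℝ] ℝ) (x : Fin (X.dim l) → ℝ) :
    (applyFunctional l F x).dofs = 0 := by
  simp [applyFunctional]

@[simp] lemma dofs_runPotential (l : ℕ) (u : Param) : (S.runPotential q l u).dofs = X.dim l := by
  simp [runPotential]

@[simp] lemma dofs_runQoi (l : ℕ) (u : Param) : (S.runQoi q l u).dofs = X.dim l := by
  simp [runQoi]

end Solver

namespace Discretization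

variable {d k : ℕ} {P : Problem d k} (X : Discretization P)

/-- The number of unknowns for an evaluation of the increment on level `l`. -/
def incrementDofs : ℕ → ℕ
  | 0 => X.dim 0
  | l + 1 => X.dim (l + 1) + X.dim l

/-- The number of unknowns for a sample average over `M` steps on level `l`, when an evaluation of
the integrand takes `g` unknowns. -/
def averageDofs (l M g : ℕ) : ℕ := (M + 1) * X.dim l + M * g

/-- The number of unknowns for the term with indices `l`, `l'` when the sample size is `M`. -/
def termDofs (M l' : ℕ) : ℕ → ℕ
  | 0 => X.averageDofs 0 M (X.incrementDofs l')
  | l + 1 => X.averageDofs (l + 1) M (X.dim (l + 1) + X.dim l + X.incrementDofs l') +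
      X.averageDofs (l + 1) M (X.dim (l + 1) + X.dim l) + X.averageDofs l M (X.incrementDofs l')

/-- The number of degrees of freedom of the multilevel algorithm. -/
def dofs (L : ℕ) : ℕ :=
  ∑ l ∈ Finset.range (L + 1), ∑ l' ∈ Finset.range (L - l + 1), X.termDofs (sampleSize L l l') l' l

end Discretization

namespace Solver

variable {d k : ℕ} {P : Problem d k} {X : Discretization P} (S : Solver X) (q : ℝ)

@[simp] lemma dofs_runIncrement (l : ℕ) (u : Param) :
    (S.runIncrement q l u).dofs = X.incrementDofs l := by
  cases l <;> simp [runIncrement, Discretization.incrementDofs]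

lemma dofs_runAverage (l : ℕ) (ω : Noise) (M : ℕ) {g : Param → Counted ℝ} {G : ℕ}
    (hg : ∀ u, (g u).dofs = G) : (S.runAverage q l ω M g).dofs = X.averageDofs l M G := by
  have h : ∀ n, (S.runChain q l ω g n).dofs = (n + 1) * X.dim l + n * G := by
    intro n
    induction n with
    | zero => simp [runChain]
    | succ n ih => simp [runChain, ih, hg]; ring
  simp [runAverage, h, Discretization.averageDofs]

/-- The number of unknowns depends neither on the random input nor on the solver. -/
lemma dofs_run (L : ℕ) (ω : ℕ → Noise) : (S.run q L ω).dofs = X.dofs L := by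
  unfold run Discretization.dofs
  simp only [Counted.dofs_sum]
  refine Finset.sum_congr rfl fun l _ => Finset.sum_congr rfl fun l' _ => ?_
  cases l with
  | zero => exact S.dofs_runAverage q _ _ _ fun u => by simp
  | succ l =>
    simp only [runTerm, Counted.dofs_bind, Counted.dofs_flop, Discretization.termDofs]
    rw [S.dofs_runAverage q _ _ _ (G := X.dim (l + 1) + X.dim l + X.incrementDofs l'),
      S.dofs_runAverage q _ _ _ (G := X.dim (l + 1) + X.dim l),
      S.dofs_runAverage q _ _ _ (G := X.incrementDofs l')]
    · ring
    · simp
    · intro u; simp [runWeight]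
    · intro u; simp [runWeight]

end Solver

/-! ### The number of floating point operations -/

section Pattern

variable {d k : ℕ} {P : Problem d k} (X : Discretization P)

/-- Finitely many matrix positions which can be nonzero are nonzero at a common parameter: the
entries are affine along segments, so that all but finitely many points of a segment will do. -/
lemma Discretization.exists_forall_stiffness_ne_zero (J l : ℕ)
    (F : Finset (Fin (X.dim l) × Fin (X.dim l)))
    (hF : ∀ p ∈ F, ∃ u : Param, X.stiffness J l u p.1 p.2 ≠ 0) :
    ∃ u : Param, ∀ p ∈ F, X.stiffness J l u p.1 p.2 ≠ 0 := by
  classical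
  induction F using Finset.induction_on with
  | empty => exact ⟨fun _ => ⟨0, by norm_num, by norm_num⟩, by simp⟩
  | insert p F hp ih =>
    obtain ⟨u, hu⟩ := ih fun p' hp' => hF p' (Finset.mem_insert_of_mem hp')
    obtain ⟨u', hu'⟩ := hF p (Finset.mem_insert_self p F)
    have hfin : ∀ p' ∈ insert p F, {t : ℝ | (1 - t) * X.stiffness J l u p'.1 p'.2 +
        t * X.stiffness J l u' p'.1 p'.2 = 0}.Finite := by
      intro p' hp'
      refine Set.Subsingleton.finite fun t ht s hs => ?_
      simp only [Set.mem_ofPred_eq] at ht hs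
      set a := X.stiffness J l u p'.1 p'.2 with ha
      set b := X.stiffness J l u' p'.1 p'.2 with hb
      have hab : a ≠ 0 ∨ b ≠ 0 := by
        rcases Finset.mem_insert.1 hp' with rfl | h
        · exact Or.inr hu'
        · exact Or.inl (hu p' h)
      by_contra hts
      have h1 : (t - s) * (b - a) = 0 := by linear_combination ht - hs
      have h2 : b - a = 0 := (mul_eq_zero.1 h1).resolve_left (sub_ne_zero.2 hts)
      have h3 : a = 0 := by linear_combination ht - t * h2
      have h4 : b = 0 := by linear_combination h2 + h3
      exact hab.elim (fun h => h h3) fun h => h h4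
    have hinf : (Set.Icc (0 : ℝ) 1 \ ⋃ p' ∈ insert p F, {t : ℝ |
        (1 - t) * X.stiffness J l u p'.1 p'.2 + t * X.stiffness J l u' p'.1 p'.2 = 0}).Nonempty :=
      ((Set.Icc_infinite one_pos).sdiff ((insert p F).finite_toSet.biUnion hfin)).nonempty
    obtain ⟨t, ⟨ht0, ht1⟩, ht⟩ := hinf
    refine ⟨fun j => ⟨(1 - t) * u j + t * u' j, ?_, ?_⟩, fun p' hp' h0 => ht ?_⟩
    · nlinarith [(u j).2.1, (u' j).2.1]
    · nlinarith [(u j).2.2, (u' j).2.2]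
    · simp only [Set.mem_iUnion]
      refine ⟨p', hp', ?_⟩
      rw [X.stiffness_eq] at h0
      simp only [Set.mem_ofPred_eq, X.stiffness_eq]
      rw [← h0]
      simp only [add_mul, Finset.sum_add_distrib, mul_assoc, ← Finset.mul_sum]
      ring

/-- At a generic parameter the pattern of the possible nonzero entries is attained, so that it is as
sparse as a single stiffness matrix. -/
lemma Solver.exists_card_pattern_le (hFE : X.FEAssumption) (q : ℝ) :
    ∃ C : ℝ, 0 ≤ C ∧ ∀ l : ℕ, ((Solver.pattern (X := X) q l).card : ℝ) ≤
      C * (((l : ℝ) + 1) ^ (d - 1) * 2 ^ (d * l)) := by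
  obtain ⟨C, hC⟩ := hFE.sparse
  refine ⟨|C|, abs_nonneg C, fun l => ?_⟩
  obtain ⟨u, hu⟩ := X.exists_forall_stiffness_ne_zero (truncLevel q l) l
    (Solver.pattern (X := X) q l) fun p hp => by simpa [Solver.pattern] using hp
  have h1 : (Solver.pattern (X := X) q l).card ≤ nnz (X.stiffness (truncLevel q l) l u) := by
    rw [← Set.ncard_coe_finset]
    exact Set.ncard_le_ncard (fun p hp => hu p hp) (Set.toFinite _)
  calc ((Solver.pattern (X := X) q l).card : ℝ) ≤ nnz (X.stiffness (truncLevel q l) l u) := by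
        exact_mod_cast h1
    _ ≤ C * ((l : ℝ) + 1) ^ (d - 1) * 2 ^ (d * l) := hC _ (Problem.one_le_truncLevel q l) l u
    _ ≤ |C| * ((l : ℝ) + 1) ^ (d - 1) * 2 ^ (d * l) := by gcongr; exact le_abs_self C
    _ = _ := by ring

end Pattern

lemma truncLevel_le {q : ℝ} (hq : 0 < q) (l : ℕ) :
    (truncLevel q l : ℝ) ≤ 2 * (2 : ℝ) ^ ((l : ℝ) / q) := by
  unfold truncLevel
  rw [Nat.cast_pow, Nat.cast_ofNat, ← Real.rpow_natCast]
  have h1 := (Nat.ceil_lt_add_one (a := (l : ℝ) / q) (by positivity)).le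
  calc (2 : ℝ) ^ (⌈(l : ℝ) / q⌉₊ : ℝ) ≤ 2 ^ ((l : ℝ) / q + 1) :=
        Real.rpow_le_rpow_of_exponent_le (by norm_num) h1
    _ = _ := by rw [Real.rpow_add (by norm_num), Real.rpow_one, mul_comm]

/-- The order of magnitude of the cost of a forward solve on level `l`. -/
def solveCost (d : ℕ) (q : ℝ) (l : ℕ) : ℝ :=
  ((l : ℝ) + 1) ^ (d - 1) * (2 : ℝ) ^ (((d : ℝ) + 1 / q) * l)

lemma solveCost_eq (d : ℕ) (q : ℝ) (l : ℕ) :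
    solveCost d q l = ((l : ℝ) + 1) ^ (d - 1) * 2 ^ (d * l) * (2 : ℝ) ^ ((l : ℝ) / q) := by
  rw [solveCost, add_mul, Real.rpow_add (by norm_num), ← mul_assoc, one_div_mul_eq_div,
    ← Nat.cast_mul, Real.rpow_natCast]

lemma one_le_solveCost (d : ℕ) {q : ℝ} (hq : 0 < q) (l : ℕ) : 1 ≤ solveCost d q l := by
  refine one_le_mul_of_one_le_of_one_le (one_le_pow₀ ?_) (Real.one_le_rpow (by norm_num) ?_)
  · linarith [(Nat.cast_nonneg l : (0 : ℝ) ≤ l)]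
  · positivity

lemma solveCost_mono (d : ℕ) {q : ℝ} (hq : 0 < q) : Monotone (solveCost d q) := by
  intro l m hlm
  have : (l : ℝ) ≤ m := by exact_mod_cast hlm
  unfold solveCost
  gcongr
  norm_num

namespace Solver

variable {d k : ℕ} {P : Problem d k} {X : Discretization P} (S : Solver X) {q : ℝ}

lemma flops_assemble (l : ℕ) (u : Param) : (assemble (X := X) q l u).flops =
    (pattern (X := X) q l).card * (2 * truncLevel q l + 1) := by
  simp only [assemble, Counted.flops_table, Counted.flops_bind, Counted.flops_sum,
    Counted.flops_flop, Finset.sum_const, Finset.card_range, smul_eq_mul]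
  ring

lemma exists_flops_forward_le (hq : 0 < q) (hFE : X.FEAssumption) (hS : S.IsLinearScaling q) :
    ∃ C : ℝ, 0 ≤ C ∧ ∀ l u, ((S.forward q l u).flops : ℝ) ≤ C * solveCost d q l := by
  obtain ⟨C₁, hC₁, h1⟩ := exists_card_pattern_le X hFE q
  obtain ⟨C₂, h2⟩ := hFE.sparse
  obtain ⟨C₃, h3⟩ := hS.linear
  refine ⟨5 * C₁ + |C₃| * (1 + |C₂|), by positivity, fun l u => ?_⟩
  set A : ℝ := ((l : ℝ) + 1) ^ (d - 1) * 2 ^ (d * l) with hA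
  set B : ℝ := (2 : ℝ) ^ ((l : ℝ) / q) with hB
  have hA1 : 1 ≤ A := one_le_mul_of_one_le_of_one_le
    (one_le_pow₀ (by linarith [(Nat.cast_nonneg l : (0 : ℝ) ≤ l)])) (one_le_pow₀ (by norm_num))
  have hB1 : 1 ≤ B := Real.one_le_rpow (by norm_num) (by positivity)
  have e : ((S.forward q l u).flops : ℝ) = (pattern (X := X) q l).card * (2 * truncLevel q l + 1) +
      (S.flops l (X.stiffness (truncLevel q l) l u) (X.load l) : ℝ) := by
    simp only [forward, Counted.flops_bind, val_assemble, flops_assemble]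
    push_cast
    rfl
  have hs : (S.flops l (X.stiffness (truncLevel q l) l u) (X.load l) : ℝ) ≤
      |C₃| * (1 + |C₂|) * (A * B) := by
    refine (h3 l u).trans ?_
    have h4 : (nnz (X.stiffness (truncLevel q l) l u) : ℝ) ≤ |C₂| * A := by
      refine (h2 _ (Problem.one_le_truncLevel q l) l u).trans ?_
      rw [hA, ← mul_assoc]
      gcongr
      exact le_abs_self C₂
    calc C₃ * (1 + (nnz (X.stiffness (truncLevel q l) l u) : ℝ)) ≤ |C₃| * (A + |C₂| * A) := by
          gcongr
          exact le_abs_self C₃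
      _ = |C₃| * (1 + |C₂|) * (A * 1) := by ring
      _ ≤ _ := by gcongr
  rw [e, solveCost_eq]
  have hJ := truncLevel_le hq l
  calc _ ≤ (C₁ * A) * (2 * (2 * B) + B) + |C₃| * (1 + |C₂|) * (A * B) := by
        gcongr
        exact h1 l
    _ = _ := by ring

lemma flops_applyFunctional (l : ℕ) (F : V P.D →L[ℝ] ℝ) (x : Fin (X.dim l) → ℝ) :
    (applyFunctional l F x).flops = X.dim l * 2 := by
  simp [applyFunctional]

lemma flops_runPotential (l : ℕ) (u : Param) : (S.runPotential q l u).flops =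
    (S.forward q l u).flops + (k * (X.dim l * 2 + 1) + (k * (k * 2 + 2) + 1)) := by
  simp only [runPotential, Counted.flops_bind, Counted.flops_table, Counted.flops_sum,
    Counted.flops_flop, flops_applyFunctional, Finset.sum_const, Finset.card_univ, Fintype.card_fin,
    smul_eq_mul]

lemma flops_runQoi (l : ℕ) (u : Param) : (S.runQoi q l u).flops =
    (S.forward q l u).flops + X.dim l * 2 := by
  simp only [runQoi, Counted.flops_bind, flops_applyFunctional]

/-- The cost of an evaluation is that of its forward solve: the number of unknowns is `O(2^(dl))`. -/
lemma exists_flops_evaluation_le (hD : IsOpen P.D) (hq : 0 < q) (hFE : X.FEAssumption)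
    (hS : S.IsLinearScaling q) : ∃ C : ℝ, 0 ≤ C ∧ ∀ l u,
      ((S.runPotential q l u).flops : ℝ) ≤ C * solveCost d q l ∧
      ((S.runQoi q l u).flops : ℝ) ≤ C * solveCost d q l := by
  obtain ⟨C₁, hC₁, h1⟩ := S.exists_flops_forward_le hq hFE hS
  obtain ⟨C₂, hC₂, h2⟩ := X.exists_dim_le hD
  refine ⟨C₁ + (k * (C₂ * 2 + 1) + (k * (k * 2 + 2) + 1)) + C₂ * 2, by positivity,
    fun l u => ?_⟩
  have hF := one_le_solveCost d hq l
  have hdim : (X.dim l : ℝ) ≤ C₂ * solveCost d q l := by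
    refine (h2 l).trans (mul_le_mul_of_nonneg_left ?_ hC₂)
    rw [solveCost_eq]
    have hA1 : (1 : ℝ) ≤ ((l : ℝ) + 1) ^ (d - 1) :=
      one_le_pow₀ (by linarith [(Nat.cast_nonneg l : (0 : ℝ) ≤ l)])
    have hB1 : 1 ≤ (2 : ℝ) ^ ((l : ℝ) / q) := Real.one_le_rpow (by norm_num) (by positivity)
    calc (2 : ℝ) ^ (d * l) = 1 * 2 ^ (d * l) * 1 := by ring
      _ ≤ _ := by gcongr
  set F := solveCost d q l with hFdef
  constructor
  · rw [flops_runPotential]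
    push_cast
    calc _ ≤ C₁ * F + ((k : ℝ) * (C₂ * F * 2 + F) + (k * (k * 2 + 2) * F + F)) := by
          have h3 : (k : ℝ) * (k * 2 + 2) ≤ k * (k * 2 + 2) * F :=
            le_mul_of_one_le_right (by positivity) hF
          gcongr
          exact h1 l u
      _ ≤ C₁ * F + ((k : ℝ) * (C₂ * F * 2 + F) + (k * (k * 2 + 2) * F + F)) + C₂ * 2 * F :=
          le_add_of_nonneg_right (by positivity)
      _ = _ := by ring
  · rw [flops_runQoi]
    push_cast
    calc _ ≤ C₁ * F + C₂ * F * 2 := by gcongr; exact h1 l u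
      _ ≤ C₁ * F + C₂ * F * 2 + ((k : ℝ) * (C₂ * 2 + 1) + (k * (k * 2 + 2) + 1)) * F :=
          le_add_of_nonneg_right (by positivity)
      _ = _ := by ring

section Term

variable {C : ℝ}

lemma flops_runWeight_le (hC : 0 ≤ C) (hq : 0 < q)
    (h : ∀ l u, ((S.runPotential q l u).flops : ℝ) ≤ C * solveCost d q l) (l : ℕ) (u : Param) :
    ((S.runWeight q l u).flops : ℝ) ≤ (2 * C + 3) * solveCost d q l := by
  have hF := one_le_solveCost d hq l
  cases l with
  | zero => simp only [runWeight, Counted.flops_pure, Nat.cast_zero]; positivity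
  | succ l =>
    simp only [runWeight, Counted.flops_bind, Counted.flops_flop]
    push_cast
    have h1 := mul_le_mul_of_nonneg_left (solveCost_mono d hq l.le_succ) hC
    simp only [Nat.succ_eq_add_one] at h1
    linarith [h (l + 1) u, h l u]

lemma flops_runIncrement_le (hC : 0 ≤ C) (hq : 0 < q)
    (h : ∀ l u, ((S.runQoi q l u).flops : ℝ) ≤ C * solveCost d q l) (l : ℕ) (u : Param) :
    ((S.runIncrement q l u).flops : ℝ) ≤ (2 * C + 1) * solveCost d q l := by
  have hF := one_le_solveCost d hq l
  cases l with
  | zero =>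
    have h1 : 0 ≤ C * solveCost d q 0 := by positivity
    simp only [runIncrement]
    linarith [h 0 u]
  | succ l =>
    simp only [runIncrement, Counted.flops_bind, Counted.flops_flop]
    push_cast
    have h1 := mul_le_mul_of_nonneg_left (solveCost_mono d hq l.le_succ) hC
    simp only [Nat.succ_eq_add_one] at h1
    linarith [h (l + 1) u, h l u]

lemma flops_runAverage_le (hC : 0 ≤ C) (hq : 0 < q)
    (h : ∀ l u, ((S.runPotential q l u).flops : ℝ) ≤ C * solveCost d q l) (l : ℕ) (ω : Noise)
    {M : ℕ} (hM : 1 ≤ M) {g : Param → Counted ℝ} {G : ℝ} (hg : ∀ u, ((g u).flops : ℝ) ≤ G) :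
    ((S.runAverage q l ω M g).flops : ℝ) ≤ M * ((2 * C + 6) * solveCost d q l + G) := by
  have hF := one_le_solveCost d hq l
  have h1 : ∀ n : ℕ, ((S.runChain q l ω g n).flops : ℝ) ≤
      (n + 1) * (C * solveCost d q l) + n * (5 + G) := by
    intro n
    induction n with
    | zero => simpa [runChain] using h l ω.1
    | succ n ih =>
      simp only [runChain, Counted.flops_bind, Counted.flops_flop, Counted.flops_pure,
        Counted.val_flop]
      push_cast
      have h2 := h l (ω.2 n).1
      refine (add_le_add ih (add_le_add h2 (add_le_add_right (add_le_add_right (add_le_add_right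
        (add_le_add_right (add_le_add_left (hg _) _) _) _) _) _))).trans (le_of_eq ?_)
      ring
  have hM' : (1 : ℝ) ≤ M := by exact_mod_cast hM
  simp only [runAverage, Counted.flops_bind, Counted.flops_flop]
  push_cast
  have h3 : 0 ≤ C * solveCost d q l := by positivity
  nlinarith [h1 M, mul_le_mul_of_nonneg_right hM' h3,
    mul_le_mul_of_nonneg_left hF (by linarith : (0 : ℝ) ≤ M)]

lemma flops_runTerm_le (hC : 0 ≤ C) (hq : 0 < q)
    (h : ∀ l u, ((S.runPotential q l u).flops : ℝ) ≤ C * solveCost d q l ∧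
      ((S.runQoi q l u).flops : ℝ) ≤ C * solveCost d q l) (L : ℕ) (ω : ℕ → Noise) (l' l : ℕ) :
    ((S.runTerm q L ω l' l).flops : ℝ) ≤ (10 * C + 30) *
      (sampleSize L l l' * (solveCost d q l + solveCost d q l')) := by
  have hp := fun l u => (h l u).1
  have hi := S.flops_runIncrement_le hC hq (fun l u => (h l u).2) l'
  have hM : 1 ≤ sampleSize L l l' := Nat.one_le_two_pow
  have hM' : (1 : ℝ) ≤ sampleSize L l l' := by exact_mod_cast hM
  have hF' := one_le_solveCost d hq l'
  cases l with
  | zero =>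
    have hF := one_le_solveCost d hq 0
    refine (S.flops_runAverage_le hC hq hp 0 (ω 0) hM hi).trans ?_
    rw [mul_left_comm]
    refine mul_le_mul_of_nonneg_left ?_ (by positivity)
    nlinarith [mul_nonneg hC (by linarith : 0 ≤ solveCost d q 0),
      mul_nonneg hC (by linarith : 0 ≤ solveCost d q l')]
  | succ l =>
    have hF := one_le_solveCost d hq (l + 1)
    have hw := S.flops_runWeight_le hC hq hp (l + 1)
    have hmono : solveCost d q l ≤ solveCost d q (l + 1) := solveCost_mono d hq l.le_succ
    simp only [runTerm, Counted.flops_bind, Counted.flops_flop]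
    push_cast
    have a1 := S.flops_runAverage_le hC hq hp (l + 1) (ω (l + 1)) hM
      (g := fun u => do
        let A ← S.runWeight q (l + 1) u
        let B ← S.runIncrement q l' u
        Counted.flop (A * B))
      (G := (2 * C + 3) * solveCost d q (l + 1) + ((2 * C + 1) * solveCost d q l' + 1))
      (fun u => by
        simp only [Counted.flops_bind, Counted.flops_flop]
        push_cast
        linarith [hw u, hi u])
    have a2 := S.flops_runAverage_le hC hq hp (l + 1) (ω (l + 1)) hM
      (g := fun u => do
        let A ← S.runWeight q (l + 1) u
        Counted.flop (-A))
      (G := (2 * C + 3) * solveCost d q (l + 1) + 1)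
      (fun u => by
        simp only [Counted.flops_bind, Counted.flops_flop]
        push_cast
        linarith [hw u])
    have a3 := S.flops_runAverage_le hC hq hp l (ω l) hM hi
    refine (add_le_add a1 (add_le_add a2 (add_le_add_left a3 _))).trans ?_
    have b1 : 0 ≤ C * solveCost d q l' := by positivity
    have b2 : C * solveCost d q l ≤ C * solveCost d q (l + 1) := mul_le_mul_of_nonneg_left hmono hC
    set M : ℝ := ((sampleSize L (l + 1) l' : ℕ) : ℝ)
    calc _ ≤ M * ((2 * C + 6) * solveCost d q (l + 1) +
            ((2 * C + 3) * solveCost d q (l + 1) + ((2 * C + 1) * solveCost d q l' + 1))) +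
          (M * ((2 * C + 6) * solveCost d q (l + 1) + ((2 * C + 3) * solveCost d q (l + 1) + 1)) +
          (M * ((2 * C + 6) * solveCost d q l + (2 * C + 1) * solveCost d q l') + M * 2)) := by
          linarith
      _ = M * ((2 * C + 6) * solveCost d q (l + 1) +
            ((2 * C + 3) * solveCost d q (l + 1) + ((2 * C + 1) * solveCost d q l' + 1)) +
          ((2 * C + 6) * solveCost d q (l + 1) + ((2 * C + 3) * solveCost d q (l + 1) + 1)) +
          ((2 * C + 6) * solveCost d q l + (2 * C + 1) * solveCost d q l') + 2) := by ring
      _ ≤ M * ((10 * C + 30) * (solveCost d q (l + 1) + solveCost d q l')) := by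
          refine mul_le_mul_of_nonneg_left ?_ (by linarith)
          linarith
      _ = _ := by ring

end Term

end Solver

/-! ### Total cost and number of degrees of freedom -/

lemma sum_four_pow_le (n : ℕ) : ∑ i ∈ Finset.range (n + 1), (4 : ℝ) ^ (n - i) ≤ 2 * 4 ^ n := by
  induction n with
  | zero => simp
  | succ n ih =>
    rw [Finset.sum_range_succ']
    simp only [Nat.add_sub_add_right, Nat.sub_zero]
    rw [pow_succ (4 : ℝ) n]
    have : (0 : ℝ) < 4 ^ n := by positivity
    linarith

/-- For costs that grow faster than the sample sizes decay, the finest level dominates. -/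
lemma sum_four_pow_mul_pow_le {b : ℝ} (hb : 4 < b) (L : ℕ) :
    ∑ l ∈ Finset.range (L + 1), (4 : ℝ) ^ (L - l) * b ^ l ≤ b / (b - 4) * b ^ L := by
  have hb4 : 0 < b - 4 := by linarith
  induction L with
  | zero =>
    simp only [zero_add, Finset.sum_range_one, Nat.sub_self, pow_zero, mul_one]
    rw [le_div_iff₀ hb4]; linarith
  | succ L ih =>
    rw [Finset.sum_range_succ]
    have e : ∑ l ∈ Finset.range (L + 1), (4 : ℝ) ^ (L + 1 - l) * b ^ l =
        4 * ∑ l ∈ Finset.range (L + 1), (4 : ℝ) ^ (L - l) * b ^ l := by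
      rw [Finset.mul_sum]
      refine Finset.sum_congr rfl fun l hl => ?_
      rw [Nat.succ_sub (Nat.lt_succ_iff.1 (Finset.mem_range.1 hl)), pow_succ]
      ring
    rw [e]
    calc _ ≤ 4 * (b / (b - 4) * b ^ L) + 4 ^ (L + 1 - (L + 1)) * b ^ (L + 1) := by gcongr
      _ = _ := by
        rw [Nat.sub_self, pow_zero, one_mul, pow_succ]
        field_simp
        ring

/-- Costs which are symmetric in the two levels are dominated by those on the first one. -/
lemma sum_sampleSize_mul_le {F : ℕ → ℝ} (hF : ∀ l, 0 ≤ F l) (L : ℕ) :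
    ∑ l ∈ Finset.range (L + 1), ∑ l' ∈ Finset.range (L - l + 1),
        (sampleSize L l l' : ℝ) * (F l + F l') ≤
      4 * ∑ l ∈ Finset.range (L + 1), 4 ^ (L - l) * F l := by
  have h1 : ∑ l ∈ Finset.range (L + 1), ∑ l' ∈ Finset.range (L - l + 1),
      (sampleSize L l l' : ℝ) * F l' = ∑ l ∈ Finset.range (L + 1),
        ∑ l' ∈ Finset.range (L - l + 1), (sampleSize L l l' : ℝ) * F l := by
    rw [Finset.sum_comm' (t' := Finset.range (L + 1)) (s' := fun l' => Finset.range (L - l' + 1))]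
    · refine Finset.sum_congr rfl fun l _ => Finset.sum_congr rfl fun l' _ => ?_
      rw [sampleSize, sampleSize, add_comm]
    · intro l l'
      simp only [Finset.mem_range]
      omega
  simp only [mul_add, Finset.sum_add_distrib]
  rw [h1]
  have h2 : ∑ l ∈ Finset.range (L + 1), ∑ l' ∈ Finset.range (L - l + 1),
      (sampleSize L l l' : ℝ) * F l ≤ 2 * ∑ l ∈ Finset.range (L + 1), 4 ^ (L - l) * F l := by
    rw [Finset.mul_sum]
    refine Finset.sum_le_sum fun l _ => ?_
    rw [← Finset.sum_mul, ← mul_assoc]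
    refine mul_le_mul_of_nonneg_right ?_ (hF l)
    refine le_trans (le_of_eq (Finset.sum_congr rfl fun l' _ => ?_)) (sum_four_pow_le (L - l))
    rw [sampleSize_eq]
    push_cast
    rfl
  linarith

namespace Solver

variable {d k : ℕ} {P : Problem d k} {X : Discretization P} (S : Solver X) {q : ℝ}

/-- The number of operations of the algorithm, uniformly in the realization. -/
lemma exists_flops_run_le (hd : d = 2 ∨ d = 3) (hD : IsOpen P.D) (hq : 0 < q)
    (hFE : X.FEAssumption) (hS : S.IsLinearScaling q) :
    ∃ C : ℝ, 0 ≤ C ∧ ∀ L : ℕ, 1 ≤ L → ∀ ω : ℕ → Noise, ((S.run q L ω).flops : ℝ) ≤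
      C * (L : ℝ) ^ (d - 1) * (2 : ℝ) ^ (((d : ℝ) + 1 / q) * (L : ℝ)) := by
  obtain ⟨C, hC, h⟩ := S.exists_flops_evaluation_le hD hq hFE hS
  set b : ℝ := (2 : ℝ) ^ ((d : ℝ) + 1 / q) with hb
  have hb4 : 4 < b := by
    have h2 : (2 : ℝ) ≤ d := by rcases hd with rfl | rfl <;> norm_num
    have h3 : (2 : ℝ) < d + 1 / q := by have : 0 < 1 / q := by positivity
                                        linarith
    calc (4 : ℝ) = 2 ^ (2 : ℝ) := by norm_num
      _ < b := Real.rpow_lt_rpow_of_exponent_lt (by norm_num) h3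
  have hbl : ∀ l : ℕ, (2 : ℝ) ^ (((d : ℝ) + 1 / q) * l) = b ^ l := fun l => by
    rw [Real.rpow_mul (by norm_num), Real.rpow_natCast]
  have hb0 : 0 < b - 4 := by linarith
  refine ⟨(10 * C + 31) * (4 * (2 ^ (d - 1) * (b / (b - 4)))), by positivity, fun L hL ω => ?_⟩
  have hF : ∀ l, 1 ≤ solveCost d q l := one_le_solveCost d hq
  have hM : ∀ l l', (1 : ℝ) ≤ sampleSize L l l' := fun l l' => by
    exact_mod_cast (Nat.one_le_two_pow : 1 ≤ sampleSize L l l')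
  have h1 : ((S.run q L ω).flops : ℝ) ≤ (10 * C + 31) *
      ∑ l ∈ Finset.range (L + 1), ∑ l' ∈ Finset.range (L - l + 1),
        (sampleSize L l l' : ℝ) * (solveCost d q l + solveCost d q l') := by
    simp only [run, Counted.flops_sum]
    push_cast
    rw [Finset.mul_sum]
    refine Finset.sum_le_sum fun l _ => ?_
    -- the addition that adds the inner sum is charged to its first summand
    have h2 : (1 : ℝ) ≤ ∑ l' ∈ Finset.range (L - l + 1), (1 : ℝ) := by
      rw [Finset.sum_const, Finset.card_range, nsmul_eq_mul, mul_one]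
      push_cast
      linarith [(Nat.cast_nonneg (L - l) : (0 : ℝ) ≤ _)]
    calc _ ≤ ∑ l' ∈ Finset.range (L - l + 1), (((S.runTerm q L ω l' l).flops : ℝ) + 1) +
          ∑ l' ∈ Finset.range (L - l + 1), (1 : ℝ) := by gcongr
      _ = ∑ l' ∈ Finset.range (L - l + 1), (((S.runTerm q L ω l' l).flops : ℝ) + 1 + 1) :=
          Finset.sum_add_distrib.symm
      _ ≤ _ := by
          rw [Finset.mul_sum]
          refine Finset.sum_le_sum fun l' _ => ?_
          have h3 := S.flops_runTerm_le hC hq h L ω l' l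
          have h4 := one_le_mul_of_one_le_of_one_le (hM l l') (hF l)
          have h5 := one_le_mul_of_one_le_of_one_le (hM l l') (hF l')
          rw [mul_add] at h3 ⊢
          nlinarith
  refine h1.trans ?_
  rw [mul_assoc, mul_assoc]
  refine mul_le_mul_of_nonneg_left ?_ (by positivity)
  refine (sum_sampleSize_mul_le (fun l => zero_le_one.trans (hF l)) L).trans ?_
  have hL' : (1 : ℝ) ≤ L := by exact_mod_cast hL
  calc 4 * ∑ l ∈ Finset.range (L + 1), 4 ^ (L - l) * solveCost d q l
      ≤ 4 * ∑ l ∈ Finset.range (L + 1), ((2 * L : ℝ) ^ (d - 1)) * (4 ^ (L - l) * b ^ l) := by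
        refine mul_le_mul_of_nonneg_left (Finset.sum_le_sum fun l hl => ?_) (by norm_num)
        rw [solveCost, hbl]
        have h6 : (l : ℝ) ≤ L := by exact_mod_cast Nat.lt_succ_iff.1 (Finset.mem_range.1 hl)
        calc (4 : ℝ) ^ (L - l) * (((l : ℝ) + 1) ^ (d - 1) * b ^ l)
            ≤ 4 ^ (L - l) * ((2 * L : ℝ) ^ (d - 1) * b ^ l) := by gcongr; linarith
          _ = _ := by ring
    _ ≤ 4 * ((2 * L : ℝ) ^ (d - 1) * (b / (b - 4) * b ^ L)) := by
        rw [← Finset.mul_sum]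
        gcongr
        exact sum_four_pow_mul_pow_le hb4 L
    _ = _ := by rw [hbl, mul_pow]; ring

end Solver

namespace Discretization

variable {d k : ℕ} {P : Problem d k} (X : Discretization P)

lemma termDofs_le {C : ℝ} (hC : 0 ≤ C) (h : ∀ l, (X.dim l : ℝ) ≤ C * 2 ^ (d * l)) {M : ℕ}
    (hM : 1 ≤ M) (l' l : ℕ) :
    (X.termDofs M l' l : ℝ) ≤ 10 * C * (M * (2 ^ (d * l) + 2 ^ (d * l'))) := by
  have hM' : (1 : ℝ) ≤ M := by exact_mod_cast hM
  have hmono : ∀ m, (X.dim m : ℝ) ≤ C * 2 ^ (d * (m + 1)) := fun m =>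
    (h m).trans (by gcongr <;> norm_num)
  have hinc : (X.incrementDofs l' : ℝ) ≤ 2 * (C * 2 ^ (d * l')) := by
    cases l' with
    | zero => simp only [incrementDofs]; have := h 0; have : 0 ≤ C * 2 ^ (d * 0) := by positivity
              linarith
    | succ m => simp only [incrementDofs]; push_cast; linarith [h (m + 1), hmono m]
  have hav : ∀ m g, (X.averageDofs m M g : ℝ) ≤ M * (2 * X.dim m + g) := fun m g => by
    simp only [averageDofs]; push_cast
    nlinarith [mul_le_mul_of_nonneg_right hM' (Nat.cast_nonneg (α := ℝ) (X.dim m))]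
  have hF : 0 ≤ C * 2 ^ (d * l) := by positivity
  have hF' : 0 ≤ C * 2 ^ (d * l') := by positivity
  cases l with
  | zero =>
    simp only [termDofs]
    refine (hav 0 _).trans ?_
    calc (M : ℝ) * (2 * X.dim 0 + X.incrementDofs l') ≤
          M * (10 * (C * 2 ^ (d * 0) + C * 2 ^ (d * l'))) := by
          gcongr; linarith [h 0]
      _ = _ := by ring
  | succ m =>
    simp only [termDofs]
    push_cast
    have a1 := hav (m + 1) (X.dim (m + 1) + X.dim m + X.incrementDofs l')
    have a2 := hav (m + 1) (X.dim (m + 1) + X.dim m)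
    have a3 := hav m (X.incrementDofs l')
    push_cast at a1 a2
    calc _ ≤ (M : ℝ) * (2 * X.dim (m + 1) + (X.dim (m + 1) + X.dim m + X.incrementDofs l')) +
          M * (2 * X.dim (m + 1) + (X.dim (m + 1) + X.dim m)) +
          M * (2 * X.dim m + X.incrementDofs l') := by linarith
      _ = (M : ℝ) * (6 * X.dim (m + 1) + 4 * X.dim m + 2 * X.incrementDofs l') := by ring
      _ ≤ M * (10 * (C * 2 ^ (d * (m + 1)) + C * 2 ^ (d * l'))) := by
          gcongr; linarith [h (m + 1), hmono m]
      _ = _ := by ring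

lemma exists_dofs_le (hD : IsOpen P.D) : ∃ C : ℝ, 0 ≤ C ∧ ∀ L,
    (X.dofs L : ℝ) ≤ C * ∑ l ∈ Finset.range (L + 1), 4 ^ (L - l) * (2 ^ d) ^ l := by
  obtain ⟨C, hC, h⟩ := X.exists_dim_le hD
  refine ⟨10 * C * 4, by positivity, fun L => ?_⟩
  have h1 : (X.dofs L : ℝ) ≤ 10 * C * ∑ l ∈ Finset.range (L + 1),
      ∑ l' ∈ Finset.range (L - l + 1), (sampleSize L l l' : ℝ) * (2 ^ (d * l) + 2 ^ (d * l')) := by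
    simp only [dofs]
    push_cast
    rw [Finset.mul_sum]
    refine Finset.sum_le_sum fun l _ => ?_
    rw [Finset.mul_sum]
    exact Finset.sum_le_sum fun l' _ => X.termDofs_le hC h Nat.one_le_two_pow l' l
  refine h1.trans ?_
  rw [mul_assoc _ (4 : ℝ)]
  refine mul_le_mul_of_nonneg_left ?_ (by positivity)
  have := sum_sampleSize_mul_le (F := fun l => (2 : ℝ) ^ (d * l)) (fun l => by positivity) L
  simpa only [pow_mul] using this

lemma exists_dofs_le_two (hd : d = 2) (hD : IsOpen P.D) :
    ∃ C : ℝ, 0 < C ∧ ∀ L : ℕ, 1 ≤ L → (X.dofs L : ℝ) ≤ C * L * 2 ^ (2 * L) := by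
  obtain ⟨C, hC, h⟩ := X.exists_dofs_le hD
  refine ⟨2 * C + 1, by positivity, fun L hL => (h L).trans ?_⟩
  have hL' : (1 : ℝ) ≤ L := by exact_mod_cast hL
  have e : ∑ l ∈ Finset.range (L + 1), (4 : ℝ) ^ (L - l) * (2 ^ d) ^ l =
      (L + 1) * 2 ^ (2 * L) := by
    rw [Finset.sum_congr rfl (g := fun _ => (2 : ℝ) ^ (2 * L))]
    · simp
    · intro l hl
      rw [hd, show ((2 : ℝ) ^ 2) = 4 by norm_num, ← pow_add,
        Nat.sub_add_cancel (Nat.lt_succ_iff.1 (Finset.mem_range.1 hl)), pow_mul]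
      norm_num
  rw [e, ← mul_assoc]
  refine mul_le_mul_of_nonneg_right ?_ (by positivity)
  nlinarith

lemma exists_dofs_le_three (hd : d = 3) (hD : IsOpen P.D) :
    ∃ C : ℝ, 0 < C ∧ ∀ L : ℕ, (X.dofs L : ℝ) ≤ C * 2 ^ (3 * L) := by
  obtain ⟨C, hC, h⟩ := X.exists_dofs_le hD
  refine ⟨2 * C + 1, by positivity, fun L => (h L).trans ?_⟩
  have e := sum_four_pow_mul_pow_le (b := 8) (by norm_num) L
  rw [hd, pow_mul, show ((2 : ℝ) ^ 3) = 8 by norm_num]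
  have h8 : (0 : ℝ) < 8 ^ L := by positivity
  calc _ ≤ C * (8 / (8 - 4) * 8 ^ L) := by gcongr
    _ = 2 * C * 8 ^ L := by ring
    _ ≤ _ := by gcongr; linarith

/-- The terms with `l' = 0` alone contribute this number of unknowns. -/
lemma sum_sampleSize_mul_dim_le_dofs (L : ℕ) :
    ∑ l ∈ Finset.range (L + 1), 4 ^ (L - l) * X.dim l ≤ X.dofs L := by
  unfold dofs
  refine Finset.sum_le_sum fun l _ => ?_
  refine le_trans ?_ (Finset.single_le_sum (f := fun l' => X.termDofs (sampleSize L l l') l' l)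
    (fun _ _ => Nat.zero_le _) (Finset.mem_range.2 (Nat.succ_pos _) : 0 ∈ _))
  simp only [sampleSize_eq, Nat.sub_zero]
  have : ∀ M g, M * X.dim l ≤ X.averageDofs l M g := fun M g => by
    unfold averageDofs; nlinarith
  cases l with
  | zero => exact this _ _
  | succ l => exact (this _ (X.dim (l + 1) + X.dim l)).trans (by simp only [termDofs]; omega)

/-- In dimension two all levels contribute equally, which gives the factor `L`. -/
lemma exists_le_dofs_two (hd : d = 2) (hD : IsOpen P.D) (hDb : Bornology.IsBounded P.D)
    (hDn : P.D.Nonempty) :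
    ∃ c : ℝ, 0 < c ∧ ∀ᶠ L : ℕ in atTop, c * L * 2 ^ (2 * L) ≤ (X.dofs L : ℝ) := by
  subst hd
  obtain ⟨c, hc, l₀, h⟩ := X.exists_le_dim hD hDb hDn
  refine ⟨c / 2, by positivity, ?_⟩
  filter_upwards [eventually_ge_atTop (2 * l₀)] with L hL
  have h1 : (∑ l ∈ Finset.range (L + 1), 4 ^ (L - l) * (X.dim l : ℝ)) ≤ X.dofs L := by
    exact_mod_cast X.sum_sampleSize_mul_dim_le_dofs L
  refine le_trans ?_ h1
  calc c / 2 * L * 2 ^ (2 * L) ≤ ∑ l ∈ Finset.Icc l₀ L, c * (2 : ℝ) ^ (2 * L) := by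
        rw [Finset.sum_const, Nat.card_Icc, nsmul_eq_mul]
        have h2 : (L : ℝ) / 2 ≤ (L + 1 - l₀ : ℕ) := by
          rw [Nat.cast_sub (by omega)]
          have : (2 * l₀ : ℝ) ≤ L := by exact_mod_cast hL
          push_cast
          linarith
        calc c / 2 * L * 2 ^ (2 * L) = (L : ℝ) / 2 * (c * 2 ^ (2 * L)) := by ring
          _ ≤ _ := by gcongr
    _ ≤ ∑ l ∈ Finset.Icc l₀ L, 4 ^ (L - l) * (X.dim l : ℝ) := by
        refine Finset.sum_le_sum fun l hl => ?_
        rw [Finset.mem_Icc] at hl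
        have h3 := h l hl.1
        calc c * (2 : ℝ) ^ (2 * L) = 4 ^ (L - l) * (c * 2 ^ (2 * l)) := by
              rw [mul_left_comm, show (4 : ℝ) = 2 ^ 2 by norm_num, ← pow_mul, ← pow_add, ← mul_add,
                Nat.sub_add_cancel hl.2]
          _ ≤ _ := by gcongr
    _ ≤ _ := by
        refine Finset.sum_le_sum_of_subset_of_nonneg (fun l hl => ?_) fun _ _ _ => by positivity
        rw [Finset.mem_Icc] at hl
        exact Finset.mem_range.2 (by omega)

/-- In dimension three the finest level alone has the full order. -/
lemma exists_le_dofs_three (hd : d = 3) (hD : IsOpen P.D) (hDb : Bornology.IsBounded P.D)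
    (hDn : P.D.Nonempty) :
    ∃ c : ℝ, 0 < c ∧ ∀ᶠ L : ℕ in atTop, c * 2 ^ (3 * L) ≤ (X.dofs L : ℝ) := by
  subst hd
  obtain ⟨c, hc, l₀, h⟩ := X.exists_le_dim hD hDb hDn
  refine ⟨c, hc, ?_⟩
  filter_upwards [eventually_ge_atTop l₀] with L hL
  have h1 := X.sum_sampleSize_mul_dim_le_dofs L
  have h2 : 4 ^ (L - L) * X.dim L ≤ X.dofs L := le_trans (Finset.single_le_sum
    (f := fun l => 4 ^ (L - l) * X.dim l) (fun _ _ => Nat.zero_le _) (Finset.self_mem_range_succ L)) h1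
  rw [Nat.sub_self, pow_zero, one_mul] at h2
  have h3 := h L hL
  exact h3.trans (by exact_mod_cast h2)

end Discretization

/-! ### Errors and costs in terms of the number of degrees of freedom -/

section Asymptotics

variable {n : ℕ → ℝ}

lemma eventually_le_log_two {c : ℝ} (hc : 0 < c)
    (h : ∀ᶠ L : ℕ in atTop, c * L * 2 ^ (2 * L) ≤ n L) :
    ∀ᶠ L : ℕ in atTop, (L : ℝ) ≤ Real.log (n L) := by
  filter_upwards [h, (tendsto_natCast_atTop_atTop (R := ℝ)).eventually_ge_atTop (1 / c)] with L h1 h2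
  rw [div_le_iff₀ hc] at h2
  have h3 : (1 : ℝ) * 2 ^ (2 * L) ≤ n L := le_trans (by gcongr; linarith) h1
  rw [Real.le_log_iff_exp_le (lt_of_lt_of_le (by positivity) h3)]
  refine le_trans ?_ h3
  rw [one_mul, pow_mul, ← Real.exp_one_pow]
  gcongr
  linarith [Real.exp_one_lt_d9]

lemma eventually_le_log_three {c : ℝ} (hc : 0 < c)
    (h : ∀ᶠ L : ℕ in atTop, c * 2 ^ (3 * L) ≤ n L) :
    ∀ᶠ L : ℕ in atTop, (L : ℝ) ≤ Real.log (n L) := by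
  filter_upwards [h, (tendsto_pow_atTop_atTop_of_one_lt (r := (2 : ℝ)) (by norm_num)).eventually_ge_atTop
    (1 / c)] with L h1 h2
  rw [div_le_iff₀ hc] at h2
  have h3 : (1 : ℝ) * 4 ^ L ≤ n L := by
    refine le_trans ?_ h1
    calc (1 : ℝ) * 4 ^ L ≤ (2 ^ L * c) * 4 ^ L := by gcongr
      _ = c * 2 ^ (3 * L) := by
        rw [pow_mul, show (2 : ℝ) ^ 3 = 2 * 4 by norm_num, mul_pow]; ring
  rw [Real.le_log_iff_exp_le (lt_of_lt_of_le (by positivity) h3)]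
  refine le_trans ?_ h3
  rw [one_mul, ← Real.exp_one_pow]
  gcongr
  linarith [Real.exp_one_lt_d9]

lemma log_le_of_le_two {C x : ℝ} (hC : 0 < C) {L : ℕ} (hL : 1 ≤ L) (hx : 0 < x)
    (h : x ≤ C * L * 2 ^ (2 * L)) : Real.log x ≤ (C + 3) * L := by
  have hL' : (1 : ℝ) ≤ L := by exact_mod_cast hL
  have h1 := Real.log_le_log hx h
  rw [Real.log_mul (by positivity) (by positivity), Real.log_mul (by positivity) (by positivity),
    Real.log_pow] at h1
  have h2 := Real.log_le_sub_one_of_pos hC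
  have h3 := Real.log_le_sub_one_of_pos (show (0 : ℝ) < L by linarith)
  have h4 := Real.log_two_lt_d9
  push_cast at h1
  have h5 : 2 * (L : ℝ) * Real.log 2 ≤ 2 * L * 1 := by gcongr; linarith
  nlinarith

/-- For `n ≈ L 4^L` one has `(log n)^(3/2) n^(-1/2) ≈ L 2^(-L)`, with a single factor `L`. -/
lemma isBigO_two {c C A : ℝ} (hc : 0 < c) (hC : 0 < C) (hA : 0 ≤ A) {e : ℕ → ℝ}
    (he0 : ∀ L, 0 ≤ e L) (he : ∀ L : ℕ, 1 ≤ L → e L ≤ A * L / 2 ^ L)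
    (hl : ∀ᶠ L : ℕ in atTop, c * L * 2 ^ (2 * L) ≤ n L)
    (hu : ∀ L : ℕ, 1 ≤ L → n L ≤ C * L * 2 ^ (2 * L)) :
    e =O[atTop] fun L => Real.log (n L) ^ (3 / 2 : ℝ) * n L ^ (-(1 / 2) : ℝ) := by
  refine Asymptotics.IsBigO.of_bound (A * C ^ (1 / 2 : ℝ)) ?_
  filter_upwards [eventually_le_log_two hc hl, hl, eventually_ge_atTop 1] with L h1 h2 hL
  have hL' : (0 : ℝ) < L := by exact_mod_cast hL
  have hn : 0 < n L := lt_of_lt_of_le (by positivity) h2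
  have h3 : (L : ℝ) ^ (3 / 2 : ℝ) ≤ Real.log (n L) ^ (3 / 2 : ℝ) :=
    Real.rpow_le_rpow hL'.le h1 (by norm_num)
  have h4 : (C * L * 2 ^ (2 * L)) ^ (-(1 / 2) : ℝ) ≤ n L ^ (-(1 / 2) : ℝ) :=
    Real.rpow_le_rpow_of_nonpos hn (hu L hL) (by norm_num)
  have e1 : (C * L * 2 ^ (2 * L)) ^ (-(1 / 2) : ℝ) =
      C ^ (-(1 / 2) : ℝ) * (L : ℝ) ^ (-(1 / 2) : ℝ) * (2 ^ L)⁻¹ := by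
    rw [Real.mul_rpow (by positivity) (by positivity), Real.mul_rpow hC.le hL'.le]
    congr 1
    rw [← Real.rpow_natCast, ← Real.rpow_mul (by norm_num), ← Real.rpow_natCast,
      ← Real.rpow_neg (by norm_num)]
    congr 1
    push_cast
    ring
  have e2 : (L : ℝ) ^ (3 / 2 : ℝ) * (L : ℝ) ^ (-(1 / 2) : ℝ) = L := by
    rw [← Real.rpow_add hL']; norm_num
  have e3 : C ^ (1 / 2 : ℝ) * C ^ (-(1 / 2) : ℝ) = 1 := by
    rw [← Real.rpow_add hC]; norm_num
  rw [Real.norm_of_nonneg (he0 L), Real.norm_of_nonneg (mul_nonneg (le_trans (by positivity) h3)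
    (le_trans (by positivity) h4))]
  calc e L ≤ A * L / 2 ^ L := he L hL
    _ = A * C ^ (1 / 2 : ℝ) * ((L : ℝ) ^ (3 / 2 : ℝ) * (C * L * 2 ^ (2 * L)) ^ (-(1 / 2) : ℝ)) := by
      rw [e1]
      calc A * L / 2 ^ L = A * 1 * L * (2 ^ L)⁻¹ := by ring
        _ = A * (C ^ (1 / 2 : ℝ) * C ^ (-(1 / 2) : ℝ)) *
            ((L : ℝ) ^ (3 / 2 : ℝ) * (L : ℝ) ^ (-(1 / 2) : ℝ)) * (2 ^ L)⁻¹ := by rw [e2, e3]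
        _ = _ := by ring
    _ ≤ _ := by gcongr; exact le_trans (by positivity) h3

/-- For `n ≈ 8^L` one has `(log n)^2 n^(-1/3) ≈ L^2 2^(-L)`. -/
lemma isBigO_three {c C A : ℝ} (hc : 0 < c) (hC : 0 < C) (hA : 0 ≤ A) {e : ℕ → ℝ}
    (he0 : ∀ L, 0 ≤ e L) (he : ∀ L : ℕ, 1 ≤ L → e L ≤ A * L / 2 ^ L)
    (hl : ∀ᶠ L : ℕ in atTop, c * 2 ^ (3 * L) ≤ n L)
    (hu : ∀ L : ℕ, n L ≤ C * 2 ^ (3 * L)) :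
    e =O[atTop] fun L => Real.log (n L) ^ 2 * n L ^ (-(1 / 3) : ℝ) := by
  refine Asymptotics.IsBigO.of_bound (A * C ^ (1 / 3 : ℝ)) ?_
  filter_upwards [eventually_le_log_three hc hl, hl, eventually_ge_atTop 1] with L h1 h2 hL
  have hL' : (1 : ℝ) ≤ L := by exact_mod_cast hL
  have hn : 0 < n L := lt_of_lt_of_le (by positivity) h2
  have h3 : (L : ℝ) ≤ Real.log (n L) ^ 2 := by nlinarith
  have h4 : (C * 2 ^ (3 * L)) ^ (-(1 / 3) : ℝ) ≤ n L ^ (-(1 / 3) : ℝ) :=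
    Real.rpow_le_rpow_of_nonpos hn (hu L) (by norm_num)
  have e1 : (C * 2 ^ (3 * L)) ^ (-(1 / 3) : ℝ) = C ^ (-(1 / 3) : ℝ) * (2 ^ L)⁻¹ := by
    rw [Real.mul_rpow hC.le (by positivity)]
    congr 1
    rw [← Real.rpow_natCast, ← Real.rpow_mul (by norm_num), ← Real.rpow_natCast,
      ← Real.rpow_neg (by norm_num)]
    congr 1
    push_cast
    ring
  have e3 : C ^ (1 / 3 : ℝ) * C ^ (-(1 / 3) : ℝ) = 1 := by
    rw [← Real.rpow_add hC]; norm_num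
  rw [Real.norm_of_nonneg (he0 L), Real.norm_of_nonneg (mul_nonneg (le_trans (by positivity) h3)
    (le_trans (by positivity) h4))]
  calc e L ≤ A * L / 2 ^ L := he L hL
    _ = A * C ^ (1 / 3 : ℝ) * (L * (C * 2 ^ (3 * L)) ^ (-(1 / 3) : ℝ)) := by
      rw [e1]
      calc A * L / 2 ^ L = A * 1 * L * (2 ^ L)⁻¹ := by ring
        _ = A * (C ^ (1 / 3 : ℝ) * C ^ (-(1 / 3) : ℝ)) * L * (2 ^ L)⁻¹ := by rw [e3]
        _ = _ := by ring
    _ ≤ _ := by gcongr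

/-- For `n ≈ L 4^L` the powers of `L` in `(log n)^(-1/(2q)) n^(1+1/(2q))` combine to a single `L`. -/
lemma exists_cost_le_two {c C q : ℝ} (hq : 0 < q) (hc : 0 < c) (hC : 0 < C)
    (hl : ∀ᶠ L : ℕ in atTop, c * L * 2 ^ (2 * L) ≤ n L)
    (hu : ∀ L : ℕ, 1 ≤ L → n L ≤ C * L * 2 ^ (2 * L)) :
    ∃ B : ℝ, 0 ≤ B ∧ ∀ᶠ L : ℕ in atTop, (L : ℝ) * (2 : ℝ) ^ ((2 + 1 / q) * L) ≤
      B * (Real.log (n L) ^ (-(1 / (2 * q))) * n L ^ (1 + 1 / (2 * q))) := by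
  set r : ℝ := 1 / (2 * q) with hr
  have hr0 : 0 < r := by positivity
  have hqr : 2 + 1 / q = 2 * (1 + r) := by rw [hr]; field_simp
  refine ⟨(C + 3) ^ r * c ^ (-(1 + r)), by positivity, ?_⟩
  filter_upwards [eventually_le_log_two hc hl, hl, eventually_ge_atTop 1] with L h1 h2 hL
  have hL' : (0 : ℝ) < L := by exact_mod_cast hL
  have hn : 0 < n L := lt_of_lt_of_le (by positivity) h2
  have h3 : ((C + 3) * L) ^ (-r) ≤ Real.log (n L) ^ (-r) :=
    Real.rpow_le_rpow_of_nonpos (by linarith) (log_le_of_le_two hC hL hn (hu L hL)) (by linarith)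
  have h4 : (c * L * 2 ^ (2 * L)) ^ (1 + r) ≤ n L ^ (1 + r) :=
    Real.rpow_le_rpow (by positivity) h2 (by linarith)
  have e1 : (c * L * 2 ^ (2 * L)) ^ (1 + r) =
      c ^ (1 + r) * (L : ℝ) ^ (1 + r) * (2 : ℝ) ^ ((2 + 1 / q) * L) := by
    rw [Real.mul_rpow (by positivity) (by positivity), Real.mul_rpow hc.le hL'.le]
    congr 1
    rw [← Real.rpow_natCast, ← Real.rpow_mul (by norm_num), hqr]
    congr 1
    push_cast
    ring
  have e2 : ((C + 3) * L) ^ (-r) = (C + 3) ^ (-r) * (L : ℝ) ^ (-r) :=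
    Real.mul_rpow (by positivity) hL'.le
  have e3 : (L : ℝ) ^ (-r) * (L : ℝ) ^ (1 + r) = L := by
    rw [← Real.rpow_add hL']
    rw [show -r + (1 + r) = 1 by ring, Real.rpow_one]
  have e4 : c ^ (-(1 + r)) * c ^ (1 + r) = 1 := by
    rw [← Real.rpow_add hc, neg_add_cancel, Real.rpow_zero]
  have e5 : (C + 3) ^ r * (C + 3) ^ (-r) = 1 := by
    rw [← Real.rpow_add (by positivity), add_neg_cancel, Real.rpow_zero]
  calc (L : ℝ) * (2 : ℝ) ^ ((2 + 1 / q) * L)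
      = ((C + 3) ^ r * (C + 3) ^ (-r)) * (c ^ (-(1 + r)) * c ^ (1 + r)) *
        ((L : ℝ) ^ (-r) * (L : ℝ) ^ (1 + r)) * (2 : ℝ) ^ ((2 + 1 / q) * L) := by
        rw [e3, e4, e5]; ring
    _ = (C + 3) ^ r * c ^ (-(1 + r)) *
        (((C + 3) * L) ^ (-r) * (c * L * 2 ^ (2 * L)) ^ (1 + r)) := by rw [e1, e2]; ring
    _ ≤ _ := by gcongr; exact le_trans (by positivity) h3

lemma exists_cost_le_three {c q : ℝ} (hq : 0 < q) (hc : 0 < c)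
    (hl : ∀ᶠ L : ℕ in atTop, c * 2 ^ (3 * L) ≤ n L) :
    ∃ B : ℝ, 0 ≤ B ∧ ∀ᶠ L : ℕ in atTop, (L : ℝ) ^ 2 * (2 : ℝ) ^ ((3 + 1 / q) * L) ≤
      B * (Real.log (n L) ^ 2 * n L ^ (1 + 1 / (3 * q))) := by
  set r : ℝ := 1 / (3 * q) with hr
  have hr0 : 0 < r := by positivity
  have hqr : 3 + 1 / q = 3 * (1 + r) := by rw [hr]; field_simp
  refine ⟨c ^ (-(1 + r)), by positivity, ?_⟩
  filter_upwards [eventually_le_log_three hc hl, hl] with L h1 h2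
  have h4 : (c * 2 ^ (3 * L)) ^ (1 + r) ≤ n L ^ (1 + r) :=
    Real.rpow_le_rpow (by positivity) h2 (by linarith)
  have e1 : (c * 2 ^ (3 * L)) ^ (1 + r) = c ^ (1 + r) * (2 : ℝ) ^ ((3 + 1 / q) * L) := by
    rw [Real.mul_rpow (by positivity) (by positivity)]
    congr 1
    rw [← Real.rpow_natCast, ← Real.rpow_mul (by norm_num), hqr]
    congr 1
    push_cast
    ring
  have e4 : c ^ (-(1 + r)) * c ^ (1 + r) = 1 := by
    rw [← Real.rpow_add hc, neg_add_cancel, Real.rpow_zero]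
  calc (L : ℝ) ^ 2 * (2 : ℝ) ^ ((3 + 1 / q) * L)
      = (c ^ (-(1 + r)) * c ^ (1 + r)) * (L : ℝ) ^ 2 * (2 : ℝ) ^ ((3 + 1 / q) * L) := by
        rw [e4, one_mul]
    _ = c ^ (-(1 + r)) * ((L : ℝ) ^ 2 * (c * 2 ^ (3 * L)) ^ (1 + r)) := by rw [e1]; ring
    _ ≤ _ := by gcongr

end Asymptotics

lemma Problem.meanError_nonneg {d k : ℕ} (P : Problem d k) (Q : ℕ → Param → V P.D) (L : ℕ) :
    0 ≤ P.meanError Q L := integral_nonneg fun _ => abs_nonneg _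

lemma mul_div_two_pow_le_sq {C : ℝ} (hC : 0 ≤ C) {L : ℕ} (hL : 1 ≤ L) :
    C * L / 2 ^ L ≤ C * (L : ℝ) ^ 2 / 2 ^ L := by
  have hL' : (1 : ℝ) ≤ L := by exact_mod_cast hL
  gcongr
  nlinarith

end MLMCMC

end

theorem mainTheorem3 {d k : ℕ} (hd : d = 2 ∨ d = 3) (P : Problem d k)
    (hD : P.ConvexPolyhedralDomain) (hcov : P.cov.PosDef)
    (κ q : ℝ) (hκ : 0 < κ) (hq : 0 < q)
    (hell : P.EllipticityAssumption κ) (hdecay : P.DecayAssumption q)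
    (X : Discretization P) (hFE : X.FEAssumption) (hreg : P.RegularityAssumption) :
    Integrable (fun u => P.qoi (P.solution u)) (P.posterior P.solution) ∧
    (∃ C : ℝ, ∀ L : ℕ, 1 ≤ L →
      Integrable (P.absError (X.levels q) L) noisesLaw ∧
      P.meanError (X.levels q) L ≤ C * (L : ℝ) ^ 2 / 2 ^ L) ∧
    ∃ N : ℕ → ℕ,
      (∀ (S : Solver X) (L : ℕ) (ω : ℕ → Noise), (S.run q L ω).dofs = N L) ∧
      (d = 2 → ∃ C : ℝ, ∀ L : ℕ, 1 ≤ L → (N L : ℝ) ≤ C * L * 2 ^ (2 * L)) ∧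
      (d = 3 → ∃ C : ℝ, ∀ L : ℕ, 1 ≤ L → (N L : ℝ) ≤ C * 2 ^ (3 * L)) ∧
      (d = 2 → P.meanError (X.levels q) =O[atTop]
        fun L => Real.log (N L) ^ (3 / 2 : ℝ) * (N L : ℝ) ^ (-(1 / 2) : ℝ)) ∧
      (d = 3 → P.meanError (X.levels q) =O[atTop]
        fun L => Real.log (N L) ^ 2 * (N L : ℝ) ^ (-(1 / 3) : ℝ)) ∧
      ∀ S : Solver X, S.IsLinearScaling q →
        (∀ (L : ℕ) (ω : ℕ → Noise), (S.run q L ω).val = P.estimator (S.levels q) L ω) ∧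
        (∃ C : ℝ, ∀ L : ℕ, 1 ≤ L →
          Integrable (P.absError (S.levels q) L) noisesLaw ∧
          P.meanError (S.levels q) L ≤ C * (L : ℝ) ^ 2 / 2 ^ L) ∧
        (d = 2 → P.meanError (S.levels q) =O[atTop]
          fun L => Real.log (N L) ^ (3 / 2 : ℝ) * (N L : ℝ) ^ (-(1 / 2) : ℝ)) ∧
        (d = 3 → P.meanError (S.levels q) =O[atTop]
          fun L => Real.log (N L) ^ 2 * (N L : ℝ) ^ (-(1 / 3) : ℝ)) ∧
        (∃ C : ℝ, ∀ L : ℕ, 1 ≤ L → ∀ ω : ℕ → Noise,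
          ((S.run q L ω).flops : ℝ) ≤
            C * (L : ℝ) ^ (d - 1) * (2 : ℝ) ^ (((d : ℝ) + 1 / q) * (L : ℝ))) ∧
        (d = 2 → ∃ C : ℝ, ∀ᶠ L in atTop, ∀ ω : ℕ → Noise,
          ((S.run q L ω).flops : ℝ) ≤
            C * (Real.log (N L) ^ (-(1 / (2 * q))) * (N L : ℝ) ^ (1 + 1 / (2 * q)))) ∧
        (d = 3 → ∃ C : ℝ, ∀ᶠ L in atTop, ∀ ω : ℕ → Noise,
          ((S.run q L ω).flops : ℝ) ≤
            C * (Real.log (N L) ^ 2 * (N L : ℝ) ^ (1 + 1 / (3 * q)))) := by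
  have hDo := hD.isOpen
  have hDb := hD.isBounded
  obtain ⟨hint, A, hA, hAerr⟩ := P.exists_meanError_galerkin_le hd hD hcov hκ hq hell hdecay X hFE
  have two : ∀ {Q : ℕ → Param → V P.D} {A : ℝ}, 0 ≤ A →
      (∀ L : ℕ, 1 ≤ L → P.meanError Q L ≤ A * L / 2 ^ L) → d = 2 → P.meanError Q =O[atTop]
        fun L => Real.log (X.dofs L) ^ (3 / 2 : ℝ) * (X.dofs L : ℝ) ^ (-(1 / 2) : ℝ) := by
    intro Q A hA h hd2
    obtain ⟨c, hc, hl⟩ := X.exists_le_dofs_two hd2 hDo hDb hD.1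
    obtain ⟨C, hC, hu⟩ := X.exists_dofs_le_two hd2 hDo
    exact isBigO_two hc hC hA (P.meanError_nonneg Q) h hl hu
  have three : ∀ {Q : ℕ → Param → V P.D} {A : ℝ}, 0 ≤ A →
      (∀ L : ℕ, 1 ≤ L → P.meanError Q L ≤ A * L / 2 ^ L) → d = 3 → P.meanError Q =O[atTop]
        fun L => Real.log (X.dofs L) ^ 2 * (X.dofs L : ℝ) ^ (-(1 / 3) : ℝ) := by
    intro Q A hA h hd3
    obtain ⟨c, hc, hl⟩ := X.exists_le_dofs_three hd3 hDo hDb hD.1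
    obtain ⟨C, hC, hu⟩ := X.exists_dofs_le_three hd3 hDo
    exact isBigO_three hc hC hA (P.meanError_nonneg Q) h hl hu
  refine ⟨hint, ⟨A, fun L hL => ⟨(hAerr L hL).1,
    (hAerr L hL).2.trans (mul_div_two_pow_le_sq hA hL)⟩⟩, X.dofs, fun S L ω => S.dofs_run q L ω,
    fun hd2 => ?_, fun hd3 => ?_, two hA fun L hL => (hAerr L hL).2,
    three hA fun L hL => (hAerr L hL).2, fun S hS => ?_⟩
  · obtain ⟨C, _, hu⟩ := X.exists_dofs_le_two hd2 hDo
    exact ⟨C, hu⟩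
  · obtain ⟨C, _, hu⟩ := X.exists_dofs_le_three hd3 hDo
    exact ⟨C, fun L _ => hu L⟩
  obtain ⟨B, hB, hBerr⟩ :=
    P.exists_meanError_solver_le hd hD hcov hκ hq hell hdecay X hFE S hS
  obtain ⟨F, hF, hflops⟩ := S.exists_flops_run_le hd hDo hq hFE hS
  refine ⟨S.val_run q, ⟨B, fun L hL => ⟨(hBerr L hL).1,
    (hBerr L hL).2.trans (mul_div_two_pow_le_sq hB hL)⟩⟩, two hB fun L hL => (hBerr L hL).2,
    three hB fun L hL => (hBerr L hL).2, ⟨F, hflops⟩, fun hd2 => ?_, fun hd3 => ?_⟩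
  · obtain ⟨c, hc, hl⟩ := X.exists_le_dofs_two hd2 hDo hDb hD.1
    obtain ⟨C, hC, hu⟩ := X.exists_dofs_le_two hd2 hDo
    obtain ⟨G, _, hcost⟩ := exists_cost_le_two hq hc hC hl hu
    refine ⟨F * G, ?_⟩
    filter_upwards [hcost, eventually_ge_atTop 1] with L h1 hL ω
    refine (hflops L hL ω).trans ?_
    have e1 : (d : ℝ) = 2 := by rw [hd2]; norm_num
    have e2 : d - 1 = 1 := by omega
    rw [e1, e2, pow_one, mul_assoc, mul_assoc]
    exact mul_le_mul_of_nonneg_left h1 hF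
  · obtain ⟨c, hc, hl⟩ := X.exists_le_dofs_three hd3 hDo hDb hD.1
    obtain ⟨G, _, hcost⟩ := exists_cost_le_three hq hc hl
    refine ⟨F * G, ?_⟩
    filter_upwards [hcost, eventually_ge_atTop 1] with L h1 hL ω
    refine (hflops L hL ω).trans ?_
    have e1 : (d : ℝ) = 3 := by rw [hd3]; norm_num
    have e2 : d - 1 = 2 := by omega
    rw [e1, e2, mul_assoc, mul_assoc]
    exact mul_le_mul_of_nonneg_left h1 hF
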